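/- **Setting.** Let $r:\mathbb R^d\to\mathbb R$ be convex and $\Phi=F+r$ with $\Phi^*=\inf\Phi>-\infty$, where - $(\Sigma^2)$: $F(x)=\frac1N\sum_{k=1}^N f_k\big(\frac1n\sum_{i=1}^n g_i(x)\big)$ with $n,N\ge1$, or - $(\mathbb E^2)$: $F=f\circ g$ with $f(y)=\mathbb E_\eta f_\eta(y)$, $g(x)=\mathbb E_\xi g_\xi(x)$. Every $f_\eta:\mathbb R^p\to\mathbb R$ is differentiable and $l_f$-Lipschitz with $L_f$-Lipschitz gradient. Every $g_\xi:\mathbb R^d\to\mathbb R^p$ is differentiable and $l_g$-Lipschitz, and its Jacobian $g_\xi'$ is $L_g$-Lipschitz in the Frobenius norm. For $(\mathbb E^2)$, moreover, for all $x,y$: $\mathbb E\|g_\xi(x)-g(x)\|^2\le\sigma_g^2$, $\mathbb E\|g'_\xi(x)-g'(x)\|_F^2\le\sigma_{g'}^2$, $\mathbb E\|\nabla f_\eta(y)-\nabla f(y)\|^2\le\sigma_{f'}^2$, with $\sigma_g,\sigma_{g'},\sigma_{f'}>0$. Let $L_F=l_g^2L_f+l_fL_g>0$, $\operatorname{prox}_{\lambda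 r}(x)=\arg\min_u\{r(u)+\frac1{2\lambda}\|u-x\|^2\}$ and $\mathcal G_\lambda(x)=\frac1\lambda\big(x-\operatorname{prox}_{\lambda r}(x-\lambda\nabla F(x))\big)$. **Algorithm (MVRC-2)** with input $x_0$, $T\ge1$, $\tau\ge1$, $\epsilon>0$, $\alpha_t=\frac2{t+1}$, $\beta$, $\lambda_t$. Put $y_0=x_0$. For $t=0,\dots,T-1$ let $z_t=(1-\alpha_{t+1})y_t+\alpha_{t+1}x_t$ and take batches $\mathcal A_t,\mathcal A_t'$ of indices $\xi$ and $\mathcal B_t$ of indices $\eta$. If $\tau\mid t$, put $$\tilde g_t=\tfrac1{|\mathcal A_t|}\sum_{\xi\in\mathcal A_t}g_\xi(z_t),\quad \tilde g_t'=\tfrac1{|\mathcal A_t'|}\sum_{\xi\in\mathcal A_t'}g'_\xi(z_t),\quad \tilde f_t'=\tfrac1{|\mathcal B_t|}\sum_{\eta\in\mathcal B_t}\nabla f_\eta(\tilde g_t);$$ otherwise $$\tilde g_t=\tilde g_{t-1}+\tfrac1{|\mathcal A_t|}\sum_{\xi\in\mathcal A_t}(g_\xi(z_t)-g_\xi(z_{t-1})),\quad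 \tilde g'_t=\tilde g'_{t-1}+\tfrac1{|\mathcal A'_t|}\sum_{\xi\in\mathcal A'_t}(g'_\xi(z_t)-g'_\xi(z_{t-1})),$$ $$\tilde f'_t=\tilde f'_{t-1}+\tfrac1{|\mathcal B_t|}\sum_{\eta\in\mathcal B_t}(\nabla f_\eta(\tilde g_t)-\nabla f_\eta(\tilde g_{t-1})).$$ Then $\tilde x_{t+1}=\operatorname{prox}_{\lambda_tr}(x_t-\lambda_t\tilde g_t'^{\top}\tilde f'_t)$, $\theta_t=\min\{\epsilon\lambda_t/\|\tilde x_{t+1}-x_t\|,\frac12\}$, $x_{t+1}=(1-\theta_t)x_t+\theta_t\tilde x_{t+1}$, $y_{t+1}=z_t+\frac{\beta}{\lambda_t}(x_{t+1}-x_t)$. The output is $z_\zeta$ with $\zeta$ uniform on $\{0,\dots,T-1\}$ and independent of the batches. All batches are independent. A batch consists of i.i.d. samples in $(\mathbb E^2)$. In $(\Sigma^2)$ it is the full index set when $\tau\mid t$, and otherwise a uniform sample, with or without replacement. **Theorem.** Fix constants $0<c\le1\le C$ and let $c/L_F\le\beta\le1/L_F$, $\lambda_t\in[\beta,(1+\alpha_t)\beta]$.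 1. *Problem $(\Sigma^2)$.* There is a constant $K$, depending only on $c,C$, such that the following holds if $n\le CN^2$, $N\le Cn^2$, $0<\epsilon<l_fl_g/\sqrt{\max\{N,n\}}$, $\tau=\lfloor\sqrt{\max\{N,n\}}\rfloor$ and the batch sizes for $\tau\nmid t$ lie in $[\tau/C,C\tau]$. The output satisfies $$\mathbb E\|\mathcal G_{\lambda_\zeta}(z_\zeta)\|\le K\Big(\epsilon+\frac{L_F(\Phi(x_0)-\Phi^*)}{\epsilon T}\Big).$$ Moreover, for every such $\epsilon$ there are an input accuracy $\epsilon'\in(0,\epsilon]$ and a $T\ge1$ for which every such run, made with $\epsilon'$ in place of $\epsilon$, has $\mathbb E\|\mathcal G_{\lambda_\zeta}(z_\zeta)\|\le\epsilon$ and uses at most $K\big(N+n+\sqrt{\max\{N,n\}}\,L_F(\Phi(x_0)-\Phi^*)\,\epsilon^{-2}\big)$ evaluations of $g_i,g_i',\nabla f_k$. 2. *Problem $(\mathbb E^2)$.* There is a constant $K$, depending only on $c,C$, such that the following holds if $0<\epsilon\le l_fl_g$, $\tau=\lfloor l_fl_g\epsilon^{-1}\rfloor$, the sizes $|\mathcal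 A_t|,|\mathcal A'_t|,|\mathcal B_t|$ for $\tau\mid t$ are positive and lie in $[s/C,C(s+1)]$ with $s=L_f^2l_g^2\sigma_g^2\epsilon^{-2}$, $l_f^2\sigma_{g'}^2\epsilon^{-2}$, $l_g^2\sigma_{f'}^2\epsilon^{-2}$, respectively, and all batch sizes for $\tau\nmid t$ lie in $[\tau/C,C\tau]$. The output satisfies $$\mathbb E\|\mathcal G_{\lambda_\zeta}(z_\zeta)\|\le K\Big(\epsilon+\frac{L_F(\Phi(x_0)-\Phi^*)}{\epsilon T}\Big).$$ Moreover, there is a constant $K'$, depending only on $c,C,l_f,l_g,L_f,L_g,\sigma_g,\sigma_{g'},\sigma_{f'}$ and an upper bound of $\Phi(x_0)-\Phi^*$, such that for every $0<\epsilon\le l_fl_g$ there are an input accuracy $\epsilon'\in(0,\epsilon]$ and a $T\ge1$ for which every such run, made with $\epsilon'$ in place of $\epsilon$, has $\mathbb E\|\mathcal G_{\lambda_\zeta}(z_\zeta)\|\le\epsilon$ and uses at most $K'\epsilon^{-3}$ evaluations of $g_\xi,g'_\xi,\nabla f_\eta$. -/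

import Mathlib

open MeasureTheory ProbabilityTheory

namespace MVRC

noncomputable section

/-- The Euclidean space of dimension `d`. -/
abbrev Vec (d : ℕ) : Type := EuclideanSpace ℝ (Fin d)

/-- The Frobenius norm of a linear map (that is, of its matrix in the standard bases). -/
def frobNorm {d p : ℕ} (M : Vec d →L[ℝ] Vec p) : ℝ :=
  Real.sqrt (∑ j : Fin d, ‖M (EuclideanSpace.single j 1)‖ ^ 2)

/-- The proximal mapping: the minimizer of `u ↦ r u + ‖u - x‖² / (2 lam)`
(it exists and is unique when `r` is convex and real valued and `lam > 0`). -/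
def prox {d : ℕ} (lam : ℝ) (r : Vec d → ℝ) (x : Vec d) : Vec d :=
  Classical.epsilon fun u =>
    ∀ v, r u + 1 / (2 * lam) * ‖u - x‖ ^ 2 ≤ r v + 1 / (2 * lam) * ‖v - x‖ ^ 2

/-- The generalized gradient mapping of `F + r` with parameter `lam`. -/
def gradMap {d : ℕ} (lam : ℝ) (F r : Vec d → ℝ) (x : Vec d) : Vec d :=
  (1 / lam) • (x - prox lam r (x - lam • gradient F x))

/-! ### The algorithm -/

/-- The samples drawn in one iteration: `m` indices for the values of `g`, `m'` indices for the
Jacobians of `g`, and `k` indices for the gradients of `f`. -/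
abbrev Batch (I J : Type*) (m m' k : ℕ) : Type _ := (Fin m → I) × (Fin m' → I) × (Fin k → J)

/-- The average over a batch. -/
def batchMean {V : Type*} [AddCommGroup V] [Module ℝ V] {m : ℕ} (v : Fin m → V) : V :=
  (m : ℝ)⁻¹ • ∑ i, v i

/-- The parameters of the algorithm: period `τ`, accuracy `ε`, momentum parameters `α t`, and
step sizes `β t`, `lam t`. -/
structure Params where
  τ : ℕ
  ε : ℝ
  α : ℕ → ℝ
  β : ℕ → ℝ
  lam : ℕ → ℝ

/-- The quantities of iteration `t`: the points `x_t`, `y_t`, `z_t` and the estimates of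
`g (z_t)`, of the Jacobian of `g` at `z_t`, and of the gradient of `f`. -/
structure State (d p : ℕ) where
  x : Vec d
  y : Vec d
  z : Vec d
  gEst : Vec p
  jacEst : Vec d →L[ℝ] Vec p
  gradEst : Vec p

/-- First half of iteration `t`: from `x_t`, `y_t` compute `z_t` and the three estimates;
`prev` holds the quantities of iteration `t - 1` (not used when `τ` divides `t`). -/
def estimate {I J : Type*} {d p m m' k : ℕ} (par : Params) (g : I → Vec d → Vec p)
    (f : J → Vec p → ℝ) (t : ℕ) (S : Batch I J m m' k) (x y : Vec d) (prev : State d p) :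
    State d p :=
  let z : Vec d := (1 - par.α (t + 1)) • y + par.α (t + 1) • x
  if t % par.τ = 0 then
    let gE : Vec p := batchMean fun i => g (S.1 i) z
    { x := x
      y := y
      z := z
      gEst := gE
      jacEst := batchMean fun i => fderiv ℝ (g (S.2.1 i)) z
      gradEst := batchMean fun i => gradient (f (S.2.2 i)) gE }
  else
    let gE : Vec p := prev.gEst + batchMean fun i => g (S.1 i) z - g (S.1 i) prev.z
    { x := x
      y := y
      z := z
      gEst := gE
      jacEst := prev.jacEst +
        batchMean fun i => fderiv ℝ (g (S.2.1 i)) z - fderiv ℝ (g (S.2.1 i)) prev.z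
      gradEst := prev.gradEst +
        batchMean fun i => gradient (f (S.2.2 i)) gE - gradient (f (S.2.2 i)) prev.gEst }

/-- The proximal step `x̃_{t+1}`. -/
def proxStep {d p : ℕ} (par : Params) (r : Vec d → ℝ) (t : ℕ) (s : State d p) : Vec d :=
  prox (par.lam t) r (s.x - par.lam t • ContinuousLinearMap.adjoint s.jacEst s.gradEst)

/-- The normalized step length `θ_t`. (If `x̃_{t+1} = x_t` its value is irrelevant.) -/
def theta {d p : ℕ} (par : Params) (r : Vec d → ℝ) (t : ℕ) (s : State d p) : ℝ :=
  min (par.ε * par.lam t / ‖proxStep par r t s - s.x‖) (1 / 2)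

/-- The next iterate `x_{t+1}`. -/
def nextX {d p : ℕ} (par : Params) (r : Vec d → ℝ) (t : ℕ) (s : State d p) : Vec d :=
  (1 - theta par r t s) • s.x + theta par r t s • proxStep par r t s

/-- The next iterate `y_{t+1}`. -/
def nextY {d p : ℕ} (par : Params) (r : Vec d → ℝ) (t : ℕ) (s : State d p) : Vec d :=
  s.z + (par.β t / par.lam t) • (nextX par r t s - s.x)

/-- The algorithm started at `x₀`, run on the sample path `S`. -/
def run {I J : Type*} {d p : ℕ} {a a' b : ℕ → ℕ} (par : Params) (g : I → Vec d → Vec p)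
    (f : J → Vec p → ℝ) (r : Vec d → ℝ) (x₀ : Vec d)
    (S : (t : ℕ) → Batch I J (a t) (a' t) (b t)) : ℕ → State d p
  | 0 => estimate par g f 0 (S 0) x₀ x₀ ⟨x₀, x₀, x₀, 0, 0, 0⟩
  | t + 1 =>
      estimate par g f (t + 1) (S (t + 1))
        (nextX par r t (run par g f r x₀ S t)) (nextY par r t (run par g f r x₀ S t))
        (run par g f r x₀ S t)

/-- The number of evaluations of the sample functions `g_ξ`, `g_ξ'`, `∇f_η` in the iterations
`0, …, T - 1`: one evaluation for every sample when `τ` divides `t`, and two otherwise. -/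
def evalCount (τ : ℕ) (a a' b : ℕ → ℕ) (T : ℕ) : ℕ :=
  ∑ t ∈ Finset.range T, (if t % τ = 0 then 1 else 2) * (a t + a' t + b t)

/-! ### Assumptions on the objective function -/

/-- Every `f_η` is differentiable and `lf`-Lipschitz, with `Lf`-Lipschitz gradient. -/
structure SmoothLoss {J : Type*} {p : ℕ} (f : J → Vec p → ℝ) (lf Lf : ℝ) : Prop where
  nonneg : 0 ≤ lf ∧ 0 ≤ Lf
  diff : ∀ η, Differentiable ℝ (f η)
  lip : ∀ η y y', |f η y - f η y'| ≤ lf * ‖y - y'‖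
  grad_lip : ∀ η y y', ‖gradient (f η) y - gradient (f η) y'‖ ≤ Lf * ‖y - y'‖

/-- Every `g_ξ` is differentiable and `lg`-Lipschitz, with `Lg`-Lipschitz Jacobian. -/
structure SmoothMap {I : Type*} {d p : ℕ} (g : I → Vec d → Vec p) (lg Lg : ℝ) : Prop where
  nonneg : 0 ≤ lg ∧ 0 ≤ Lg
  diff : ∀ ξ, Differentiable ℝ (g ξ)
  lip : ∀ ξ x x', ‖g ξ x - g ξ x'‖ ≤ lg * ‖x - x'‖
  jac_lip : ∀ ξ x x', frobNorm (fderiv ℝ (g ξ) x - fderiv ℝ (g ξ) x') ≤ Lg * ‖x - x'‖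

/-- The regularizer is convex and the objective `F + r` is bounded below. -/
structure RegularObjective {d : ℕ} (F r : Vec d → ℝ) : Prop where
  convex : ConvexOn ℝ Set.univ r
  bddBelow : BddBelow (Set.range fun x => F x + r x)

/-- The Lipschitz constant `L_F` of the gradient of the composition. -/
def LF (lf lg Lf Lg : ℝ) : ℝ := lg ^ 2 * Lf + lf * Lg

/-- The initial gap `Φ(x₀) - Φ*`, where `Φ = F + r`. -/
def gap {d : ℕ} (F r : Vec d → ℝ) (x₀ : Vec d) : ℝ := (F x₀ + r x₀) - ⨅ x, (F x + r x)

/-- The smooth part of the double finite-sum objective. -/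
def sumObj {d p n N : ℕ} (g : Fin n → Vec d → Vec p) (f : Fin N → Vec p → ℝ) (x : Vec d) : ℝ :=
  (1 / (N : ℝ)) * ∑ k, f k ((1 / (n : ℝ)) • ∑ i, g i x)

/-- The mean of the inner mappings. -/
def meanMap {I : Type*} [MeasurableSpace I] {d p : ℕ} (μ : Measure I) (g : I → Vec d → Vec p)
    (x : Vec d) : Vec p := ∫ ξ, g ξ x ∂μ

/-- The mean of the outer functions. -/
def meanLoss {J : Type*} [MeasurableSpace J] {p : ℕ} (ν : Measure J) (f : J → Vec p → ℝ)
    (y : Vec p) : ℝ := ∫ η, f η y ∂ν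

/-- The smooth part of the double expectation objective. -/
def expObj {I J : Type*} [MeasurableSpace I] [MeasurableSpace J] {d p : ℕ} (μ : Measure I)
    (ν : Measure J) (g : I → Vec d → Vec p) (f : J → Vec p → ℝ) (x : Vec d) : ℝ :=
  meanLoss ν f (meanMap μ g x)

/-- The expectations that define the double expectation problem make sense, and the samples have
bounded variance. -/
structure BoundedVariance {I J : Type*} [MeasurableSpace I] [MeasurableSpace J] {d p : ℕ}
    (μ : Measure I) (ν : Measure J) (g : I → Vec d → Vec p) (f : J → Vec p → ℝ)
    (σg σg' σf' : ℝ) : Prop where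
  pos : 0 < σg ∧ 0 < σg' ∧ 0 < σf'
  meas_g : ∀ x, Measurable fun ξ => g ξ x
  meas_f : ∀ y, Measurable fun η => f η y
  int_g : ∀ x, Integrable (fun ξ => g ξ x) μ
  int_f : ∀ y, Integrable (fun η => f η y) ν
  var_g : ∀ x, Integrable (fun ξ => ‖g ξ x - meanMap μ g x‖ ^ 2) μ ∧
    ∫ ξ, ‖g ξ x - meanMap μ g x‖ ^ 2 ∂μ ≤ σg ^ 2
  var_jac : ∀ x,
    Integrable (fun ξ => frobNorm (fderiv ℝ (g ξ) x - fderiv ℝ (meanMap μ g) x) ^ 2) μ ∧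
    ∫ ξ, frobNorm (fderiv ℝ (g ξ) x - fderiv ℝ (meanMap μ g) x) ^ 2 ∂μ ≤ σg' ^ 2
  var_grad : ∀ y,
    Integrable (fun η => ‖gradient (f η) y - gradient (meanLoss ν f) y‖ ^ 2) ν ∧
    ∫ η, ‖gradient (f η) y - gradient (meanLoss ν f) y‖ ^ 2 ∂ν ≤ σf' ^ 2

/-! ### Hyperparameters and random samples -/

/-- The diminishing momentum parameters. -/
def alpha (t : ℕ) : ℝ := 2 / ((t : ℝ) + 1)

/-- Parameters of the algorithm with diminishing momentum and constant `β`. -/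
def dimParams (τ : ℕ) (ε β : ℝ) (lam : ℕ → ℝ) : Params where
  τ := τ
  ε := ε
  α := alpha
  β := fun _ => β
  lam := lam

/-- `β` is of order `1 / L` and `lam t` lies in `[β, (1 + α t) β]`. -/
structure StepSizes (c L : ℝ) (T : ℕ) (β : ℝ) (lam : ℕ → ℝ) : Prop where
  pos : 0 < β
  lower : c ≤ β * L
  upper : β * L ≤ 1
  lam_mem : ∀ t < T, lam t ∈ Set.Icc β ((1 + alpha t) * β)

/-- `m` is a positive batch size of order `⌈s⌉`. -/
def BatchOrder (C s : ℝ) (m : ℕ) : Prop := 1 ≤ m ∧ s / C ≤ m ∧ (m : ℝ) ≤ C * (s + 1)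

/-- `m` is a batch size of order `τ`. -/
def BatchOrderTau (C : ℝ) (τ m : ℕ) : Prop := (τ : ℝ) / C ≤ m ∧ (m : ℝ) ≤ C * τ

/-- The batches of different iterations are independent, and the output index `ζ` is uniform on
`{0, …, T - 1}` and independent of the batches. -/
structure IndependentSamples {Ω I J : Type*} [MeasurableSpace Ω] [MeasurableSpace I]
    [MeasurableSpace J] (P : Measure Ω) (T : ℕ) {a a' b : ℕ → ℕ}
    (S : (t : ℕ) → Ω → Batch I J (a t) (a' t) (b t)) (ζ : Ω → Fin T) : Prop where
  meas : ∀ t < T, Measurable (S t)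
  indep : iIndepFun (fun t : Fin T => S t) P
  meas_ζ : Measurable ζ
  law_ζ : P.map ζ = uniformOn Set.univ
  indep_ζ : IndepFun ζ (fun ω (t : Fin T) => S t ω) P

/-- The two ways to sample a batch of indices from a finite set. -/
inductive Sampling where
  | withReplacement
  | withoutReplacement

/-- The law of `m` uniform samples from `n` indices, with or without replacement. -/
def batchLaw (mode : Sampling) (n m : ℕ) : Measure (Fin m → Fin n) :=
  match mode with
  | .withReplacement => uniformOn Set.univ
  | .withoutReplacement => uniformOn {s | Function.Injective s}

/-- The period in the double finite-sum problem. -/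
def sumPeriod (n N : ℕ) : ℕ := ⌊Real.sqrt (max N n : ℕ)⌋₊

/-- Admissible hyperparameters and samples for the double finite-sum problem: the full index sets
when the period divides `t`, and random batches of order `τ` otherwise. -/
structure SumRun {Ω : Type*} [MeasurableSpace Ω] (P : Measure Ω) (n N : ℕ) (c C L : ℝ)
    (T : ℕ) (β : ℝ) (lam : ℕ → ℝ) {a a' b : ℕ → ℕ} (mode : Sampling)
    (S : (t : ℕ) → Ω → Batch (Fin n) (Fin N) (a t) (a' t) (b t)) (ζ : Ω → Fin T) : Prop where
  steps : StepSizes c L T β lam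
  samples : IndependentSamples P T S ζ
  size_reset : ∀ t < T, t % sumPeriod n N = 0 → a t = n ∧ a' t = n ∧ b t = N
  full_reset : ∀ t < T, t % sumPeriod n N = 0 → ∀ ω, Function.Bijective (S t ω).1 ∧
    Function.Bijective (S t ω).2.1 ∧ Function.Bijective (S t ω).2.2
  size : ∀ t < T, t % sumPeriod n N ≠ 0 → BatchOrderTau C (sumPeriod n N) (a t) ∧
    BatchOrderTau C (sumPeriod n N) (a' t) ∧ BatchOrderTau C (sumPeriod n N) (b t)
  law : ∀ t < T, t % sumPeriod n N ≠ 0 → P.map (S t) =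
    (batchLaw mode n (a t)).prod ((batchLaw mode n (a' t)).prod (batchLaw mode N (b t)))

/-- The period in the double expectation problem. -/
def expPeriod (lf lg ε : ℝ) : ℕ := ⌊lf * lg / ε⌋₊

/-- Admissible hyperparameters and samples for the double expectation problem: independent
samples from `μ` and `ν`. -/
structure ExpRun {Ω I J : Type*} [MeasurableSpace Ω] [MeasurableSpace I] [MeasurableSpace J]
    (P : Measure Ω) (μ : Measure I) (ν : Measure J) (c C lf lg Lf Lg σg σg' σf' ε : ℝ)
    (T : ℕ) (β : ℝ) (lam : ℕ → ℝ) {a a' b : ℕ → ℕ}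
    (S : (t : ℕ) → Ω → Batch I J (a t) (a' t) (b t)) (ζ : Ω → Fin T) : Prop where
  steps : StepSizes c (LF lf lg Lf Lg) T β lam
  samples : IndependentSamples P T S ζ
  size_reset : ∀ t < T, t % expPeriod lf lg ε = 0 →
    BatchOrder C (Lf ^ 2 * lg ^ 2 * σg ^ 2 / ε ^ 2) (a t) ∧
    BatchOrder C (lf ^ 2 * σg' ^ 2 / ε ^ 2) (a' t) ∧
    BatchOrder C (lg ^ 2 * σf' ^ 2 / ε ^ 2) (b t)
  size : ∀ t < T, t % expPeriod lf lg ε ≠ 0 → BatchOrderTau C (expPeriod lf lg ε) (a t) ∧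
    BatchOrderTau C (expPeriod lf lg ε) (a' t) ∧ BatchOrderTau C (expPeriod lf lg ε) (b t)
  law : ∀ t < T, P.map (S t) =
    (Measure.pi fun _ => μ).prod ((Measure.pi fun _ => μ).prod (Measure.pi fun _ => ν))

/-- The norm of the generalized gradient mapping at the output `z_ζ`, as a random variable. -/
def outputNorm {Ω I J : Type*} {d p : ℕ} {a a' b : ℕ → ℕ} (par : Params)
    (g : I → Vec d → Vec p) (f : J → Vec p → ℝ) (F r : Vec d → ℝ) (x₀ : Vec d) {T : ℕ}
    (S : (t : ℕ) → Ω → Batch I J (a t) (a' t) (b t)) (ζ : Ω → Fin T) (ω : Ω) : ℝ :=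
  ‖gradMap (par.lam (ζ ω)) F r (run par g f r x₀ (fun t => S t ω) (ζ ω)).z‖

end

end MVRC

namespace MVRC

noncomputable section

/-! The normalization in `theta` makes every move of the iterates deterministic in size: `x` moves
by at most `ε * lam t`. The momentum recursion then keeps `z` within `2 * β * ε` of `x`, and
consecutive points `z` within `3 * β * ε` of each other, whatever the random estimates are
(`IsTrajectory.norm_z_sub_x_le`, `IsTrajectory.norm_z_succ_sub_le`).

An inexact proximal gradient step of this kind decreases the objective by about `ε / 4` times the
length of the full proximal step, up to `ε * lam` times the error of the gradient estimate and a
term of order `ε ^ 2 * lam` (`normalized_step_descent`). Telescoping bounds the sum of the proximal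
steps, and nonexpansiveness of `prox` turns these into the stationarity measure at `z`
(`IsTrajectory.sum_norm_gradMap_le`). What remains is to show that the expected gradient error is of
order `ε`.

That error is at most `3 / 2 * ε` plus `1 / ε` times a weighted sum of three squared errors: of the
inner value, of its Jacobian and of the outer gradient (`norm_estimate_sub_gradient_le`).
Conditionally on the past, each correction between resets adds a centered term to the error. Batch
entries are pairwise non-positively correlated (independence, or sampling without replacement), so
one correction raises the mean square error by at most a constant times `(l * β * ε) ^ 2 / m`, where
`l` is the relevant Lipschitz constant. As `m` is at least `τ / C` and fewer than `τ` corrections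
follow a reset, the accumulated error is of order `C * (l * β * ε) ^ 2`
(`StochasticComposition.lintegral_err_run_le`), and `β * L_F ≤ 1` makes its weighted size of order
`C * ε ^ 2`. The reset errors are zero for full batches, and of the same order for the prescribed
sample sizes.

`StochasticComposition.integral_outputNorm_le` combines these facts for arbitrary sampling laws;
finite sums enter as expectations under uniform measures. For the complexity, the algorithm runs
with accuracy `ε / (2 * K)` for about `4 * K ^ 2 * A / ε ^ 2` iterations, `A` being `L_F` times the
initial gap, and the cost of the resets is spread over their periods. -/

/-! ### The proximal mapping -/

section Prox

variable {d : ℕ} {r : Vec d → ℝ} {lam : ℝ}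

/-- A finite convex function on a Euclidean space decreases at most linearly. -/
lemma exists_linear_lower_bound (hr : ConvexOn ℝ Set.univ r) (x : Vec d) :
    ∃ b : ℝ, 0 ≤ b ∧ ∀ u, r x - b - b * ‖u - x‖ ≤ r u := by
  have hcont : Continuous r := hr.locallyLipschitz.continuous
  obtain ⟨m, hm⟩ := (isCompact_closedBall x 1).bddBelow_image hcont.continuousOn
  have hm' : ∀ u, ‖u - x‖ ≤ 1 → m ≤ r u := fun u hu =>
    hm ⟨u, by simpa [dist_eq_norm] using hu, rfl⟩
  have hmx : m ≤ r x := hm' x (by simp)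
  -- The slope is the largest possible drop of `r` on the unit ball around `x`. Farther away,
  -- convexity is applied at the point of the segment from `x` to `u` at distance 1 from `x`, so a
  -- steeper drop would already be visible inside the ball.
  refine ⟨r x - m, by linarith, fun u => ?_⟩
  rcases le_or_gt ‖u - x‖ 1 with hu | hu
  · have := hm' u hu
    nlinarith [norm_nonneg (u - x)]
  · have hpos : 0 < ‖u - x‖ := by linarith
    set s := ‖u - x‖⁻¹ with hs
    have hs0 : 0 < s := inv_pos.mpr hpos
    have hs1 : s ≤ 1 := inv_le_one_of_one_le₀ hu.le
    have hsu : s * ‖u - x‖ = 1 := inv_mul_cancel₀ hpos.ne'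
    have hc := hr.2 (Set.mem_univ x) (Set.mem_univ u) (sub_nonneg.mpr hs1) hs0.le (by ring)
    have hb := hm' ((1 - s) • x + s • u) (by
      have : (1 - s) • x + s • u - x = s • (u - x) := by module
      rw [this, norm_smul, Real.norm_of_nonneg hs0.le, hsu])
    simp only [smul_eq_mul] at hc
    have h1 : s * (r x - r u) ≤ r x - m := by nlinarith
    have h2 : r x - r u ≤ (r x - m) * ‖u - x‖ := by
      have := mul_le_mul_of_nonneg_right h1 hpos.le
      calc r x - r u = (s * ‖u - x‖) * (r x - r u) := by rw [hsu, one_mul]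
        _ = s * (r x - r u) * ‖u - x‖ := by ring
        _ ≤ _ := this
    linarith

/-- The quadratic term dominates the at most linear decrease of `r`, so a minimizer over a large
closed ball is global. -/
lemma exists_prox (hr : ConvexOn ℝ Set.univ r) (hlam : 0 < lam) (x : Vec d) :
    ∃ u, ∀ v, r u + 1 / (2 * lam) * ‖u - x‖ ^ 2 ≤ r v + 1 / (2 * lam) * ‖v - x‖ ^ 2 := by
  have hcont : Continuous r := hr.locallyLipschitz.continuous
  obtain ⟨b, hb, hbu⟩ := exists_linear_lower_bound hr x
  set q := 1 / (2 * lam) with hq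
  have hq0 : 0 < q := by positivity
  -- Beyond distance `R` the quadratic term exceeds the possible loss `b + b * ‖v - x‖`, so such a
  -- point is no better than `x`; the extra 1 pays for the constant part of the loss.
  set R := (b + 1) / q + 1 with hR
  have hR1 : 1 ≤ R := by
    have : 0 ≤ (b + 1) / q := by positivity
    linarith
  obtain ⟨u, -, hu⟩ := (isCompact_closedBall x R).exists_isMinOn
    ⟨x, by simp; linarith⟩
    (f := fun v => r v + q * ‖v - x‖ ^ 2) (by fun_prop)
  refine ⟨u, fun v => ?_⟩
  by_cases hv : ‖v - x‖ ≤ R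
  · exact hu (by simpa [dist_eq_norm] using hv)
  · push Not at hv
    have hx := hu (show x ∈ Metric.closedBall x R by simp; linarith)
    simp only [sub_self, norm_zero, Set.mem_ofPred_eq] at hx
    have h1 := hbu v
    have h2 : b + 1 ≤ q * (R - 1) := by
      rw [hR]; simp only [add_sub_cancel_right]; rw [mul_div_cancel₀ _ hq0.ne']
    have h3 : b + 1 ≤ q * ‖v - x‖ := by nlinarith
    nlinarith [norm_nonneg (v - x)]

lemma prox_le (hr : ConvexOn ℝ Set.univ r) (hlam : 0 < lam) (x v : Vec d) :
    r (prox lam r x) + 1 / (2 * lam) * ‖prox lam r x - x‖ ^ 2 ≤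
      r v + 1 / (2 * lam) * ‖v - x‖ ^ 2 :=
  Classical.epsilon_spec (exists_prox hr hlam x) v

/-- The variational inequality that characterizes the proximal point. -/
lemma prox_variational (hr : ConvexOn ℝ Set.univ r) (hlam : 0 < lam) (x v : Vec d) :
    r (prox lam r x) + inner ℝ (x - prox lam r x) (v - prox lam r x) / lam ≤ r v := by
  set u := prox lam r x with hu
  set q := 1 / (2 * lam) with hq
  have hq0 : 0 < q := by positivity
  -- Comparison of the minimizer with a point on the segment towards `v`, divided by `s`; the
  -- first-order condition is the limit `s → 0`.
  have key : ∀ s : ℝ, 0 < s → s ≤ 1 →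
      r u - r v ≤ 2 * q * inner ℝ (u - x) (v - u) + s * (q * ‖v - u‖ ^ 2) := by
    intro s hs0 hs1
    have h1 := prox_le hr hlam x ((1 - s) • u + s • v)
    have h2 := hr.2 (Set.mem_univ u) (Set.mem_univ v) (sub_nonneg.mpr hs1) hs0.le (by ring)
    simp only [smul_eq_mul] at h2
    have h3 : (1 - s) • u + s • v - x = (u - x) + s • (v - u) := by module
    rw [← hu, ← hq, h3, norm_add_sq_real, norm_smul, inner_smul_right,
      Real.norm_of_nonneg hs0.le] at h1
    have h4 : s * (r u - r v) ≤
        s * (2 * q * inner ℝ (u - x) (v - u) + s * (q * ‖v - u‖ ^ 2)) := by nlinarith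
    exact le_of_mul_le_mul_left h4 hs0
  have hlim : r u - r v ≤ 2 * q * inner ℝ (u - x) (v - u) := by
    refine le_of_forall_pos_le_add fun δ hδ => ?_
    set a := q * ‖v - u‖ ^ 2 with ha
    have ha0 : 0 ≤ a := by positivity
    -- The denominator `a + 1` covers the case `a = 0`.
    have hs : 0 < min 1 (δ / (a + 1)) := by positivity
    refine (key _ hs (min_le_left _ _)).trans ?_
    have : min 1 (δ / (a + 1)) * a ≤ δ / (a + 1) * (a + 1) := by
      gcongr
      · exact min_le_right _ _
      · linarith
    rw [div_mul_cancel₀ _ (by positivity)] at this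
    linarith
  have h5 : inner ℝ (x - u) (v - u) = -inner ℝ (u - x) (v - u) := by
    rw [← inner_neg_left, neg_sub]
  have h6 : 2 * q = 1 / lam := by rw [hq]; field_simp
  rw [h5, neg_div]
  rw [h6, one_div, inv_mul_eq_div] at hlim
  linarith

/-- Adding the variational inequalities at the two proximal points cancels `r` and leaves firm
nonexpansiveness, `‖u - v‖ ^ 2 ≤ ⟪x - y, u - v⟫`; Cauchy–Schwarz finishes. -/
lemma norm_prox_sub_prox_le (hr : ConvexOn ℝ Set.univ r) (hlam : 0 < lam) (x y : Vec d) :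
    ‖prox lam r x - prox lam r y‖ ≤ ‖x - y‖ := by
  set u := prox lam r x with hu
  set v := prox lam r y with hv
  have h1 : r u + inner ℝ (x - u) (v - u) / lam ≤ r v := prox_variational hr hlam x v
  have h2 : r v + inner ℝ (y - v) (u - v) / lam ≤ r u := prox_variational hr hlam y u
  have h3 : (inner ℝ (x - u) (v - u) + inner ℝ (y - v) (u - v)) / lam ≤ 0 := by
    rw [add_div]; linarith
  have h4 : inner ℝ (x - u) (v - u) + inner ℝ (y - v) (u - v) ≤ 0 := by
    rw [div_le_iff₀ hlam] at h3; linarith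
  have h5 : inner ℝ (x - u) (v - u) + inner ℝ (y - v) (u - v) =
      ‖u - v‖ ^ 2 - inner ℝ (x - y) (u - v) := by
    rw [← real_inner_self_eq_norm_sq, show v - u = -(u - v) by abel, inner_neg_right]
    simp only [inner_sub_left, inner_sub_right]; ring
  have h6 := real_inner_le_norm (x - y) (u - v)
  by_contra hlt
  push Not at hlt
  have : 0 < ‖u - v‖ := lt_of_le_of_lt (norm_nonneg _) hlt
  nlinarith

lemma continuous_prox (hr : ConvexOn ℝ Set.univ r) (hlam : 0 < lam) :
    Continuous (prox lam r) :=
  (LipschitzWith.of_dist_le_mul (K := 1) fun x y => by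
    simpa [dist_eq_norm] using norm_prox_sub_prox_le hr hlam x y).continuous

/-- The stationarity measure at `z`, in terms of an inexact proximal gradient step at `x`. -/
lemma norm_gradMap_le {F : Vec d → ℝ} (hr : ConvexOn ℝ Set.univ r) (hlam : 0 < lam)
    (x z v : Vec d) :
    ‖gradMap lam F r z‖ ≤
      (2 * ‖z - x‖ + ‖prox lam r (x - lam • v) - x‖) / lam + ‖v - gradient F z‖ := by
  -- The exact step at `z` is compared with the inexact step at `x`. Their arguments differ by at
  -- most `‖z - x‖ + lam * ‖v - gradient F z‖`, which accounts for one of the two copies of `‖z -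
  -- x‖`.
  have h1 := norm_prox_sub_prox_le hr hlam (x - lam • v) (z - lam • gradient F z)
  have h2 : x - lam • v - (z - lam • gradient F z) =
      -(z - x) - lam • (v - gradient F z) := by module
  have h3 := norm_sub_le (-(z - x)) (lam • (v - gradient F z))
  rw [← h2, norm_neg, norm_smul, Real.norm_of_nonneg hlam.le] at h3
  have h4 : z - prox lam r (z - lam • gradient F z) = (z - x) -
      (prox lam r (x - lam • v) - x) + (prox lam r (x - lam • v) -
        prox lam r (z - lam • gradient F z)) := by abel
  have h5 := norm_add_le ((z - x) - (prox lam r (x - lam • v) - x))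
    (prox lam r (x - lam • v) - prox lam r (z - lam • gradient F z))
  have h6 := norm_sub_le (z - x) (prox lam r (x - lam • v) - x)
  rw [gradMap, norm_smul, Real.norm_of_nonneg (by positivity), one_div, inv_mul_eq_div, h4,
    div_le_iff₀ hlam, add_mul, div_mul_cancel₀ _ hlam.ne']
  linarith

end Prox

/-! ### Descent -/

/-- The descent lemma for functions with Lipschitz gradient. -/
lemma descent_le {d : ℕ} {F : Vec d → ℝ} {L : ℝ} (hF : Differentiable ℝ F)
    (hL : ∀ x y, ‖gradient F x - gradient F y‖ ≤ L * ‖x - y‖) (x y : Vec d) :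
    F y ≤ F x + inner ℝ (gradient F x) (y - x) + L / 2 * ‖y - x‖ ^ 2 := by
  -- The excess of `F` along the segment over its quadratic model; the Lipschitz bound makes its
  -- derivative nonpositive.
  set h : ℝ → ℝ := fun s => F (x + s • (y - x)) - s * inner ℝ (gradient F x) (y - x) -
    L / 2 * ‖y - x‖ ^ 2 * s ^ 2 with hh
  have hd : ∀ s, HasDerivAt h (inner ℝ (gradient F (x + s • (y - x)) - gradient F x) (y - x) -
      L * ‖y - x‖ ^ 2 * s) s := by
    intro s
    have h1 : HasDerivAt (fun s : ℝ => x + s • (y - x)) (y - x) s := by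
      simpa using ((hasDerivAt_id s).smul_const (y - x)).const_add x
    have h2 : HasDerivAt (fun s : ℝ => F (x + s • (y - x)))
        (inner ℝ (gradient F (x + s • (y - x))) (y - x)) s := by
      have h3 := (hF (x + s • (y - x))).hasGradientAt.hasFDerivAt.comp_hasDerivAt s h1
      exact h3.congr_deriv (by simp)
    have h4 := (h2.sub ((hasDerivAt_id s).mul_const (inner ℝ (gradient F x) (y - x)))).sub
      ((hasDerivAt_pow 2 s).const_mul (L / 2 * ‖y - x‖ ^ 2))
    refine h4.congr_deriv ?_
    rw [inner_sub_left]; push_cast; ring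
  have hanti : AntitoneOn h (Set.Icc 0 1) := by
    refine antitoneOn_of_deriv_nonpos (convex_Icc 0 1)
      (fun s _ => (hd s).continuousAt.continuousWithinAt)
      (fun s _ => (hd s).differentiableAt.differentiableWithinAt) fun s hs => ?_
    rw [interior_Icc] at hs
    rw [(hd s).deriv]
    have h1 := real_inner_le_norm (gradient F (x + s • (y - x)) - gradient F x) (y - x)
    have h2 := hL (x + s • (y - x)) x
    rw [add_sub_cancel_left, norm_smul, Real.norm_of_nonneg hs.1.le] at h2
    nlinarith [norm_nonneg (y - x), mul_le_mul_of_nonneg_right h2 (norm_nonneg (y - x))]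
  have := hanti (by simp : (0 : ℝ) ∈ Set.Icc (0 : ℝ) 1) (by simp : (1 : ℝ) ∈ Set.Icc (0 : ℝ) 1)
    zero_le_one
  simp only [hh, zero_smul, one_smul, add_zero, add_sub_cancel] at this
  linarith

/-- One step of the normalized inexact proximal gradient method. -/
lemma normalized_step_descent {d : ℕ} {F r : Vec d → ℝ} {L lam ε : ℝ}
    (hr : ConvexOn ℝ Set.univ r) (hF : Differentiable ℝ F)
    (hL : ∀ x y, ‖gradient F x - gradient F y‖ ≤ L * ‖x - y‖) (hlam : 0 < lam)
    (hlamL : lam * L ≤ 3) (hε : 0 ≤ ε) (x v : Vec d) {u : Vec d}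
    (hu : u = prox lam r (x - lam • v)) {θ : ℝ}
    (hθ : θ = min (ε * lam / ‖u - x‖) (1 / 2)) :
    ε * ‖u - x‖ / 4 ≤ (F x + r x) - (F ((1 - θ) • x + θ • u) + r ((1 - θ) • x + θ • u)) +
      ε * lam * ‖gradient F x - v‖ + ε ^ 2 * lam / 8 := by
  set D := ‖u - x‖ with hD
  have hD0 : 0 ≤ D := norm_nonneg _
  have hθ0 : 0 ≤ θ := by rw [hθ]; positivity
  have hθ2 : θ ≤ 1 / 2 := by rw [hθ]; exact min_le_right _ _
  have hθD : θ * D ≤ ε * lam := by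
    rcases hD0.eq_or_lt with h | h
    · rw [← h]; simp; positivity
    · calc θ * D ≤ ε * lam / D * D := by gcongr; rw [hθ]; exact min_le_left _ _
        _ = ε * lam := div_mul_cancel₀ _ h.ne'
  -- Both branches of the minimum give a bound linear in `D`: equality in the first up to the
  -- subtracted square, and `(D - ε * lam) ^ 2 ≥ 0` in the second.
  have hθD2 : ε * lam * D - ε ^ 2 * lam ^ 2 / 2 ≤ θ * D ^ 2 := by
    rcases hD0.eq_or_lt with h | h
    · rw [← h]; simp; positivity
    · rcases min_choice (ε * lam / D) (1 / 2) with h' | h'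
      · rw [hθ, h']
        have : ε * lam / D * D ^ 2 = ε * lam * D := by field_simp
        rw [this]; nlinarith [sq_nonneg (ε * lam)]
      · rw [hθ, h']; nlinarith [sq_nonneg (D - ε * lam)]
  set w := (1 - θ) • x + θ • u with hw
  have hwx : w - x = θ • (u - x) := by rw [hw]; module
  have h1 := descent_le hF hL x w
  rw [hwx, norm_smul, inner_smul_right, Real.norm_of_nonneg hθ0, ← hD] at h1
  have h2 := hr.2 (Set.mem_univ x) (Set.mem_univ u) (by linarith : 0 ≤ 1 - θ) hθ0 (by ring)
  rw [← hw] at h2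
  simp only [smul_eq_mul] at h2
  have h3 := prox_variational hr hlam (x - lam • v) x
  rw [← hu] at h3
  have h4 : inner ℝ (x - lam • v - u) (x - u) = D ^ 2 + lam * inner ℝ v (u - x) := by
    rw [hD, ← real_inner_self_eq_norm_sq, show x - lam • v - u = -(u - x) - lam • v by abel,
      show x - u = -(u - x) by abel, inner_sub_left, inner_neg_neg, inner_smul_left,
      inner_neg_right]
    simp
  rw [h4, add_div, mul_div_cancel_left₀ _ hlam.ne'] at h3
  have h5 : inner ℝ (gradient F x) (u - x) - inner ℝ v (u - x) ≤ ‖gradient F x - v‖ * D := by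
    rw [← inner_sub_left]; exact real_inner_le_norm _ _
  have h6 : θ * (‖gradient F x - v‖ * D) ≤ ε * lam * ‖gradient F x - v‖ := by
    nlinarith [norm_nonneg (gradient F x - v)]
  have h7 : θ * (r u + D ^ 2 / lam + inner ℝ v (u - x)) ≤ θ * r x := by
    refine mul_le_mul_of_nonneg_left ?_ hθ0; linarith
  -- Since `θ ≤ 1 / 2` and `lam * L ≤ 3`, the curvature term uses up three quarters of `θ * D ^ 2 /
  -- lam`. The remaining quarter gives the constants `1 / 4` and `1 / 8` of the conclusion.
  have h8 : L / 2 * (θ * D) ^ 2 ≤ 3 / 4 * (θ * D ^ 2 / lam) := by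
    rw [show 3 / 4 * (θ * D ^ 2 / lam) = (3 * (θ * D ^ 2) / 4) / lam by ring, le_div_iff₀ hlam]
    have : lam * L * (θ * (θ * D ^ 2)) ≤ 3 * (1 / 2 * (θ * D ^ 2)) := by
      have h0 : 0 ≤ θ * D ^ 2 := by positivity
      have ha : θ * (θ * D ^ 2) ≤ 1 / 2 * (θ * D ^ 2) := by gcongr
      have hb : 0 ≤ θ * (θ * D ^ 2) := by positivity
      nlinarith
    nlinarith
  have h9 : ε * D - ε ^ 2 * lam / 2 ≤ θ * D ^ 2 / lam := by
    rw [le_div_iff₀ hlam]; nlinarith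
  have h10 : θ * (D ^ 2 / lam) = θ * D ^ 2 / lam := by ring
  have h11 := mul_le_mul_of_nonneg_left h5 hθ0
  nlinarith

/-! ### Trajectories -/

section Trajectory

variable {d p : ℕ}

/-- The recursion of the iterates, whatever the estimates are. -/
structure IsTrajectory (par : Params) (r : Vec d → ℝ) (x₀ : Vec d) (s : ℕ → State d p) :
    Prop where
  x_zero : (s 0).x = x₀
  y_zero : (s 0).y = x₀
  z_eq : ∀ t, (s t).z = (1 - par.α (t + 1)) • (s t).y + par.α (t + 1) • (s t).x
  x_succ : ∀ t, (s (t + 1)).x = nextX par r t (s t)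
  y_succ : ∀ t, (s (t + 1)).y = nextY par r t (s t)

section Estimate

variable {I J : Type*} {m m' k : ℕ} (par : Params) (g : I → Vec d → Vec p)
  (f : J → Vec p → ℝ) (t : ℕ) (S : Batch I J m m' k) (x y : Vec d) (prev : State d p)

@[simp] lemma estimate_x : (estimate par g f t S x y prev).x = x := by
  unfold estimate; simp only []; split <;> rfl

@[simp] lemma estimate_y : (estimate par g f t S x y prev).y = y := by
  unfold estimate; simp only []; split <;> rfl

lemma estimate_z : (estimate par g f t S x y prev).z =
    (1 - par.α (t + 1)) • y + par.α (t + 1) • x := by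
  unfold estimate; simp only []; split <;> rfl

end Estimate

lemma isTrajectory_run {I J : Type*} {a a' b : ℕ → ℕ} (par : Params) (g : I → Vec d → Vec p)
    (f : J → Vec p → ℝ) (r : Vec d → ℝ) (x₀ : Vec d)
    (S : (t : ℕ) → Batch I J (a t) (a' t) (b t)) :
    IsTrajectory par r x₀ (run par g f r x₀ S) where
  x_zero := by simp [run]
  y_zero := by simp [run]
  z_eq t := by cases t <;> simp [run, estimate_z]
  x_succ t := by simp [run]
  y_succ t := by simp [run]

/-- The purpose of the normalization: the bound is deterministic, so no control of the gradient
estimate is needed for it. -/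
lemma norm_nextX_sub_le {par : Params} (r : Vec d → ℝ) (t : ℕ) (s : State d p)
    (h : 0 ≤ par.ε * par.lam t) : ‖nextX par r t s - s.x‖ ≤ par.ε * par.lam t := by
  have h1 : nextX par r t s - s.x = theta par r t s • (proxStep par r t s - s.x) := by
    rw [nextX]; module
  have h0 : 0 ≤ theta par r t s := by rw [theta]; positivity
  rw [h1, norm_smul, Real.norm_of_nonneg h0]
  rcases (norm_nonneg (proxStep par r t s - s.x)).eq_or_lt with h' | h'
  · rw [← h']; simpa using h
  · calc _ ≤ par.ε * par.lam t / ‖proxStep par r t s - s.x‖ * ‖proxStep par r t s - s.x‖ := by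
          gcongr; exact min_le_left _ _
      _ = _ := div_mul_cancel₀ _ h'.ne'

variable {τ : ℕ} {ε β : ℝ} {lam : ℕ → ℝ} {r : Vec d → ℝ} {x₀ : Vec d} {s : ℕ → State d p}
  {T : ℕ}

lemma alpha_nonneg (t : ℕ) : 0 ≤ alpha t := by unfold alpha; positivity

lemma alpha_succ_le_one (t : ℕ) : alpha (t + 1) ≤ 1 := by
  unfold alpha; push_cast
  rw [div_le_one (by positivity)]
  have : (0 : ℝ) ≤ t := by positivity
  linarith

lemma alpha_le_two (t : ℕ) : alpha t ≤ 2 := by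
  unfold alpha
  rw [div_le_iff₀ (by positivity)]
  have : (0 : ℝ) ≤ t := by positivity
  linarith

/-- The difference `y - x` contracts by `1 - alpha (t + 1)` and receives a term of size at most `ε *
(lam t - β) ≤ ε * alpha t * β`. Because `alpha t ≤ 2 * alpha (t + 1)`, the bound `2 * β * ε` is
preserved. -/
lemma IsTrajectory.norm_y_sub_x_le (hs : IsTrajectory (dimParams τ ε β lam) r x₀ s)
    (hε : 0 ≤ ε) (hβ : 0 < β) (hlam : ∀ t < T, lam t ∈ Set.Icc β ((1 + alpha t) * β)) :
    ∀ t ≤ T, ‖(s t).y - (s t).x‖ ≤ 2 * β * ε := by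
  intro t
  induction t with
  | zero => intro _; rw [hs.x_zero, hs.y_zero]; simp; positivity
  | succ t ih =>
    intro ht
    obtain ⟨h1, h2⟩ := hlam t ht
    have hl : 0 < lam t := by linarith
    have ih := ih (by omega)
    have e : (s (t + 1)).y - (s (t + 1)).x = (1 - alpha (t + 1)) • ((s t).y - (s t).x) -
        (1 - β / lam t) • (nextX (dimParams τ ε β lam) r t (s t) - (s t).x) := by
      rw [hs.x_succ, hs.y_succ, nextY, hs.z_eq]
      simp only [dimParams]; module
    have hstep : ‖nextX (dimParams τ ε β lam) r t (s t) - (s t).x‖ ≤ ε * lam t :=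
      norm_nextX_sub_le r t (s t) (by simp only [dimParams]; positivity)
    have hb : 0 ≤ 1 - β / lam t := by
      rw [sub_nonneg, div_le_one hl]; exact h1
    have hb2 : (1 - β / lam t) * (ε * lam t) = ε * (lam t - β) := by field_simp
    rw [e]
    refine (norm_sub_le _ _).trans ?_
    rw [norm_smul, norm_smul, Real.norm_of_nonneg (sub_nonneg.mpr (alpha_succ_le_one t)),
      Real.norm_of_nonneg hb]
    calc (1 - alpha (t + 1)) * ‖(s t).y - (s t).x‖ +
        (1 - β / lam t) * ‖nextX (dimParams τ ε β lam) r t (s t) - (s t).x‖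
        ≤ (1 - alpha (t + 1)) * (2 * β * ε) + (1 - β / lam t) * (ε * lam t) := by
          gcongr
          exact sub_nonneg.mpr (alpha_succ_le_one t)
      _ ≤ (1 - alpha (t + 1)) * (2 * β * ε) + ε * (alpha t * β) := by
          rw [hb2]; gcongr; linarith
      _ ≤ 2 * β * ε := by
          have : alpha t ≤ 2 * alpha (t + 1) := by
            unfold alpha; push_cast
            rw [← mul_div_assoc, div_le_div_iff₀ (by positivity) (by positivity)]
            have : (0 : ℝ) ≤ t := by positivity
            linarith
          have : alpha t * (β * ε) ≤ 2 * alpha (t + 1) * (β * ε) := by gcongr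
          linarith

lemma IsTrajectory.norm_z_sub_x_le (hs : IsTrajectory (dimParams τ ε β lam) r x₀ s)
    (hε : 0 ≤ ε) (hβ : 0 < β) (hlam : ∀ t < T, lam t ∈ Set.Icc β ((1 + alpha t) * β))
    {t : ℕ} (ht : t ≤ T) : ‖(s t).z - (s t).x‖ ≤ 2 * β * ε := by
  have h := hs.norm_y_sub_x_le hε hβ hlam t ht
  have e : (s t).z - (s t).x = (1 - alpha (t + 1)) • ((s t).y - (s t).x) := by
    rw [hs.z_eq]; simp only [dimParams]; module
  rw [e, norm_smul, Real.norm_of_nonneg (sub_nonneg.mpr (alpha_succ_le_one t))]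
  nlinarith [alpha_nonneg (t + 1), norm_nonneg ((s t).y - (s t).x)]

/-- Passing through the intermediate point `y_{t+1}`: from `z_t` to it the move is the `x`-step
rescaled to length at most `β * ε`, and from it to `z_{t+1}` the move is a fraction of `y_{t+1} -
x_{t+1}`, at most `2 * β * ε`. -/
lemma IsTrajectory.norm_z_succ_sub_le (hs : IsTrajectory (dimParams τ ε β lam) r x₀ s)
    (hε : 0 ≤ ε) (hβ : 0 < β) (hlam : ∀ t < T, lam t ∈ Set.Icc β ((1 + alpha t) * β))
    {t : ℕ} (ht : t < T) : ‖(s (t + 1)).z - (s t).z‖ ≤ 3 * β * ε := by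
  have h := hs.norm_y_sub_x_le hε hβ hlam (t + 1) ht
  have hl : 0 < lam t := hβ.trans_le (hlam t ht).1
  have hstep : ‖nextX (dimParams τ ε β lam) r t (s t) - (s t).x‖ ≤ ε * lam t :=
      norm_nextX_sub_le r t (s t) (by simp only [dimParams]; positivity)
  have e : (s (t + 1)).z - (s t).z = (-alpha (t + 2)) • ((s (t + 1)).y - (s (t + 1)).x) +
      (β / lam t) • (nextX (dimParams τ ε β lam) r t (s t) - (s t).x) := by
    have : (s (t + 1)).y - (s t).z =
        (β / lam t) • (nextX (dimParams τ ε β lam) r t (s t) - (s t).x) := by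
      rw [hs.y_succ, nextY]; simp only [dimParams]; module
    rw [← this, hs.z_eq (t + 1)]; simp only [dimParams]; module
  rw [e]
  refine (norm_add_le _ _).trans ?_
  rw [norm_smul, norm_smul, norm_neg, Real.norm_of_nonneg (alpha_nonneg _),
    Real.norm_of_nonneg (by positivity)]
  calc alpha (t + 2) * ‖(s (t + 1)).y - (s (t + 1)).x‖ +
      β / lam t * ‖nextX (dimParams τ ε β lam) r t (s t) - (s t).x‖
      ≤ 1 * (2 * β * ε) + β / lam t * (ε * lam t) := by
        gcongr; exact alpha_succ_le_one (t + 1)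
    _ = 3 * β * ε := by field_simp; ring

/-- Confines `z_t` to a ball that does not depend on the samples, which later makes the stationarity
measure bounded and hence integrable. -/
lemma IsTrajectory.norm_z_sub_start_le (hs : IsTrajectory (dimParams τ ε β lam) r x₀ s)
    (hε : 0 ≤ ε) (hβ : 0 < β) (hlam : ∀ t < T, lam t ∈ Set.Icc β ((1 + alpha t) * β)) :
    ∀ t ≤ T, ‖(s t).z - x₀‖ ≤ 3 * β * ε * t := by
  intro t
  induction t with
  | zero =>
    intro _
    rw [hs.z_eq, hs.x_zero, hs.y_zero]
    have : (1 - (dimParams τ ε β lam).α (0 + 1)) • x₀ +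
      (dimParams τ ε β lam).α (0 + 1) • x₀ - x₀ = 0 := by module
    rw [this]; simp
  | succ t ih =>
    intro ht
    have h1 := ih (by omega)
    have h2 := hs.norm_z_succ_sub_le hε hβ hlam (show t < T from ht)
    have h3 := norm_add_le ((s (t + 1)).z - (s t).z) ((s t).z - x₀)
    rw [sub_add_sub_cancel] at h3
    push_cast; linarith

/-- The sum of the stationarity measures along a trajectory is controlled by the initial gap and
the errors of the gradient estimates. -/
lemma IsTrajectory.sum_norm_gradMap_le {F : Vec d → ℝ} {L c : ℝ}
    (hs : IsTrajectory (dimParams τ ε β lam) r x₀ s) (hF : Differentiable ℝ F)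
    (hL : ∀ x y, ‖gradient F x - gradient F y‖ ≤ L * ‖x - y‖) (hFr : RegularObjective F r)
    (hε : 0 < ε) (hc : 0 < c) (hstep : StepSizes c L T β lam) :
    ∑ t ∈ Finset.range T, ‖gradMap (lam t) F r (s t).z‖ ≤
      30 * ε * T + 4 * (L * gap F r x₀) / (c * ε) +
        13 * ∑ t ∈ Finset.range T,
          ‖ContinuousLinearMap.adjoint (s t).jacEst (s t).gradEst - gradient F (s t).z‖ := by
  have hβ := hstep.pos
  have hL0 : 0 < L := by
    by_contra h
    push Not at h
    have := hstep.lower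
    nlinarith
  set Φ : Vec d → ℝ := fun x => F x + r x with hΦ
  set e : ℕ → ℝ := fun t =>
    ‖ContinuousLinearMap.adjoint (s t).jacEst (s t).gradEst - gradient F (s t).z‖ with he
  set D : ℕ → ℝ := fun t => ‖proxStep (dimParams τ ε β lam) r t (s t) - (s t).x‖ with hD
  have hD0 : ∀ t, 0 ≤ D t := fun t => norm_nonneg _
  have he0 : ∀ t, 0 ≤ e t := fun t => norm_nonneg _
  -- The one-step descent with `lam t ≤ 3 * β`, multiplied by `4 / (ε * β)`: the error gets the
  -- factor `4 * 3 = 12`, and the terms in `ε` add up to `24 + 3 / 2`, rounded to 26.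
  have hdesc : ∀ t < T, D t / β ≤ 4 / (ε * β) * (Φ (s t).x - Φ (s (t + 1)).x) +
      12 * e t + 26 * ε := by
    intro t ht
    obtain ⟨h1, h2⟩ := hstep.lam_mem t ht
    have hl : 0 < lam t := by linarith
    -- The factor 3 is forced by `t = 0`, where `alpha 0 = 2`.
    have h3 : lam t ≤ 3 * β := by nlinarith [alpha_le_two t]
    have h4 : lam t * L ≤ 3 := by nlinarith [hstep.upper]
    have h5 := normalized_step_descent hFr.convex hF hL hl h4 hε.le (s t).x
      (ContinuousLinearMap.adjoint (s t).jacEst (s t).gradEst) rfl rfl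
    have h6 := hs.norm_z_sub_x_le hε.le hβ hstep.lam_mem ht.le
    have h7 : ‖gradient F (s t).x -
        ContinuousLinearMap.adjoint (s t).jacEst (s t).gradEst‖ ≤ 2 * ε + e t := by
      have a1 := norm_add_le (gradient F (s t).x - gradient F (s t).z)
        (gradient F (s t).z - ContinuousLinearMap.adjoint (s t).jacEst (s t).gradEst)
      rw [sub_add_sub_cancel] at a1
      have a2 := hL (s t).x (s t).z
      rw [norm_sub_rev (s t).x] at a2
      have a3 : L * ‖(s t).z - (s t).x‖ ≤ 2 * ε := by
        calc L * ‖(s t).z - (s t).x‖ ≤ L * (2 * β * ε) := by gcongr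
          _ = 2 * (β * L) * ε := by ring
          _ ≤ 2 * 1 * ε := by gcongr; exact hstep.upper
          _ = _ := by ring
      rw [norm_sub_rev (gradient F (s t).z)] at a1
      linarith
    have h8 : ε * D t / 4 ≤ Φ (s t).x - Φ (s (t + 1)).x +
        ε * (3 * β) * (2 * ε + e t) + ε ^ 2 * (3 * β) / 8 := by
      have e1 : ε * lam t * ‖gradient F (s t).x -
        ContinuousLinearMap.adjoint (s t).jacEst (s t).gradEst‖ ≤
          ε * (3 * β) * (2 * ε + e t) := by gcongr
      have e2 : ε ^ 2 * lam t / 8 ≤ ε ^ 2 * (3 * β) / 8 := by gcongr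
      have e3 : (s (t + 1)).x = nextX (dimParams τ ε β lam) r t (s t) := hs.x_succ t
      rw [e3]
      refine h5.trans ?_
      have e4 : ∀ a b b' c c' : ℝ, b ≤ b' → c ≤ c' → a + b + c ≤ a + b' + c' := by
        intros; linarith
      exact e4 _ _ _ _ _ e1 e2
    rw [div_le_iff₀ hβ]
    have h9 : (4 / (ε * β) * (Φ (s t).x - Φ (s (t + 1)).x) + 12 * e t + 26 * ε) * β * ε =
        4 * (Φ (s t).x - Φ (s (t + 1)).x) + 12 * e t * β * ε + 26 * ε * β * ε := by
      field_simp
    refine le_of_mul_le_mul_right ?_ hε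
    rw [h9]
    nlinarith [mul_pos (mul_pos hε hε) hβ]
  have hpt : ∀ t < T, ‖gradMap (lam t) F r (s t).z‖ ≤
      4 / (ε * β) * (Φ (s t).x - Φ (s (t + 1)).x) + 13 * e t + 30 * ε := by
    intro t ht
    have hlt := (hstep.lam_mem t ht).1
    have hl : 0 < lam t := by linarith
    have h1 := norm_gradMap_le (F := F) hFr.convex hl (s t).x (s t).z
      (ContinuousLinearMap.adjoint (s t).jacEst (s t).gradEst)
    have h2 := hs.norm_z_sub_x_le hε.le hβ hstep.lam_mem ht.le
    have h3 : (2 * ‖(s t).z - (s t).x‖ + D t) / lam t ≤ (2 * (2 * β * ε) + D t) / β := by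
      gcongr
    have h4 : (2 * (2 * β * ε) + D t) / β = 4 * ε + D t / β := by field_simp; ring
    have h5 := hdesc t ht
    have h6 : ‖gradMap (lam t) F r (s t).z‖ ≤
      (2 * ‖(s t).z - (s t).x‖ + D t) / lam t + e t := h1
    linarith
  have hsum := Finset.sum_le_sum fun t ht => hpt t (Finset.mem_range.mp ht)
  rw [Finset.sum_add_distrib, Finset.sum_add_distrib, ← Finset.mul_sum, ← Finset.mul_sum,
    Finset.sum_range_sub' fun t => Φ (s t).x] at hsum
  have hgap : Φ (s 0).x - Φ (s T).x ≤ gap F r x₀ := by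
    rw [hs.x_zero, gap]
    have := ciInf_le hFr.bddBelow (s T).x
    simp only [hΦ]; linarith
  have hgap0 : 0 ≤ gap F r x₀ := by
    have := ciInf_le hFr.bddBelow x₀
    unfold gap; linarith
  -- Here the lower bound `c ≤ β * L` trades `1 / β` for `L / c`.
  have hfin : 4 / (ε * β) * (Φ (s 0).x - Φ (s T).x) ≤ 4 * (L * gap F r x₀) / (c * ε) := by
    calc 4 / (ε * β) * (Φ (s 0).x - Φ (s T).x) ≤ 4 / (ε * β) * gap F r x₀ := by gcongr
      _ = 4 * gap F r x₀ / (β * ε) := by field_simp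
      _ ≤ 4 * (L * gap F r x₀) / (c * ε) := by
        rw [div_le_div_iff₀ (by positivity) (by positivity)]
        have : 0 ≤ (β * L - c) * (4 * gap F r x₀ * ε) :=
          mul_nonneg (sub_nonneg.mpr hstep.lower) (by positivity)
        nlinarith
  simp only [Finset.sum_const, Finset.card_range, nsmul_eq_mul] at hsum
  linarith

end Trajectory

/-! ### The Frobenius norm -/

section Frobenius

variable {d p : ℕ}

/-- The matrix entries of a linear map. -/
def entries : (Vec d →L[ℝ] Vec p) →ₗ[ℝ] EuclideanSpace ℝ (Fin d × Fin p) where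
  toFun M := WithLp.toLp 2 fun q => M (EuclideanSpace.single q.1 1) q.2
  map_add' _ _ := rfl
  map_smul' _ _ := rfl

/-- Realizes the Frobenius norm as a Euclidean norm, so that the variance bounds for
Euclidean-valued samples apply to Jacobians. -/
lemma norm_entries (M : Vec d →L[ℝ] Vec p) : ‖entries M‖ = frobNorm M := by
  rw [EuclideanSpace.norm_eq, frobNorm, Fintype.sum_prod_type]
  simp only [EuclideanSpace.norm_sq_eq]
  rfl

lemma continuous_entries :
    Continuous (entries : (Vec d →L[ℝ] Vec p) →ₗ[ℝ] EuclideanSpace ℝ (Fin d × Fin p)) :=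
  LinearMap.continuous_of_finiteDimensional _

/-- Cauchy–Schwarz on the expansion of `x` in the standard basis. The Frobenius norm serves for
variances, the operator norm for the chain rule. -/
lemma norm_le_frobNorm (M : Vec d →L[ℝ] Vec p) : ‖M‖ ≤ frobNorm M := by
  refine M.opNorm_le_bound (Real.sqrt_nonneg _) fun x => ?_
  have hx : x = ∑ j, x j • (EuclideanSpace.single j (1 : ℝ) : Vec d) := by
    have := (EuclideanSpace.basisFun (Fin d) ℝ).sum_repr x
    simpa using this.symm
  calc ‖M x‖ = ‖∑ j, x j • M (EuclideanSpace.single j 1)‖ := by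
        conv_lhs => rw [hx]
        simp [map_sum]
    _ ≤ ∑ j, ‖x j‖ * ‖M (EuclideanSpace.single j 1)‖ := by
        refine (norm_sum_le _ _).trans (le_of_eq ?_)
        simp [norm_smul]
    _ ≤ Real.sqrt (∑ j, ‖x j‖ ^ 2) * Real.sqrt (∑ j, ‖M (EuclideanSpace.single j 1)‖ ^ 2) :=
        Real.sum_mul_le_sqrt_mul_sqrt _ _ _
    _ = frobNorm M * ‖x‖ := by rw [mul_comm, EuclideanSpace.norm_eq]; rfl

end Frobenius

/-! ### Derivatives of Lipschitz families and of their means -/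

section Mean

variable {I E V : Type*} [NormedAddCommGroup E] [NormedSpace ℝ E]
  [NormedAddCommGroup V] [NormedSpace ℝ V]

lemma norm_fderiv_le_of_norm_sub_le {h : V → E} {l : ℝ} (hl : 0 ≤ l)
    (hlip : ∀ x x', ‖h x - h x'‖ ≤ l * ‖x - x'‖) (x : V) : ‖fderiv ℝ h x‖ ≤ l := by
  have : LipschitzWith l.toNNReal h := LipschitzWith.of_dist_le_mul fun x y => by
    rw [dist_eq_norm, dist_eq_norm, Real.coe_toNNReal _ hl]; exact hlip x y
  simpa [hl] using norm_fderiv_le_of_lipschitz ℝ this (x₀ := x)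

variable [MeasurableSpace I] {μ : Measure I} [IsProbabilityMeasure μ]

lemma norm_integral_sub_integral_le {h h' : I → E} {b : ℝ} (hh : Integrable h μ)
    (hh' : Integrable h' μ) (hb : ∀ ξ, ‖h ξ - h' ξ‖ ≤ b) :
    ‖∫ ξ, h ξ ∂μ - ∫ ξ, h' ξ ∂μ‖ ≤ b := by
  rw [← integral_sub hh hh']
  simpa using norm_integral_le_of_norm_le_const (μ := μ) (.of_forall hb)

variable [FiniteDimensional ℝ E] [FiniteDimensional ℝ V] [MeasurableSpace E] [BorelSpace E]

/-- A family of operators on a finite-dimensional space is measurable if it is so pointwise. -/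
lemma measurable_of_apply {M : I → V →L[ℝ] E} (hM : ∀ v, Measurable fun ξ => M ξ v) :
    Measurable M := by
  let b := Module.finBasis ℝ V
  let c : Fin (Module.finrank ℝ V) → V →L[ℝ] ℝ := fun j =>
    LinearMap.toContinuousLinearMap (b.coord j)
  -- The operator is a finite sum of rank-one operators, each a continuous function of the vector `M
  -- ξ (b j)`.
  have hsum : M = fun ξ => ∑ j, ContinuousLinearMap.smulRightL ℝ V E (c j) (M ξ (b j)) := by
    ext ξ v
    calc M ξ v = M ξ (∑ j, b.repr v j • b j) := by rw [b.sum_repr]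
      _ = _ := by rw [map_sum]; simp [c]
  rw [hsum]
  refine Finset.measurable_sum _ fun j _ => ?_
  exact (ContinuousLinearMap.continuous _).measurable.comp (hM _)

/-- Each directional derivative is a pointwise limit of difference quotients with steps `1 / n`,
which are measurable in the sample. -/
lemma measurable_fderiv_family {h : I → V → E} (hd : ∀ ξ, Differentiable ℝ (h ξ))
    (hm : ∀ x, Measurable fun ξ => h ξ x) (x : V) : Measurable fun ξ => fderiv ℝ (h ξ) x := by
  refine measurable_of_apply fun v => ?_
  have hlim : ∀ ξ, Filter.Tendsto
      (fun n : ℕ => ((n : ℝ)) • (h ξ (x + ((n : ℝ))⁻¹ • v) - h ξ x)) Filter.atTop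
      (nhds (fderiv ℝ (h ξ) x v)) := fun ξ => by
    have h1 := (hd ξ x).hasFDerivAt.lim_real v
    exact h1.comp tendsto_natCast_atTop_atTop
  refine measurable_of_tendsto_metrizable (f := fun (n : ℕ) ξ =>
    ((n : ℝ)) • (h ξ (x + ((n : ℝ))⁻¹ • v) - h ξ x)) (fun n => ?_)
    (tendsto_pi_nhds.mpr hlim)
  exact ((hm _).sub (hm _)).const_smul _

lemma integrable_fderiv_family {h : I → V → E} {l : ℝ} (hl : 0 ≤ l)
    (hd : ∀ ξ, Differentiable ℝ (h ξ)) (hlip : ∀ ξ x x', ‖h ξ x - h ξ x'‖ ≤ l * ‖x - x'‖)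
    (hm : ∀ x, Measurable fun ξ => h ξ x) (x : V) :
    Integrable (fun ξ => fderiv ℝ (h ξ) x) μ :=
  Integrable.of_bound (measurable_fderiv_family hd hm x).aestronglyMeasurable l
    (.of_forall fun ξ => norm_fderiv_le_of_norm_sub_le hl (hlip ξ) x)

/-- The common Lipschitz constant dominates all derivatives, so differentiation under the integral
needs no further integrability assumption. -/
lemma hasFDerivAt_integral_family {h : I → V → E} {l : ℝ} (hl : 0 ≤ l)
    (hd : ∀ ξ, Differentiable ℝ (h ξ)) (hlip : ∀ ξ x x', ‖h ξ x - h ξ x'‖ ≤ l * ‖x - x'‖)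
    (hm : ∀ x, Measurable fun ξ => h ξ x) (hint : ∀ x, Integrable (fun ξ => h ξ x) μ) (x : V) :
    HasFDerivAt (fun x => ∫ ξ, h ξ x ∂μ) (∫ ξ, fderiv ℝ (h ξ) x ∂μ) x :=
  hasFDerivAt_integral_of_dominated_of_fderiv_le (bound := fun _ => l)
    (F' := fun x ξ => fderiv ℝ (h ξ) x)
    Filter.univ_mem (.of_forall fun x => (hint x).aestronglyMeasurable) (hint x)
    (measurable_fderiv_family hd hm x).aestronglyMeasurable
    (.of_forall fun ξ y _ => norm_fderiv_le_of_norm_sub_le hl (hlip ξ) y)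
    (integrable_const l) (.of_forall fun ξ y _ => (hd ξ y).hasFDerivAt)

end Mean

/-! ### Derivative bounds for the sample functions -/

section Families

variable {d p : ℕ} {I J : Type*} {g : I → Vec d → Vec p} {f : J → Vec p → ℝ} {lf lg Lf Lg : ℝ}

lemma gradient_eq_toDual (h : Vec p → ℝ) (y : Vec p) :
    gradient h y = (InnerProductSpace.toDual ℝ (Vec p)).symm (fderiv ℝ h y) := rfl

lemma norm_gradient_le (hf : SmoothLoss f lf Lf) (η : J) (y : Vec p) :
    ‖gradient (f η) y‖ ≤ lf := by
  rw [gradient_eq_toDual, LinearIsometryEquiv.norm_map]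
  exact norm_fderiv_le_of_norm_sub_le hf.nonneg.1 (hf.lip η) y

lemma norm_fderiv_sub_le (hg : SmoothMap g lg Lg) (ξ : I) (x x' : Vec d) :
    ‖fderiv ℝ (g ξ) x - fderiv ℝ (g ξ) x'‖ ≤ Lg * ‖x - x'‖ :=
  (norm_le_frobNorm _).trans (hg.jac_lip ξ x x')

end Families

/-! ### The mean maps -/

section MeanMap

variable {d p : ℕ} {I J : Type*} [MeasurableSpace I] [MeasurableSpace J]
  {μ : Measure I} {ν : Measure J} [IsProbabilityMeasure μ] [IsProbabilityMeasure ν]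
  {g : I → Vec d → Vec p} {f : J → Vec p → ℝ} {lf lg Lf Lg : ℝ}

lemma fderiv_meanMap (hg : SmoothMap g lg Lg) (hm : ∀ x, Measurable fun ξ => g ξ x)
    (hint : ∀ x, Integrable (fun ξ => g ξ x) μ) (x : Vec d) :
    fderiv ℝ (meanMap μ g) x = ∫ ξ, fderiv ℝ (g ξ) x ∂μ :=
  (hasFDerivAt_integral_family hg.nonneg.1 hg.diff hg.lip hm hint x).fderiv

lemma entries_integral {μ : Measure I} {M : I → Vec d →L[ℝ] Vec p} (hM : Integrable M μ) :
    entries (∫ ξ, M ξ ∂μ) = ∫ ξ, entries (M ξ) ∂μ :=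
  (ContinuousLinearMap.integral_comp_comm
    (LinearMap.toContinuousLinearMap (entries (d := d) (p := p))) hM).symm

lemma integrable_entries {μ : Measure I} {M : I → Vec d →L[ℝ] Vec p} (hM : Integrable M μ) :
    Integrable (fun ξ => entries (M ξ)) μ :=
  (LinearMap.toContinuousLinearMap (entries (d := d) (p := p))).integrable_comp hM

/-- All Lipschitz constants survive averaging. The Jacobian bound passes through `entries`, a linear
map that commutes with the integral. Regarding the mean as a family over `Unit` allows the same
structure to describe it. -/
lemma SmoothMap.meanMap (hg : SmoothMap g lg Lg) (hm : ∀ x, Measurable fun ξ => g ξ x)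
    (hint : ∀ x, Integrable (fun ξ => g ξ x) μ) :
    SmoothMap (fun _ : Unit => meanMap μ g) lg Lg where
  nonneg := hg.nonneg
  diff _ x := (hasFDerivAt_integral_family hg.nonneg.1 hg.diff hg.lip hm hint x).differentiableAt
  lip _ x x' := norm_integral_sub_integral_le (hint x) (hint x') fun ξ => hg.lip ξ x x'
  jac_lip _ x x' := by
    have h1 := fun x => integrable_fderiv_family (μ := μ) hg.nonneg.1 hg.diff hg.lip hm x
    rw [fderiv_meanMap hg hm hint, fderiv_meanMap hg hm hint, ← norm_entries, map_sub,
      entries_integral (h1 _), entries_integral (h1 _)]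
    refine norm_integral_sub_integral_le (integrable_entries (h1 _)) (integrable_entries (h1 _))
      fun ξ => ?_
    rw [← map_sub, norm_entries]
    exact hg.jac_lip ξ x x'

lemma measurable_gradient_family (hf : SmoothLoss f lf Lf) (hm : ∀ y, Measurable fun η => f η y)
    (y : Vec p) : Measurable fun η => gradient (f η) y :=
  (InnerProductSpace.toDual ℝ (Vec p)).symm.continuous.measurable.comp
    (measurable_fderiv_family hf.diff hm y)

lemma integrable_gradient_family (hf : SmoothLoss f lf Lf)
    (hm : ∀ y, Measurable fun η => f η y) (y : Vec p) :
    Integrable (fun η => gradient (f η) y) ν :=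
  Integrable.of_bound (measurable_gradient_family hf hm y).aestronglyMeasurable lf
    (.of_forall fun η => norm_gradient_le hf η y)

lemma gradient_meanLoss (hf : SmoothLoss f lf Lf) (hm : ∀ y, Measurable fun η => f η y)
    (hint : ∀ y, Integrable (fun η => f η y) ν) (y : Vec p) :
    gradient (meanLoss ν f) y = ∫ η, gradient (f η) y ∂ν := by
  have hlip : ∀ η y y', ‖f η y - f η y'‖ ≤ lf * ‖y - y'‖ := hf.lip
  have h1 : fderiv ℝ (meanLoss ν f) y = ∫ η, fderiv ℝ (f η) y ∂ν :=
    (hasFDerivAt_integral_family hf.nonneg.1 hf.diff hlip hm hint y).fderiv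
  refine ext_inner_left ℝ fun v => ?_
  rw [← integral_inner (integrable_gradient_family hf hm y), real_inner_comm,
    gradient_eq_toDual, InnerProductSpace.toDual_symm_apply, h1,
    ContinuousLinearMap.integral_apply (integrable_fderiv_family hf.nonneg.1 hf.diff hlip hm y)]
  refine integral_congr_ae (.of_forall fun η => ?_)
  simp only []
  rw [real_inner_comm, gradient_eq_toDual, InnerProductSpace.toDual_symm_apply]

lemma SmoothLoss.meanLoss (hf : SmoothLoss f lf Lf) (hm : ∀ y, Measurable fun η => f η y)
    (hint : ∀ y, Integrable (fun η => f η y) ν) :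
    SmoothLoss (fun _ : Unit => meanLoss ν f) lf Lf where
  nonneg := hf.nonneg
  diff _ y := (hasFDerivAt_integral_family hf.nonneg.1 hf.diff
    hf.lip hm hint y).differentiableAt
  lip _ y y' := norm_integral_sub_integral_le (hint y) (hint y') fun η => hf.lip η y y'
  grad_lip _ y y' := by
    rw [gradient_meanLoss hf hm hint, gradient_meanLoss hf hm hint]
    exact norm_integral_sub_integral_le (integrable_gradient_family hf hm y)
      (integrable_gradient_family hf hm y') fun η => hf.grad_lip η y y'

/-! ### Joint measurability -/

/-- A Carathéodory function, continuous in the point and measurable in the sample, is jointly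
measurable. This is needed because the points at which the samples are evaluated are themselves
random. -/
lemma measurable_uncurry_of_norm_sub_le {V W : Type*} [NormedAddCommGroup V]
    [SecondCountableTopology V] [MeasurableSpace V] [BorelSpace V] [NormedAddCommGroup W]
    [MeasurableSpace W] [BorelSpace W] {h : I → V → W} {l : ℝ}
    (hlip : ∀ ξ x x', ‖h ξ x - h ξ x'‖ ≤ l * ‖x - x'‖) (hm : ∀ x, Measurable fun ξ => h ξ x) :
    Measurable fun q : I × V => h q.1 q.2 := by
  have hc : ∀ ξ, Continuous (h ξ) := fun ξ => by
    have : LipschitzWith l.toNNReal (h ξ) := LipschitzWith.of_dist_le_mul fun x y => by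
      rw [dist_eq_norm, dist_eq_norm]
      refine (hlip ξ x y).trans ?_
      gcongr
      exact Real.le_coe_toNNReal l
    exact this.continuous
  have := measurable_uncurry_of_continuous_of_measurable (u := fun x ξ => h ξ x) hc hm
  exact this.comp measurable_swap

lemma measurable_uncurry_map (hg : SmoothMap g lg Lg) (hm : ∀ x, Measurable fun ξ => g ξ x) :
    Measurable fun q : I × Vec d => g q.1 q.2 :=
  measurable_uncurry_of_norm_sub_le hg.lip hm

lemma measurable_uncurry_fderiv (hg : SmoothMap g lg Lg)
    (hm : ∀ x, Measurable fun ξ => g ξ x) :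
    Measurable fun q : I × Vec d => fderiv ℝ (g q.1) q.2 :=
  measurable_uncurry_of_norm_sub_le (h := fun ξ x => fderiv ℝ (g ξ) x) (norm_fderiv_sub_le hg)
    (measurable_fderiv_family hg.diff hm)

lemma measurable_uncurry_gradient (hf : SmoothLoss f lf Lf)
    (hm : ∀ y, Measurable fun η => f η y) :
    Measurable fun q : J × Vec p => gradient (f q.1) q.2 :=
  measurable_uncurry_of_norm_sub_le (h := fun η y => gradient (f η) y) hf.grad_lip
    (measurable_gradient_family hf hm)

end MeanMap

/-! ### The gradient of a composition -/

section Composition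

variable {d p : ℕ} {G : Vec d → Vec p} {H : Vec p → ℝ} {lf lg Lf Lg : ℝ}

lemma gradient_comp (hG : Differentiable ℝ G) (hH : Differentiable ℝ H) (x : Vec d) :
    gradient (fun x => H (G x)) x =
      ContinuousLinearMap.adjoint (fderiv ℝ G x) (gradient H (G x)) := by
  have h1 : HasFDerivAt (fun x => H (G x)) ((fderiv ℝ H (G x)).comp (fderiv ℝ G x)) x :=
    (hH (G x)).hasFDerivAt.comp x (hG x).hasFDerivAt
  refine ext_inner_right ℝ fun v => ?_
  rw [ContinuousLinearMap.adjoint_inner_left, gradient_eq_toDual, gradient_eq_toDual, h1.fderiv]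
  simp

lemma adjoint_apply_sub_le (A B : Vec d →L[ℝ] Vec p) (u v : Vec p) :
    ‖ContinuousLinearMap.adjoint A u - ContinuousLinearMap.adjoint B v‖ ≤
      ‖A - B‖ * ‖u‖ + ‖B‖ * ‖u - v‖ := by
  have : ContinuousLinearMap.adjoint A u - ContinuousLinearMap.adjoint B v =
      ContinuousLinearMap.adjoint (A - B) u + ContinuousLinearMap.adjoint B (u - v) := by
    simp [map_sub]
  rw [this]
  refine (norm_add_le _ _).trans (add_le_add ?_ ?_)
  · simpa only [LinearIsometryEquiv.norm_map] using
      (ContinuousLinearMap.adjoint (A - B)).le_opNorm u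
  · simpa only [LinearIsometryEquiv.norm_map] using
      (ContinuousLinearMap.adjoint B).le_opNorm (u - v)

/-- The source of `LF`: changing the Jacobian costs `Lg * lf`, and changing the outer gradient costs
`lg * Lf * lg`. -/
lemma norm_gradient_comp_sub_le (hG : SmoothMap (fun _ : Unit => G) lg Lg)
    (hH : SmoothLoss (fun _ : Unit => H) lf Lf) (x x' : Vec d) :
    ‖gradient (fun x => H (G x)) x - gradient (fun x => H (G x)) x'‖ ≤
      LF lf lg Lf Lg * ‖x - x'‖ := by
  rw [gradient_comp (hG.diff ()) (hH.diff ()), gradient_comp (hG.diff ()) (hH.diff ())]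
  refine (adjoint_apply_sub_le _ _ _ _).trans ?_
  have h1 := norm_fderiv_sub_le hG () x x'
  have h2 := norm_gradient_le hH () (G x)
  have h3 := norm_fderiv_le_of_norm_sub_le hG.nonneg.1 (hG.lip ()) x'
  have h4 := hH.grad_lip () (G x) (G x')
  have h5 := hG.lip () x x'
  have hlg := hG.nonneg.1
  have hLf := hH.nonneg.2
  have hLg := hG.nonneg.2
  calc _ ≤ (Lg * ‖x - x'‖) * lf + lg * (Lf * (lg * ‖x - x'‖)) := by
        gcongr
        exact h4.trans (by gcongr)
    _ = _ := by unfold LF; ring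

/-- The error of the gradient estimate, in terms of the errors of its three components. -/
lemma norm_estimate_sub_gradient_le (hG : SmoothMap (fun _ : Unit => G) lg Lg)
    (hH : SmoothLoss (fun _ : Unit => H) lf Lf) {ε : ℝ} (hε : 0 < ε) (hεl : ε ≤ lf * lg)
    (z : Vec d) (gE v : Vec p) (M : Vec d →L[ℝ] Vec p) :
    ‖ContinuousLinearMap.adjoint M v - gradient (fun x => H (G x)) z‖ ≤
      3 / 2 * ε + (lf ^ 2 * frobNorm (M - fderiv ℝ G z) ^ 2 + lg ^ 2 * ‖v - gradient H gE‖ ^ 2 +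
        Lf ^ 2 * lg ^ 2 * ‖gE - G z‖ ^ 2) / ε := by
  rw [gradient_comp (hG.diff ()) (hH.diff ())]
  have hlf := hH.nonneg.1
  have hlg := hG.nonneg.1
  have hLf := hH.nonneg.2
  set A := frobNorm (M - fderiv ℝ G z) with hA
  set B := ‖v - gradient H gE‖ with hB
  set Q := ‖gE - G z‖ with hQ
  have hA0 : 0 ≤ A := Real.sqrt_nonneg _
  have hB0 : 0 ≤ B := norm_nonneg _
  have h0 := adjoint_apply_sub_le M (fderiv ℝ G z) v (gradient H (G z))
  have h1 : ‖M - fderiv ℝ G z‖ ≤ A := norm_le_frobNorm _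
  have h2 : ‖v‖ ≤ B + lf := by
    have := norm_add_le (v - gradient H gE) (gradient H gE)
    rw [sub_add_cancel] at this
    linarith [norm_gradient_le hH () gE]
  have h3 := norm_fderiv_le_of_norm_sub_le hG.nonneg.1 (hG.lip ()) z
  have h4 : ‖v - gradient H (G z)‖ ≤ B + Lf * Q := by
    have := norm_add_le (v - gradient H gE) (gradient H gE - gradient H (G z))
    rw [sub_add_sub_cancel] at this
    linarith [hH.grad_lip () gE (G z)]
  have h5 : ‖ContinuousLinearMap.adjoint M v -
      ContinuousLinearMap.adjoint (fderiv ℝ G z) (gradient H (G z))‖ ≤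
      A * (B + lf) + lg * (B + Lf * Q) := h0.trans (by gcongr)
  refine h5.trans ?_
  rw [← sub_le_iff_le_add', le_div_iff₀ hε]
  -- The product of two errors has no Lipschitz factors of its own; `ε ≤ lf * lg` supplies them at
  -- the price of `1 / ε`. The three linear terms are split by `a ≤ ε / 2 + a ^ 2 / (2 * ε)`, which
  -- produces `3 / 2 * ε`.
  have h6 : A * B * ε ≤ (lf * A) * (lg * B) := by
    calc A * B * ε ≤ A * B * (lf * lg) := by gcongr
      _ = _ := by ring
  nlinarith [sq_nonneg (lf * A - lg * B), sq_nonneg (lf * A - ε), sq_nonneg (lg * B - ε),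
    sq_nonneg (Lf * lg * Q - ε), sq_nonneg (Lf * lg * Q)]

end Composition

/-! ### Variance of batch means -/

/-- A law of batches whose entries have law `μ` and are pairwise non-positively correlated. -/
structure UnbiasedBatch {I : Type*} [MeasurableSpace I] (μ : Measure I) {m : ℕ}
    (ρ : Measure (Fin m → I)) : Prop where
  prob : IsProbabilityMeasure ρ
  marginal : ∀ i, MeasurePreserving (fun s : Fin m → I => s i) ρ μ
  cov : ∀ i j, i ≠ j → ∀ φ : I → ℝ, MemLp φ 2 μ → ∫ ξ, φ ξ ∂μ = 0 →
    ∫ s, φ (s i) * φ (s j) ∂ρ ≤ 0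

section Variance

variable {I : Type*} [MeasurableSpace I] {μ : Measure I} {m : ℕ} {ρ : Measure (Fin m → I)}
  {κ : Type*} [Fintype κ]

lemma UnbiasedBatch.memLp (h : UnbiasedBatch μ ρ) {φ : I → EuclideanSpace ℝ κ}
    (hφ : MemLp φ 2 μ) (i : Fin m) : MemLp (fun s => φ (s i)) 2 ρ :=
  hφ.comp_measurePreserving (h.marginal i)

lemma UnbiasedBatch.integral_eval (h : UnbiasedBatch μ ρ) {E : Type*} [NormedAddCommGroup E]
    [NormedSpace ℝ E] {φ : I → E} (hφ : AEStronglyMeasurable φ μ) (i : Fin m) :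
    ∫ s, φ (s i) ∂ρ = ∫ ξ, φ ξ ∂μ := by
  rw [← (h.marginal i).map_eq, integral_map (h.marginal i).measurable.aemeasurable
    (by rwa [(h.marginal i).map_eq])]

/-- The scalar covariance condition, applied to each coordinate and summed. -/
lemma UnbiasedBatch.integral_inner_le (h : UnbiasedBatch μ ρ) [IsFiniteMeasure μ]
    {φ : I → EuclideanSpace ℝ κ} (hφ : MemLp φ 2 μ) (h0 : ∫ ξ, φ ξ ∂μ = 0) {i j : Fin m}
    (hij : i ≠ j) : ∫ s, inner ℝ (φ (s i)) (φ (s j)) ∂ρ ≤ 0 := by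
  have hcoord : ∀ k, MemLp (fun ξ => φ ξ k) 2 μ := fun k =>
    (EuclideanSpace.proj k : EuclideanSpace ℝ κ →L[ℝ] ℝ).comp_memLp' hφ
  have hcoord0 : ∀ k, ∫ ξ, φ ξ k ∂μ = 0 := fun k => by
    have := (EuclideanSpace.proj k : EuclideanSpace ℝ κ →L[ℝ] ℝ).integral_comp_comm
      (hφ.integrable one_le_two)
    rw [h0] at this
    simpa using this
  have hin : ∀ s : Fin m → I, inner ℝ (φ (s i)) (φ (s j)) =
      ∑ k, φ (s i) k * φ (s j) k := fun s => by
    simp [PiLp.inner_apply, mul_comm]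
  simp_rw [hin]
  rw [integral_finsetSum]
  · exact Finset.sum_nonpos fun k _ => h.cov i j hij _ (hcoord k) (hcoord0 k)
  · intro k _
    exact ((hcoord k).comp_measurePreserving (h.marginal i)).integrable_mul
      ((hcoord k).comp_measurePreserving (h.marginal j))

/-- The bias-variance decomposition of a batch mean. -/
lemma UnbiasedBatch.lintegral_add_batchMean_le (h : UnbiasedBatch μ ρ) [IsFiniteMeasure μ]
    {φ : I → EuclideanSpace ℝ κ} (hφ : MemLp φ 2 μ) (h0 : ∫ ξ, φ ξ ∂μ = 0) {V : ℝ}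
    (hV : ∫ ξ, ‖φ ξ‖ ^ 2 ∂μ ≤ V) (e : EuclideanSpace ℝ κ) :
    ∫⁻ s, ENNReal.ofReal (‖e + batchMean fun i => φ (s i)‖ ^ 2) ∂ρ ≤
      ENNReal.ofReal (‖e‖ ^ 2 + V / m) := by
  have := h.prob
  have hmem := h.memLp hφ
  have hint : ∀ i, Integrable (fun s => φ (s i)) ρ := fun i => (hmem i).integrable one_le_two
  have hinner : ∀ i j, Integrable (fun s => inner ℝ (φ (s i)) (φ (s j))) ρ := fun i j =>
    ((hmem i).norm.integrable_mul (hmem j).norm).mono'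
      ((hmem i).aestronglyMeasurable.inner (hmem j).aestronglyMeasurable)
      (.of_forall fun s => norm_inner_le_norm _ _)
  have hX : MemLp (fun s => e + batchMean fun i => φ (s i)) 2 ρ := by
    refine (memLp_const e).add ?_
    have hsum : MemLp (fun s : Fin m → I => ∑ i, φ (s i)) 2 ρ :=
      memLp_finsetSum Finset.univ (f := fun i (s : Fin m → I) => φ (s i)) fun i _ => hmem i
    exact hsum.const_smul (m : ℝ)⁻¹
  rw [← ofReal_integral_eq_lintegral_ofReal hX.integrable_norm_pow' (.of_forall fun s => by positivity)]
  refine ENNReal.ofReal_le_ofReal ?_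
  -- After integration the cross terms with `e` vanish because `φ` is centered, the off-diagonal
  -- pairs are nonpositive, and each of the `m` diagonal terms is at most `V`.
  have hexp : ∀ s : Fin m → I, ‖e + batchMean fun i => φ (s i)‖ ^ 2 =
      ‖e‖ ^ 2 + 2 * (m : ℝ)⁻¹ * ∑ i, inner ℝ e (φ (s i)) +
        ((m : ℝ)⁻¹) ^ 2 * ∑ i, ∑ j, inner ℝ (φ (s i)) (φ (s j)) := fun s => by
    rw [norm_add_sq_real, batchMean, norm_smul, inner_smul_right, inner_sum, mul_pow,
      ← real_inner_self_eq_norm_sq (∑ i, φ (s i)), sum_inner]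
    simp_rw [inner_sum]
    rw [Real.norm_of_nonneg (by positivity)]; ring
  simp_rw [hexp]
  have hi1 : Integrable (fun s => ∑ i, inner ℝ e (φ (s i))) ρ :=
    integrable_finsetSum _ fun i _ => (hint i).const_inner e
  have hi2 : Integrable (fun s => ∑ i, ∑ j, inner ℝ (φ (s i)) (φ (s j))) ρ :=
    integrable_finsetSum _ fun i _ => integrable_finsetSum _ fun j _ => hinner i j
  rw [integral_add (by fun_prop) (hi2.const_mul _),
    integral_add (integrable_const _) (hi1.const_mul _), integral_const_mul, integral_const_mul,
    integral_finsetSum _ fun i _ => (hint i).const_inner e,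
    integral_finsetSum _ fun i _ => integrable_finsetSum _ fun j _ => hinner i j]
  have hz : ∀ i, ∫ s, inner ℝ e (φ (s i)) ∂ρ = 0 := fun i => by
    rw [integral_inner (hint i), h.integral_eval hφ.aestronglyMeasurable, h0, inner_zero_right]
  have hrow : ∀ i, ∫ s, ∑ j, inner ℝ (φ (s i)) (φ (s j)) ∂ρ ≤ V := fun i => by
    rw [integral_finsetSum _ fun j _ => hinner i j, ← Finset.add_sum_erase _ _ (Finset.mem_univ i)]
    have h1 : ∫ s, inner ℝ (φ (s i)) (φ (s i)) ∂ρ ≤ V := by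
      simp_rw [real_inner_self_eq_norm_sq]
      rw [h.integral_eval (φ := fun ξ => ‖φ ξ‖ ^ 2) (hφ.aestronglyMeasurable.norm.pow 2)]
      exact hV
    have h2 : ∑ j ∈ Finset.univ.erase i, ∫ s, inner ℝ (φ (s i)) (φ (s j)) ∂ρ ≤ 0 :=
      Finset.sum_nonpos fun j hj => h.integral_inner_le hφ h0 (Finset.ne_of_mem_erase hj).symm
    linarith
  have hdbl : ∑ i, ∫ s, ∑ j, inner ℝ (φ (s i)) (φ (s j)) ∂ρ ≤ m * V := by
    refine (Finset.sum_le_sum fun i _ => hrow i).trans ?_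
    simp
  simp only [hz, Finset.sum_const_zero, mul_zero, add_zero, integral_const, probReal_univ,
    one_smul]
  have hfin : ((m : ℝ)⁻¹) ^ 2 * ∑ i, ∫ s, ∑ j, inner ℝ (φ (s i)) (φ (s j)) ∂ρ ≤ V / m := by
    -- For an empty batch both sides are zero, with `V / 0 = 0`.
    rcases Nat.eq_zero_or_pos m with hm | hm
    · subst hm; simp
    · calc _ ≤ ((m : ℝ)⁻¹) ^ 2 * (m * V) := by gcongr
        _ = V / m := by field_simp
  linarith

lemma UnbiasedBatch.lintegral_add_batchMean_sub_le (h : UnbiasedBatch μ ρ)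
    [IsProbabilityMeasure μ] (hm : 0 < m) {φ : I → EuclideanSpace ℝ κ} (hφ : MemLp φ 2 μ)
    {V : ℝ} (hV : ∫ ξ, ‖φ ξ - ∫ ξ', φ ξ' ∂μ‖ ^ 2 ∂μ ≤ V) (e : EuclideanSpace ℝ κ) :
    ∫⁻ s, ENNReal.ofReal (‖e + ((batchMean fun i => φ (s i)) - ∫ ξ', φ ξ' ∂μ)‖ ^ 2) ∂ρ ≤
      ENNReal.ofReal (‖e‖ ^ 2 + V / m) := by
  have h1 : MemLp (fun ξ => φ ξ - ∫ ξ', φ ξ' ∂μ) 2 μ := hφ.sub (memLp_const _)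
  have h2 : ∫ ξ, (φ ξ - ∫ ξ', φ ξ' ∂μ) ∂μ = 0 := by
    rw [integral_sub (hφ.integrable one_le_two) (integrable_const _)]; simp
  convert h.lintegral_add_batchMean_le h1 h2 hV e using 6 with s
  simp only [batchMean, Finset.sum_sub_distrib, Finset.sum_const, Finset.card_univ,
    Fintype.card_fin, smul_sub, ← Nat.cast_smul_eq_nsmul ℝ]
  rw [inv_smul_smul₀ (by positivity)]

/-- A pointwise bound: every deviation from the mean is at most `2 * b`. It asks for no
measurability of `φ`. -/
lemma integral_norm_sub_integral_sq_le {E : Type*} [NormedAddCommGroup E] [NormedSpace ℝ E]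
    [IsProbabilityMeasure μ] {φ : I → E} {b : ℝ} (hb : ∀ ξ, ‖φ ξ‖ ≤ b) :
    ∫ ξ, ‖φ ξ - ∫ ξ', φ ξ' ∂μ‖ ^ 2 ∂μ ≤ 4 * b ^ 2 := by
  have h1 : ‖∫ ξ', φ ξ' ∂μ‖ ≤ b := by
    simpa using norm_integral_le_of_norm_le_const (μ := μ) (.of_forall hb)
  have h2 : ∀ ξ, ‖φ ξ - ∫ ξ', φ ξ' ∂μ‖ ^ 2 ≤ 4 * b ^ 2 := fun ξ => by
    have h3 : ‖φ ξ - ∫ ξ', φ ξ' ∂μ‖ ≤ 2 * b := by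
      linarith [norm_sub_le (φ ξ) (∫ ξ', φ ξ' ∂μ), hb ξ]
    nlinarith [norm_nonneg (φ ξ - ∫ ξ', φ ξ' ∂μ)]
  have h4 := norm_integral_le_of_norm_le_const (μ := μ)
    (.of_forall fun ξ => by simpa using h2 ξ :
      ∀ᵐ ξ ∂μ, ‖‖φ ξ - ∫ ξ', φ ξ' ∂μ‖ ^ 2‖ ≤ 4 * b ^ 2)
  simp only [probReal_univ, mul_one] at h4
  exact (le_abs_self _).trans h4

/-- The effect of a bounded correction on the mean square error. -/
lemma UnbiasedBatch.lintegral_correction_le (h : UnbiasedBatch μ ρ) [IsProbabilityMeasure μ]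
    (hm : 0 < m) {φ : I → EuclideanSpace ℝ κ} (hφ : AEStronglyMeasurable φ μ) {b : ℝ}
    (hb : ∀ ξ, ‖φ ξ‖ ≤ b) (e : EuclideanSpace ℝ κ) :
    ∫⁻ s, ENNReal.ofReal (‖e + ((batchMean fun i => φ (s i)) - ∫ ξ', φ ξ' ∂μ)‖ ^ 2) ∂ρ ≤
      ENNReal.ofReal (‖e‖ ^ 2 + 4 * b ^ 2 / m) :=
  h.lintegral_add_batchMean_sub_le hm (.of_bound hφ b (.of_forall hb))
    (integral_norm_sub_integral_sq_le hb) e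

end Variance

/-! ### Batches of independent samples -/

/-- For independent entries the covariance is exactly zero. -/
lemma unbiasedBatch_pi {I : Type*} [MeasurableSpace I] (μ : Measure I) [IsProbabilityMeasure μ]
    (m : ℕ) : UnbiasedBatch μ (Measure.pi fun _ : Fin m => μ) where
  prob := inferInstance
  marginal i := measurePreserving_eval (fun _ : Fin m => μ) i
  cov i j hij φ hφ h0 := by
    have hind : iIndepFun (fun (i : Fin m) (s : Fin m → I) => φ (s i))
        (Measure.pi fun _ : Fin m => μ) :=
      iIndepFun_pi (X := fun _ => φ) fun _ => hφ.aestronglyMeasurable.aemeasurable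
    have hmp := measurePreserving_eval (fun _ : Fin m => μ)
    have hm : ∀ i, AEStronglyMeasurable (fun s : Fin m → I => φ (s i))
        (Measure.pi fun _ : Fin m => μ) := fun i =>
      (hφ.comp_measurePreserving (hmp i)).aestronglyMeasurable
    have h1 := (hind.indepFun hij).integral_mul_eq_mul_integral (hm i) (hm j)
    have h2 : ∫ s, φ (s i) ∂(Measure.pi fun _ : Fin m => μ) = 0 := by
      rw [← h0]
      conv_rhs => rw [← (hmp i).map_eq]
      rw [integral_map (hmp i).measurable.aemeasurable]
      rw [(hmp i).map_eq]
      exact hφ.aestronglyMeasurable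
    rw [h2, zero_mul] at h1
    exact h1.le

/-! ### Uniform samples from a finite set -/

section Uniform

variable {n m : ℕ}

lemma integral_uniformOn_univ {E : Type*} [NormedAddCommGroup E] [NormedSpace ℝ E]
    [CompleteSpace E] (φ : Fin n → E) :
    ∫ i, φ i ∂(uniformOn (Set.univ : Set (Fin n))) = (n : ℝ)⁻¹ • ∑ i, φ i := by
  rcases Nat.eq_zero_or_pos n with hn | hn
  · subst hn
    have : uniformOn (Set.univ : Set (Fin 0)) = 0 := by simp; infer_instance
    rw [this]; simp
  · have : NeZero n := ⟨hn.ne'⟩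
    rw [integral_fintype (Integrable.of_finite), Finset.smul_sum]
    refine Finset.sum_congr rfl fun i _ => ?_
    congr 1
    simp [Measure.real, uniformOn_univ]

/-- A uniform measure is invariant under the symmetries of its support. -/
lemma measurePreserving_uniformOn {X : Type*} [MeasurableSpace X] [MeasurableSingletonClass X]
    [Finite X] (A : Set X) (e : Equiv.Perm X) (he : ∀ x, e x ∈ A ↔ x ∈ A) :
    MeasurePreserving e (uniformOn A) (uniformOn A) := by
  refine ⟨measurable_of_finite _, ?_⟩
  ext B hB
  rw [Measure.map_apply (measurable_of_finite _) hB, uniformOn, cond_apply A.toFinite.measurableSet,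
    cond_apply A.toFinite.measurableSet]
  congr 1
  rw [← Measure.count_injective_image e.injective]
  congr 1
  ext y
  constructor
  · rintro ⟨x, ⟨hx, hx'⟩, rfl⟩
    exact ⟨(he x).2 hx, hx'⟩
  · rintro ⟨hy, hy'⟩
    exact ⟨e.symm y, ⟨(he _).1 (by simpa using hy), by simpa using hy'⟩, by simp⟩

/-- The values of a centered function at two different random places are non-positively
correlated. -/
lemma sum_perm_mul_nonpos (φ : Fin n → ℝ) (h0 : ∑ i, φ i = 0) {a b : Fin n} (hab : a ≠ b) :
    ∑ σ : Equiv.Perm (Fin n), φ (σ a) * φ (σ b) ≤ 0 := by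
  set Q := ∑ σ : Equiv.Perm (Fin n), φ (σ a) * φ (σ b) with hQ
  -- Composition with the transposition of `b` and `b'` permutes the summands and fixes the place
  -- `a`, so the sum does not depend on the second place.
  have hsame : ∀ b' ∈ Finset.univ.erase a,
      ∑ σ : Equiv.Perm (Fin n), φ (σ a) * φ (σ b') = Q := by
    intro b' hb'
    have hb' := Finset.ne_of_mem_erase hb'
    rw [hQ, ← Equiv.sum_comp (Equiv.mulRight (Equiv.swap b b'))]
    refine Finset.sum_congr rfl fun σ _ => ?_
    simp [Equiv.swap_apply_of_ne_of_ne hab hb'.symm]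
  -- Summed over all second places, the values other than `φ (σ a)` add up to `-φ (σ a)`, leaving
  -- minus a square for every permutation.
  have hsum : ∑ b' ∈ Finset.univ.erase a, ∑ σ : Equiv.Perm (Fin n), φ (σ a) * φ (σ b') ≤ 0 := by
    rw [Finset.sum_comm]
    refine Finset.sum_nonpos fun σ _ => ?_
    rw [← Finset.mul_sum]
    have h1 : ∑ b' ∈ Finset.univ.erase a, φ (σ b') = -φ (σ a) := by
      have h2 := Finset.add_sum_erase Finset.univ (fun b' => φ (σ b')) (Finset.mem_univ a)
      rw [Equiv.sum_comp σ φ, h0] at h2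
      linarith
    rw [h1]; nlinarith [sq_nonneg (φ (σ a))]
  rw [Finset.sum_congr rfl hsame, Finset.sum_const, nsmul_eq_mul] at hsum
  have hcard : 0 < (Finset.univ.erase a).card :=
    Finset.card_pos.mpr ⟨b, Finset.mem_erase.mpr ⟨hab.symm, Finset.mem_univ b⟩⟩
  have : (0 : ℝ) < (Finset.univ.erase a).card := by exact_mod_cast hcard
  nlinarith

/-- The law on injections is invariant under relabelling the indices. Hence each marginal is
invariant under all permutations and so uniform, and a covariance equals its average over
relabellings, where `sum_perm_mul_nonpos` applies. The probability hypothesis rules out `n < m`,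
when there are no injections and the law is zero. -/
lemma unbiasedBatch_withoutReplacement
    (h : IsProbabilityMeasure (batchLaw .withoutReplacement n m)) :
    UnbiasedBatch (uniformOn Set.univ) (batchLaw .withoutReplacement n m) where
  prob := h
  marginal i := by
    refine ⟨measurable_pi_apply i, ?_⟩
    have hinv : ∀ e : Equiv.Perm (Fin n), MeasurePreserving e
        ((batchLaw .withoutReplacement n m).map fun s => s i)
        ((batchLaw .withoutReplacement n m).map fun s => s i) := fun e => by
      have h1 := measurePreserving_uniformOn {s : Fin m → Fin n | Function.Injective s}
        (Equiv.piCongrRight fun _ => e) fun s => by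
          change Function.Injective (e ∘ s) ↔ _
          exact e.injective.of_comp_iff s
      refine ⟨measurable_of_finite _, ?_⟩
      conv_rhs => rw [batchLaw, ← h1.map_eq]
      rw [Measure.map_map (measurable_of_finite _) (measurable_of_finite _),
        Measure.map_map (measurable_of_finite _) (measurable_of_finite _)]
      rfl
    set P := (batchLaw .withoutReplacement n m).map fun s => s i with hP
    have hprob : IsProbabilityMeasure P :=
      Measure.isProbabilityMeasure_map (measurable_of_finite _).aemeasurable
    have hsingle : ∀ a b : Fin n, P {a} = P {b} := fun a b => by
      have h1 := (hinv (Equiv.swap a b)).measure_preimage (s := {b})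
        (measurableSet_singleton b).nullMeasurableSet
      rw [← h1]
      congr 1
      ext x
      simp only [Set.mem_singleton_iff, Set.mem_preimage]
      constructor
      · rintro rfl; simp
      · intro hx
        rw [Equiv.swap_apply_eq_iff] at hx
        simpa using hx
    have hn : Nonempty (Fin n) := by
      by_contra hne
      rw [not_nonempty_iff] at hne
      have := hprob.measure_univ
      rw [Set.eq_empty_of_isEmpty (Set.univ : Set (Fin n))] at this
      simp at this
    have : NeZero n := ⟨fun h0 => by subst h0; exact hn.elim finZeroElim⟩
    refine Measure.ext_of_singleton fun a => ?_
    have hsum : ∑ b : Fin n, P {b} = 1 := by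
      rw [← hprob.measure_univ, ← Finset.coe_univ, ← sum_measure_singleton]
    simp_rw [fun b => hsingle b a] at hsum
    rw [Finset.sum_const, nsmul_eq_mul] at hsum
    rw [uniformOn_univ, Measure.count_singleton, ENNReal.eq_div_iff (by simpa using NeZero.ne _) (by simp)]
    simpa using hsum
  cov i j hij φ _ h0 := by
    rw [integral_uniformOn_univ, smul_eq_mul] at h0
    set ρ := batchLaw .withoutReplacement n m with hρ
    -- Relabelling invariance replaces the single covariance by an average over all `σ`, which can
    -- be estimated for each fixed injective sample.
    have hperm : ∀ σ : Equiv.Perm (Fin n),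
        ∫ s, φ (σ (s i)) * φ (σ (s j)) ∂ρ = ∫ s, φ (s i) * φ (s j) ∂ρ := fun σ => by
      have h1 := measurePreserving_uniformOn {s : Fin m → Fin n | Function.Injective s}
        (Equiv.piCongrRight fun _ => σ) fun s => by
          change Function.Injective (σ ∘ s) ↔ _
          exact σ.injective.of_comp_iff s
      conv_rhs => rw [hρ, batchLaw, ← h1.map_eq]
      rw [integral_map (measurable_of_finite _).aemeasurable
        (measurable_of_finite _).aestronglyMeasurable]
      rfl
    have hinj : ∀ᵐ s ∂ρ, Function.Injective s :=
      ae_cond_mem (Set.toFinite {s : Fin m → Fin n | Function.Injective s}).measurableSet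
    have hsum : ∑ σ : Equiv.Perm (Fin n), ∫ s, φ (σ (s i)) * φ (σ (s j)) ∂ρ ≤ 0 := by
      rw [← integral_finsetSum _ fun σ _ => Integrable.of_finite]
      refine integral_nonpos_of_ae ?_
      filter_upwards [hinj] with s hs
      have hn : (n : ℝ) ≠ 0 := by
        have := (s i).pos
        positivity
      refine sum_perm_mul_nonpos φ ?_ (hs.ne hij)
      simpa [hn] using h0
    simp_rw [hperm] at hsum
    rw [Finset.sum_const, nsmul_eq_mul] at hsum
    have : (0 : ℝ) < (Finset.univ : Finset (Equiv.Perm (Fin n))).card := by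
      exact_mod_cast Finset.card_pos.mpr Finset.univ_nonempty
    nlinarith

lemma unbiasedBatch_batchLaw (hn : 0 < n) (mode : Sampling)
    (h : IsProbabilityMeasure (batchLaw mode n m)) :
    UnbiasedBatch (uniformOn (Set.univ : Set (Fin n))) (batchLaw mode n m) := by
  cases mode with
  | withoutReplacement => exact unbiasedBatch_withoutReplacement h
  | withReplacement =>
    have : Nonempty (Fin n) := ⟨⟨0, hn⟩⟩
    have : IsProbabilityMeasure (uniformOn (Set.univ : Set (Fin n))) :=
      isProbabilityMeasure_uniformOn Set.finite_univ Set.univ_nonempty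
    rw [batchLaw, ← Set.pi_univ Set.univ, uniformOn_pi]
    exact unbiasedBatch_pi _ m

end Uniform

/-! ### Measurability of the algorithm -/

section Measurability

variable {d p : ℕ}

/-- The components of a state. -/
def State.toProd (s : State d p) :
    Vec d × Vec d × Vec d × Vec p × (Vec d →L[ℝ] Vec p) × Vec p :=
  (s.x, s.y, s.z, s.gEst, s.jacEst, s.gradEst)

/-- The pulled-back structure makes the field projections measurable, and makes a map into states
measurable as soon as its components are. -/
instance : MeasurableSpace (State d p) := MeasurableSpace.comap State.toProd inferInstance

lemma State.measurable_toProd : Measurable (State.toProd (d := d) (p := p)) :=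
  comap_measurable _

@[fun_prop]
lemma State.measurable_x : Measurable (State.x (d := d) (p := p)) :=
  measurable_fst.comp State.measurable_toProd

@[fun_prop]
lemma State.measurable_z : Measurable (State.z (d := d) (p := p)) :=
  (measurable_fst.comp (measurable_snd.comp measurable_snd)).comp State.measurable_toProd

@[fun_prop]
lemma State.measurable_gEst : Measurable (State.gEst (d := d) (p := p)) :=
  (measurable_fst.comp (measurable_snd.comp (measurable_snd.comp measurable_snd))).comp
    State.measurable_toProd

@[fun_prop]
lemma State.measurable_jacEst : Measurable (State.jacEst (d := d) (p := p)) :=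
  (measurable_fst.comp (measurable_snd.comp (measurable_snd.comp
    (measurable_snd.comp measurable_snd)))).comp State.measurable_toProd

@[fun_prop]
lemma State.measurable_gradEst : Measurable (State.gradEst (d := d) (p := p)) :=
  (measurable_snd.comp (measurable_snd.comp (measurable_snd.comp
    (measurable_snd.comp measurable_snd)))).comp State.measurable_toProd

lemma State.measurable_mk {A : Type*} [MeasurableSpace A] {x y z : A → Vec d} {v w : A → Vec p}
    {M : A → Vec d →L[ℝ] Vec p} (hx : Measurable x) (hy : Measurable y) (hz : Measurable z)
    (hv : Measurable v) (hM : Measurable M) (hw : Measurable w) :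
    Measurable fun a => (⟨x a, y a, z a, v a, M a, w a⟩ : State d p) :=
  measurable_comap_iff.mpr
    (hx.prodMk (hy.prodMk (hz.prodMk (hv.prodMk (hM.prodMk hw)))))

lemma measurable_batchMean {A V : Type*} [MeasurableSpace A] [NormedAddCommGroup V]
    [NormedSpace ℝ V] [MeasurableSpace V] [BorelSpace V] [SecondCountableTopology V] {m : ℕ}
    {v : A → Fin m → V} (hv : ∀ i, Measurable fun a => v a i) :
    Measurable fun a => batchMean (v a) :=
  (Finset.measurable_sum _ fun i _ => hv i).const_smul _

lemma norm_batchMean_le {V : Type*} [NormedAddCommGroup V] [NormedSpace ℝ V] {m : ℕ}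
    {v : Fin m → V} {b : ℝ} (hb : 0 ≤ b) (hv : ∀ i, ‖v i‖ ≤ b) : ‖batchMean v‖ ≤ b := by
  rw [batchMean, norm_smul, Real.norm_of_nonneg (by positivity)]
  have h1 : ‖∑ i, v i‖ ≤ m * b := by
    refine (norm_sum_le _ _).trans ((Finset.sum_le_sum fun i _ => hv i).trans ?_)
    simp
  rcases Nat.eq_zero_or_pos m with hm | hm
  · subst hm; simpa using hb
  · calc (m : ℝ)⁻¹ * ‖∑ i, v i‖ ≤ (m : ℝ)⁻¹ * (m * b) := by gcongr
      _ = b := by field_simp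

lemma entries_batchMean {m : ℕ} (v : Fin m → Vec d →L[ℝ] Vec p) :
    entries (batchMean v) = batchMean fun i => entries (v i) := by
  simp [batchMean]

/-- The estimate of the gradient of the composition. -/
def State.compGrad (s : State d p) : Vec d := ContinuousLinearMap.adjoint s.jacEst s.gradEst

lemma measurable_compGrad : Measurable (State.compGrad (d := d) (p := p)) := by
  have h1 : Continuous fun M : Vec d →L[ℝ] Vec p => ContinuousLinearMap.adjoint M :=
    LinearIsometryEquiv.continuous _
  have h2 : Measurable fun q : (Vec d →L[ℝ] Vec p) × Vec p =>
      ContinuousLinearMap.adjoint q.1 q.2 :=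
    ((h1.comp (continuous_fst (Y := Vec p))).clm_apply continuous_snd).measurable
  have h3 : Measurable fun s : State d p => (s.jacEst, s.gradEst) :=
    State.measurable_jacEst.prodMk State.measurable_gradEst
  have h4 : Measurable ((fun q : (Vec d →L[ℝ] Vec p) × Vec p =>
      ContinuousLinearMap.adjoint q.1 q.2) ∘ fun s : State d p => (s.jacEst, s.gradEst)) :=
    h2.comp h3
  exact h4

lemma measurable_proxStep {par : Params} {r : Vec d → ℝ} {t : ℕ}
    (hr : ConvexOn ℝ Set.univ r) (hlam : 0 < par.lam t) :
    Measurable (proxStep (p := p) par r t) := by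
  have h1 : Measurable fun s : State d p => par.lam t • s.compGrad :=
    measurable_compGrad.const_smul (par.lam t)
  exact (continuous_prox hr hlam).measurable.comp (State.measurable_x.sub h1)

lemma measurable_theta {par : Params} {r : Vec d → ℝ} {t : ℕ}
    (hr : ConvexOn ℝ Set.univ r) (hlam : 0 < par.lam t) :
    Measurable (theta (p := p) par r t) := by
  have h2 : Measurable fun s : State d p => ‖proxStep par r t s - s.x‖ :=
    ((measurable_proxStep hr hlam).sub State.measurable_x).norm
  exact (h2.const_div _).min measurable_const

lemma measurable_nextX {par : Params} {r : Vec d → ℝ} {t : ℕ} (hr : ConvexOn ℝ Set.univ r)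
    (hlam : 0 < par.lam t) : Measurable (nextX (p := p) par r t) := by
  have h1 := measurable_proxStep (p := p) hr hlam
  have h2 := measurable_theta (p := p) hr hlam
  exact ((measurable_const.sub h2).smul State.measurable_x).add (h2.smul h1)

lemma measurable_nextY {par : Params} {r : Vec d → ℝ} {t : ℕ} (hr : ConvexOn ℝ Set.univ r)
    (hlam : 0 < par.lam t) : Measurable (nextY (p := p) par r t) := by
  have h : Measurable fun s : State d p => nextX par r t s - s.x :=
    (measurable_nextX hr hlam).sub State.measurable_x
  exact State.measurable_z.add (h.const_smul (par.β t / par.lam t))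

variable {I J : Type*} [MeasurableSpace I] [MeasurableSpace J]
  {g : I → Vec d → Vec p} {f : J → Vec p → ℝ} {lf lg Lf Lg : ℝ}

lemma measurable_estimate {par : Params} {t m m' k : ℕ} (hg : SmoothMap g lg Lg)
    (hgm : ∀ x, Measurable fun ξ => g ξ x) (hf : SmoothLoss f lf Lf)
    (hfm : ∀ y, Measurable fun η => f η y) {A : Type*} [MeasurableSpace A]
    {S : A → Batch I J m m' k} {x y : A → Vec d} {prev : A → State d p} (hS : Measurable S)
    (hx : Measurable x) (hy : Measurable y) (hprev : Measurable prev) :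
    Measurable fun a => estimate par g f t (S a) (x a) (y a) (prev a) := by
  have hz : Measurable fun a => (1 - par.α (t + 1)) • y a + par.α (t + 1) • x a :=
    (hy.const_smul (1 - par.α (t + 1))).add (hx.const_smul (par.α (t + 1)))
  have hS1 : ∀ i, Measurable fun a => (S a).1 i := fun i => (measurable_pi_apply i).comp hS.fst
  have hS2 : ∀ i, Measurable fun a => (S a).2.1 i := fun i =>
    (measurable_pi_apply i).comp hS.snd.fst
  have hS3 : ∀ i, Measurable fun a => (S a).2.2 i := fun i =>
    (measurable_pi_apply i).comp hS.snd.snd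
  have hG := measurable_uncurry_map hg hgm
  have hG' := measurable_uncurry_fderiv hg hgm
  have hF := measurable_uncurry_gradient hf hfm
  have hpz : Measurable fun a => (prev a).z := State.measurable_z.comp hprev
  have hpg : Measurable fun a => (prev a).gEst := State.measurable_gEst.comp hprev
  have hpj : Measurable fun a => (prev a).jacEst := State.measurable_jacEst.comp hprev
  have hpf : Measurable fun a => (prev a).gradEst := State.measurable_gradEst.comp hprev
  by_cases ht : t % par.τ = 0
  · have hgE : Measurable fun a => batchMean fun i => g ((S a).1 i)
        ((1 - par.α (t + 1)) • y a + par.α (t + 1) • x a) :=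
      measurable_batchMean fun i => hG.comp ((hS1 i).prodMk hz)
    have hjE : Measurable fun a => batchMean fun i => fderiv ℝ (g ((S a).2.1 i))
        ((1 - par.α (t + 1)) • y a + par.α (t + 1) • x a) :=
      measurable_batchMean fun i => hG'.comp ((hS2 i).prodMk hz)
    have hfE : Measurable fun a => batchMean fun i => gradient (f ((S a).2.2 i))
        (batchMean fun i => g ((S a).1 i)
          ((1 - par.α (t + 1)) • y a + par.α (t + 1) • x a)) :=
      measurable_batchMean fun i => hF.comp ((hS3 i).prodMk hgE)
    simp only [estimate, ht, if_true]
    exact State.measurable_mk hx hy hz hgE hjE hfE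
  · have hgE : Measurable fun a => (prev a).gEst + batchMean fun i => g ((S a).1 i)
        ((1 - par.α (t + 1)) • y a + par.α (t + 1) • x a) - g ((S a).1 i) (prev a).z :=
      hpg.add (measurable_batchMean fun i =>
        (hG.comp ((hS1 i).prodMk hz)).sub (hG.comp ((hS1 i).prodMk hpz)))
    have hjE : Measurable fun a => (prev a).jacEst + batchMean fun i =>
        fderiv ℝ (g ((S a).2.1 i)) ((1 - par.α (t + 1)) • y a + par.α (t + 1) • x a) -
          fderiv ℝ (g ((S a).2.1 i)) (prev a).z :=
      hpj.add (measurable_batchMean fun i =>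
        (hG'.comp ((hS2 i).prodMk hz)).sub (hG'.comp ((hS2 i).prodMk hpz)))
    have hfE : Measurable fun a => (prev a).gradEst + batchMean fun i =>
        gradient (f ((S a).2.2 i)) ((prev a).gEst + batchMean fun i => g ((S a).1 i)
          ((1 - par.α (t + 1)) • y a + par.α (t + 1) • x a) - g ((S a).1 i) (prev a).z) -
            gradient (f ((S a).2.2 i)) (prev a).gEst :=
      hpf.add (measurable_batchMean fun i =>
        (hF.comp ((hS3 i).prodMk hgE)).sub (hF.comp ((hS3 i).prodMk hpg)))
    simp only [estimate, ht, if_false]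
    exact State.measurable_mk hx hy hz hgE hjE hfE

/-! ### The run as a function of past data and fresh samples -/

/-- The data that iteration `t` receives from the earlier iterations: `x_t`, `y_t`, and the
previous state. -/
def runInput {I J : Type*} {a a' b : ℕ → ℕ} (par : Params) (g : I → Vec d → Vec p)
    (f : J → Vec p → ℝ) (r : Vec d → ℝ) (x₀ : Vec d)
    (S : (t : ℕ) → Batch I J (a t) (a' t) (b t)) : ℕ → Vec d × Vec d × State d p
  | 0 => (x₀, x₀, ⟨x₀, x₀, x₀, 0, 0, 0⟩)
  | t + 1 => (nextX par r t (run par g f r x₀ S t), nextY par r t (run par g f r x₀ S t),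
      run par g f r x₀ S t)

/-- Separates the fresh batch `S t` from everything decided earlier, which is the form needed for
conditioning on the past. -/
lemma run_eq_estimate {I J : Type*} {a a' b : ℕ → ℕ} (par : Params) (g : I → Vec d → Vec p)
    (f : J → Vec p → ℝ) (r : Vec d → ℝ) (x₀ : Vec d)
    (S : (t : ℕ) → Batch I J (a t) (a' t) (b t)) (t : ℕ) :
    run par g f r x₀ S t = estimate par g f t (S t) (runInput par g f r x₀ S t).1
      (runInput par g f r x₀ S t).2.1 (runInput par g f r x₀ S t).2.2 := by
  cases t <;> rfl

section Run

variable {a a' b : ℕ → ℕ} {par : Params} {r : Vec d → ℝ}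

/-- The measurable space `A` is arbitrary, so that measurability can also be asserted for σ-algebras
generated by the batches. -/
lemma measurable_run (hg : SmoothMap g lg Lg) (hgm : ∀ x, Measurable fun ξ => g ξ x)
    (hf : SmoothLoss f lf Lf) (hfm : ∀ y, Measurable fun η => f η y)
    (hr : ConvexOn ℝ Set.univ r) (x₀ : Vec d) {A : Type*} [MeasurableSpace A]
    {S : (t : ℕ) → A → Batch I J (a t) (a' t) (b t)} {t : ℕ}
    (hlam : ∀ s < t, 0 < par.lam s) (hS : ∀ s ≤ t, Measurable (S s)) :
    Measurable fun ω => run par g f r x₀ (fun s => S s ω) t := by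
  induction t with
  | zero =>
    exact measurable_estimate (x := fun _ => x₀) (y := fun _ => x₀)
      (prev := fun _ => ⟨x₀, x₀, x₀, 0, 0, 0⟩) hg hgm hf hfm (hS 0 le_rfl) measurable_const
      measurable_const measurable_const
  | succ t ih =>
    have ih := ih (fun s hs => hlam s (by omega)) fun s hs => hS s (by omega)
    have hl := hlam t (by omega)
    exact measurable_estimate
      (x := fun ω => nextX par r t (run par g f r x₀ (fun s => S s ω) t))
      (y := fun ω => nextY par r t (run par g f r x₀ (fun s => S s ω) t))
      (prev := fun ω => run par g f r x₀ (fun s => S s ω) t) hg hgm hf hfm (hS (t + 1) le_rfl)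
      ((measurable_nextX hr hl).comp ih) ((measurable_nextY hr hl).comp ih) ih

lemma measurable_runInput (hg : SmoothMap g lg Lg) (hgm : ∀ x, Measurable fun ξ => g ξ x)
    (hf : SmoothLoss f lf Lf) (hfm : ∀ y, Measurable fun η => f η y)
    (hr : ConvexOn ℝ Set.univ r) (x₀ : Vec d) {A : Type*} [MeasurableSpace A]
    {S : (t : ℕ) → A → Batch I J (a t) (a' t) (b t)} {t : ℕ}
    (hlam : ∀ s < t, 0 < par.lam s) (hS : ∀ s < t, Measurable (S s)) :
    Measurable fun ω => runInput par g f r x₀ (fun s => S s ω) t := by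
  cases t with
  | zero => exact measurable_const
  | succ t =>
    have h := measurable_run (par := par) (t := t) hg hgm hf hfm hr x₀
      (fun s hs => hlam s (by omega)) fun s hs => hS s (by omega)
    have hl := hlam t (by omega)
    exact ((measurable_nextX hr hl).comp h).prodMk (((measurable_nextY hr hl).comp h).prodMk h)

variable {Ω : Type*} [MeasurableSpace Ω] {P : Measure Ω} {T : ℕ}
  {S : (t : ℕ) → Ω → Batch I J (a t) (a' t) (b t)} {ζ : Ω → Fin T}

/-- The input of iteration `t` is measurable with respect to the σ-algebra of the batches with index
below `t`. Families of independent σ-algebras over disjoint index sets generate independent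
σ-algebras. -/
lemma IndependentSamples.indepFun_runInput (hS : IndependentSamples P T S ζ)
    (hg : SmoothMap g lg Lg) (hgm : ∀ x, Measurable fun ξ => g ξ x)
    (hf : SmoothLoss f lf Lf) (hfm : ∀ y, Measurable fun η => f η y)
    (hr : ConvexOn ℝ Set.univ r) (x₀ : Vec d) {t : ℕ} (ht : t < T)
    (hlam : ∀ s < t, 0 < par.lam s) :
    IndepFun (fun ω => runInput par g f r x₀ (fun s => S s ω) t) (S t) P := by
  rw [IndepFun_iff_Indep]
  let m : Fin T → MeasurableSpace Ω := fun s => MeasurableSpace.comap (S s) inferInstance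
  have hle : ∀ s, m s ≤ ‹MeasurableSpace Ω› := fun s => (hS.meas s s.2).comap_le
  have hdis : Disjoint {s : Fin T | (s : ℕ) < t} {⟨t, ht⟩} := by
    rw [Set.disjoint_singleton_right]; simp
  have hind := indep_iSup_of_disjoint hle hS.indep hdis
  refine indep_of_indep_of_le_left (indep_of_indep_of_le_right hind ?_) ?_
  · exact le_iSup₂_of_le (f := fun i _ => m i) ⟨t, ht⟩ rfl le_rfl
  -- Measurability of the input is invoked with the σ-algebra of the past in place of the one on
  -- `Ω`.
  · have hmeas : Measurable[⨆ i ∈ {s : Fin T | (s : ℕ) < t}, m i] fun ω =>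
        runInput par g f r x₀ (fun s => S s ω) t := by
      refine @measurable_runInput _ _ _ _ _ _ _ _ _ _ _ _ _ _ _ _ _ hg hgm hf hfm hr x₀ Ω
        (⨆ i ∈ {s : Fin T | (s : ℕ) < t}, m i) S t hlam fun s hs => ?_
      refine Measurable.of_comap_le ?_
      exact le_iSup₂_of_le (f := fun i _ => m i) ⟨s, hs.trans ht⟩ hs le_rfl
    exact hmeas.comap_le

end Run

/-- Integration of one iteration over the samples that it draws. -/
lemma lintegral_le_of_indepFun {Ω W B : Type*} [MeasurableSpace Ω] [MeasurableSpace W]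
    [MeasurableSpace B] {P : Measure Ω} [IsProbabilityMeasure P] {w : Ω → W} {s : Ω → B}
    (hw : Measurable w) (hs : Measurable s) (hind : IndepFun w s P) {h : W → B → ENNReal}
    (hh : Measurable fun q : W × B => h q.1 q.2) {k : W → ENNReal}
    (hk : ∀ w, ∫⁻ b, h w b ∂(P.map s) ≤ k w) (hkm : Measurable k) :
    ∫⁻ ω, h (w ω) (s ω) ∂P ≤ ∫⁻ ω, k (w ω) ∂P := by
  have h1 : P.map (fun ω => (w ω, s ω)) = (P.map w).prod (P.map s) :=
    (indepFun_iff_map_prod_eq_prod_map_map hw.aemeasurable hs.aemeasurable).mp hind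
  have : IsProbabilityMeasure (P.map s) := Measure.isProbabilityMeasure_map hs.aemeasurable
  calc ∫⁻ ω, h (w ω) (s ω) ∂P = ∫⁻ q, h q.1 q.2 ∂(P.map fun ω => (w ω, s ω)) :=
        (lintegral_map hh (hw.prodMk hs)).symm
    _ = ∫⁻ w, ∫⁻ b, h w b ∂(P.map s) ∂(P.map w) := by
        rw [h1, lintegral_prod _ hh.aemeasurable]
    _ ≤ ∫⁻ w, k w ∂(P.map w) := lintegral_mono hk
    _ = ∫⁻ ω, k (w ω) ∂P := lintegral_map hkm hw

end Measurability

/-! ### Mean square errors of the estimates -/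

section Errors

variable {d p : ℕ}

/-- The squared error of the estimate of the inner map. -/
def State.valueErr (G : Vec d → Vec p) (s : State d p) : ℝ := ‖s.gEst - G s.z‖ ^ 2

/-- The squared error of the estimate of the Jacobian of the inner map. -/
def State.jacErr (G : Vec d → Vec p) (s : State d p) : ℝ :=
  frobNorm (s.jacEst - fderiv ℝ G s.z) ^ 2

/-- The squared error of the estimate of the gradient of the outer function. -/
def State.gradErr (H : Vec p → ℝ) (s : State d p) : ℝ := ‖s.gradEst - gradient H s.gEst‖ ^ 2

variable {I J : Type*} [MeasurableSpace I] [MeasurableSpace J]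

/-- A composition of two expectations of smooth maps that are measurable in the sample. -/
structure StochasticComposition (μ : Measure I) (ν : Measure J) (g : I → Vec d → Vec p)
    (f : J → Vec p → ℝ) (lf lg Lf Lg : ℝ) : Prop where
  loss : SmoothLoss f lf Lf
  map : SmoothMap g lg Lg
  meas_g : ∀ x, Measurable fun ξ => g ξ x
  meas_f : ∀ y, Measurable fun η => f η y
  int_g : ∀ x, Integrable (fun ξ => g ξ x) μ
  int_f : ∀ y, Integrable (fun η => f η y) ν

variable {μ : Measure I} {ν : Measure J} {g : I → Vec d → Vec p} {f : J → Vec p → ℝ}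
  {lf lg Lf Lg : ℝ}

lemma StochasticComposition.smoothMap [IsProbabilityMeasure μ]
    (hM : StochasticComposition μ ν g f lf lg Lf Lg) :
    SmoothMap (fun _ : Unit => meanMap μ g) lg Lg :=
  hM.map.meanMap hM.meas_g hM.int_g

lemma StochasticComposition.smoothLoss [IsProbabilityMeasure ν]
    (hM : StochasticComposition μ ν g f lf lg Lf Lg) :
    SmoothLoss (fun _ : Unit => meanLoss ν f) lf Lf :=
  hM.loss.meanLoss hM.meas_f hM.int_f

lemma StochasticComposition.measurable_valueErr [IsProbabilityMeasure μ]
    (hM : StochasticComposition μ ν g f lf lg Lf Lg) :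
    Measurable (State.valueErr (meanMap μ g)) := by
  have h1 : Measurable fun s : State d p => meanMap μ g s.z :=
    (hM.smoothMap.diff ()).continuous.measurable.comp State.measurable_z
  exact (State.measurable_gEst.sub h1).norm.pow_const 2

lemma State.measurable_jacErr (G : Vec d → Vec p) : Measurable (State.jacErr G) := by
  have h1 : Measurable fun s : State d p => fderiv ℝ G s.z :=
    (measurable_fderiv ℝ G).comp State.measurable_z
  have h2 : Measurable fun s : State d p => entries (s.jacEst - fderiv ℝ G s.z) :=
    continuous_entries.measurable.comp (State.measurable_jacEst.sub h1)
  have h3 : State.jacErr G =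
      fun s : State d p => ‖entries (s.jacEst - fderiv ℝ G s.z)‖ ^ 2 := by
    funext s; rw [norm_entries]; rfl
  rw [h3]
  exact h2.norm.pow_const 2

lemma StochasticComposition.continuous_gradient [IsProbabilityMeasure ν]
    (hM : StochasticComposition μ ν g f lf lg Lf Lg) :
    Continuous (gradient (meanLoss ν f)) :=
  (LipschitzWith.of_dist_le_mul (K := Lf.toNNReal) fun x y => by
    rw [dist_eq_norm, dist_eq_norm, Real.coe_toNNReal _ hM.loss.nonneg.2]
    exact hM.smoothLoss.grad_lip () x y).continuous

lemma StochasticComposition.measurable_gradErr [IsProbabilityMeasure ν]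
    (hM : StochasticComposition μ ν g f lf lg Lf Lg) :
    Measurable (State.gradErr (d := d) (meanLoss ν f)) := by
  have h1 : Measurable fun s : State d p => gradient (meanLoss ν f) s.gEst :=
    hM.continuous_gradient.measurable.comp State.measurable_gEst
  exact (State.measurable_gradEst.sub h1).norm.pow_const 2

lemma lintegral_prod_prod {A B D : Type*} [MeasurableSpace A] [MeasurableSpace B]
    [MeasurableSpace D] (ρ₁ : Measure A) (ρ₂ : Measure B) (ρ₃ : Measure D) [SFinite ρ₂]
    [SFinite ρ₃] {h : A × B × D → ENNReal} (hh : Measurable h) :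
    ∫⁻ s, h s ∂(ρ₁.prod (ρ₂.prod ρ₃)) = ∫⁻ s₁, ∫⁻ s₂, ∫⁻ s₃, h (s₁, s₂, s₃) ∂ρ₃ ∂ρ₂ ∂ρ₁ := by
  rw [lintegral_prod _ hh.aemeasurable]
  refine lintegral_congr fun s₁ => ?_
  rw [lintegral_prod]
  exact (hh.comp measurable_prodMk_left).aemeasurable

lemma lintegral_le_of_forall_le {A : Type*} [MeasurableSpace A] {ρ : Measure A}
    [IsProbabilityMeasure ρ] {h : A → ENNReal} {k : ENNReal} (hk : ∀ a, h a ≤ k) :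
    ∫⁻ a, h a ∂ρ ≤ k := by
  refine (lintegral_mono hk).trans ?_
  simp

variable {m m' k : ℕ}
  {ρ₁ : Measure (Fin m → I)} {ρ₂ : Measure (Fin m' → I)} {ρ₃ : Measure (Fin k → J)}
  {par : Params} {t : ℕ}

lemma StochasticComposition.measurable_err_estimate
    (hM : StochasticComposition μ ν g f lf lg Lf Lg) {err : State d p → ℝ}
    (herr : Measurable err) (x y : Vec d) (prev : State d p) :
    Measurable fun S : Batch I J m m' k =>
      ENNReal.ofReal (err (estimate par g f t S x y prev)) :=
  (herr.comp (measurable_estimate (S := fun S : Batch I J m m' k => S) (x := fun _ => x)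
    (y := fun _ => y) (prev := fun _ => prev) hM.map hM.meas_g hM.loss hM.meas_f measurable_id
    measurable_const measurable_const measurable_const)).ennreal_ofReal

/-! ### One iteration without reset -/

section Step

variable (hM : StochasticComposition μ ν g f lf lg Lf Lg) (h₁ : UnbiasedBatch μ ρ₁)
  (h₂ : UnbiasedBatch μ ρ₂) (h₃ : UnbiasedBatch ν ρ₃) (ht : t % par.τ ≠ 0) (x y : Vec d)
  (prev : State d p)

include hM h₁ h₂ h₃ ht

/-- With the past fixed, the new error is the old one plus a batch mean minus its expectation. The
averaged increments are bounded by `lg` times the move of `z`. -/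
lemma StochasticComposition.lintegral_valueErr_step_le [IsProbabilityMeasure μ]
    (hm : 0 < m) :
    ∫⁻ S, ENNReal.ofReal ((estimate par g f t S x y prev).valueErr (meanMap μ g))
      ∂(ρ₁.prod (ρ₂.prod ρ₃)) ≤
    ENNReal.ofReal (prev.valueErr (meanMap μ g) +
      4 * (lg * ‖(1 - par.α (t + 1)) • y + par.α (t + 1) • x - prev.z‖) ^ 2 / m) := by
  have := h₂.prob
  have := h₃.prob
  rw [lintegral_prod_prod _ _ _ (hM.measurable_err_estimate hM.measurable_valueErr x y prev)]
  set z := (1 - par.α (t + 1)) • y + par.α (t + 1) • x with hz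
  have hb := h₁.lintegral_correction_le hm (φ := fun ξ => g ξ z - g ξ prev.z)
    ((hM.meas_g z).sub (hM.meas_g prev.z)).aestronglyMeasurable
    (fun ξ => hM.map.lip ξ z prev.z) (prev.gEst - meanMap μ g prev.z)
  have hmean : ∫ ξ, (g ξ z - g ξ prev.z) ∂μ = meanMap μ g z - meanMap μ g prev.z :=
    integral_sub (hM.int_g z) (hM.int_g prev.z)
  refine (lintegral_mono fun s₁ => ?_).trans hb
  refine lintegral_le_of_forall_le fun s₂ => lintegral_le_of_forall_le fun s₃ => ?_
  refine le_of_eq ?_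
  simp only [estimate, ht, if_false, State.valueErr, hmean, ← hz]
  congr 3
  abel

lemma StochasticComposition.lintegral_jacErr_step_le [IsProbabilityMeasure μ]
    (hm : 0 < m') :
    ∫⁻ S, ENNReal.ofReal ((estimate par g f t S x y prev).jacErr (meanMap μ g))
      ∂(ρ₁.prod (ρ₂.prod ρ₃)) ≤
    ENNReal.ofReal (prev.jacErr (meanMap μ g) +
      4 * (Lg * ‖(1 - par.α (t + 1)) • y + par.α (t + 1) • x - prev.z‖) ^ 2 / m') := by
  have := h₁.prob
  have := h₃.prob
  have := h₂.prob
  rw [lintegral_prod_prod _ _ _ (hM.measurable_err_estimate (State.measurable_jacErr _) x y prev)]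
  set z := (1 - par.α (t + 1)) • y + par.α (t + 1) • x with hz
  have hint := fun x => integrable_fderiv_family (μ := μ) hM.map.nonneg.1 hM.map.diff hM.map.lip
    hM.meas_g x
  have hb := h₂.lintegral_correction_le hm
    (φ := fun ξ => entries (fderiv ℝ (g ξ) z - fderiv ℝ (g ξ) prev.z))
    (integrable_entries ((hint z).sub (hint prev.z))).aestronglyMeasurable
    (fun ξ => by rw [norm_entries]; exact hM.map.jac_lip ξ z prev.z)
    (entries (prev.jacEst - fderiv ℝ (meanMap μ g) prev.z))
  have hmean : ∫ ξ, entries (fderiv ℝ (g ξ) z - fderiv ℝ (g ξ) prev.z) ∂μ =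
      entries (fderiv ℝ (meanMap μ g) z - fderiv ℝ (meanMap μ g) prev.z) := by
    rw [← entries_integral (M := fun ξ => fderiv ℝ (g ξ) z - fderiv ℝ (g ξ) prev.z)
      ((hint z).sub (hint prev.z)), integral_sub (hint z) (hint prev.z), fderiv_meanMap hM.map hM.meas_g hM.int_g,
      fderiv_meanMap hM.map hM.meas_g hM.int_g]
  refine lintegral_le_of_forall_le fun s₁ => ?_
  simp only [State.jacErr, ← norm_entries] at hb ⊢
  refine (lintegral_mono fun s₂ => ?_).trans hb
  refine lintegral_le_of_forall_le fun s₃ => ?_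
  refine le_of_eq ?_
  rw [hmean, ← entries_batchMean, ← map_sub, ← map_add]
  simp only [estimate, ht, if_false, ← hz]
  congr 4
  abel

/-- The point where the outer gradient is evaluated depends on the first batch through `c`. That
batch is held fixed while the third is integrated; `‖c‖ ≤ lg * ‖z - prev.z‖` holds for every
outcome, so the resulting bound is uniform. -/
lemma StochasticComposition.lintegral_gradErr_step_le [IsProbabilityMeasure ν]
    (hk : 0 < k) :
    ∫⁻ S, ENNReal.ofReal ((estimate par g f t S x y prev).gradErr (meanLoss ν f))
      ∂(ρ₁.prod (ρ₂.prod ρ₃)) ≤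
    ENNReal.ofReal (prev.gradErr (meanLoss ν f) +
      4 * (Lf * lg * ‖(1 - par.α (t + 1)) • y + par.α (t + 1) • x - prev.z‖) ^ 2 / k) := by
  have := h₁.prob
  have := h₂.prob
  have := h₃.prob
  rw [lintegral_prod_prod _ _ _ (hM.measurable_err_estimate hM.measurable_gradErr x y prev)]
  set z := (1 - par.α (t + 1)) • y + par.α (t + 1) • x with hz
  refine lintegral_le_of_forall_le fun s₁ => lintegral_le_of_forall_le fun s₂ => ?_
  set c := batchMean fun i => g (s₁ i) z - g (s₁ i) prev.z with hc
  have hlg := hM.map.nonneg.1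
  have hLf := hM.loss.nonneg.2
  have hcn : ‖c‖ ≤ lg * ‖z - prev.z‖ :=
    norm_batchMean_le (by positivity) fun i => hM.map.lip (s₁ i) z prev.z
  have hint := fun y => integrable_gradient_family (ν := ν) hM.loss hM.meas_f y
  have hb := h₃.lintegral_correction_le hk
    (φ := fun η => gradient (f η) (prev.gEst + c) - gradient (f η) prev.gEst)
    ((hint _).sub (hint _)).aestronglyMeasurable (b := Lf * lg * ‖z - prev.z‖)
    (fun η => (hM.loss.grad_lip η _ _).trans (by
      rw [add_sub_cancel_left, mul_assoc]; gcongr))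
    (prev.gradEst - gradient (meanLoss ν f) prev.gEst)
  have hmean : ∫ η, (gradient (f η) (prev.gEst + c) - gradient (f η) prev.gEst) ∂ν =
      gradient (meanLoss ν f) (prev.gEst + c) - gradient (meanLoss ν f) prev.gEst := by
    rw [integral_sub (hint _) (hint _), gradient_meanLoss hM.loss hM.meas_f hM.int_f,
      gradient_meanLoss hM.loss hM.meas_f hM.int_f]
  refine (lintegral_mono fun s₃ => ?_).trans hb
  refine le_of_eq ?_
  simp only [estimate, ht, if_false, State.gradErr, hmean, ← hz, ← hc]
  congr 3
  abel

end Step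

/-! ### One iteration with reset to independent samples -/

section Reset

variable (hM : StochasticComposition μ ν g f lf lg Lf Lg) {σg σg' σf' : ℝ}
  (hV : BoundedVariance μ ν g f σg σg' σf') (h₁ : UnbiasedBatch μ ρ₁)
  (h₂ : UnbiasedBatch μ ρ₂) (h₃ : UnbiasedBatch ν ρ₃) (ht : t % par.τ = 0) (x y : Vec d)
  (prev : State d p)

include hM hV h₁ h₂ h₃ ht

lemma StochasticComposition.lintegral_valueErr_reset_le [IsProbabilityMeasure μ]
    (hm : 0 < m) :
    ∫⁻ S, ENNReal.ofReal ((estimate par g f t S x y prev).valueErr (meanMap μ g))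
      ∂(ρ₁.prod (ρ₂.prod ρ₃)) ≤ ENNReal.ofReal (σg ^ 2 / m) := by
  have := h₂.prob
  have := h₃.prob
  rw [lintegral_prod_prod _ _ _ (hM.measurable_err_estimate hM.measurable_valueErr x y prev)]
  set z := (1 - par.α (t + 1)) • y + par.α (t + 1) • x with hz
  -- Square integrability comes from the variance assumption: the deviation is square integrable and
  -- the mean is constant.
  have hmem : MemLp (fun ξ => g ξ z) 2 μ := by
    have h0 : MemLp (fun ξ => g ξ z - meanMap μ g z) 2 μ :=
      (memLp_two_iff_integrable_sq_norm
        ((hM.meas_g z).sub_const _).aestronglyMeasurable).mpr (hV.var_g z).1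
    have h1 := h0.add (memLp_const (meanMap μ g z))
    refine h1.ae_eq (.of_forall fun ξ => ?_)
    simp
  have hb := h₁.lintegral_add_batchMean_sub_le hm hmem (hV.var_g z).2 0
  rw [norm_zero, zero_pow two_ne_zero, zero_add] at hb
  refine (lintegral_mono fun s₁ => ?_).trans hb
  refine lintegral_le_of_forall_le fun s₂ => lintegral_le_of_forall_le fun s₃ => ?_
  refine le_of_eq ?_
  simp only [estimate, ht, if_true, State.valueErr, ← hz, zero_add]
  rfl

lemma StochasticComposition.lintegral_jacErr_reset_le [IsProbabilityMeasure μ]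
    (hm : 0 < m') :
    ∫⁻ S, ENNReal.ofReal ((estimate par g f t S x y prev).jacErr (meanMap μ g))
      ∂(ρ₁.prod (ρ₂.prod ρ₃)) ≤ ENNReal.ofReal (σg' ^ 2 / m') := by
  have := h₁.prob
  have := h₂.prob
  have := h₃.prob
  rw [lintegral_prod_prod _ _ _ (hM.measurable_err_estimate (State.measurable_jacErr _) x y prev)]
  set z := (1 - par.α (t + 1)) • y + par.α (t + 1) • x with hz
  have hint := integrable_fderiv_family (μ := μ) hM.map.nonneg.1 hM.map.diff hM.map.lip
    hM.meas_g z
  have hmean : ∫ ξ, entries (fderiv ℝ (g ξ) z) ∂μ = entries (fderiv ℝ (meanMap μ g) z) := by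
    rw [← entries_integral hint, fderiv_meanMap hM.map hM.meas_g hM.int_g]
  have hmeas := (integrable_entries hint).aestronglyMeasurable
  have hvar := hV.var_jac z
  simp only [← norm_entries, map_sub] at hvar
  have hmem : MemLp (fun ξ => entries (fderiv ℝ (g ξ) z)) 2 μ := by
    have h0 : MemLp (fun ξ => entries (fderiv ℝ (g ξ) z) - entries (fderiv ℝ (meanMap μ g) z))
        2 μ :=
      (memLp_two_iff_integrable_sq_norm (hmeas.sub aestronglyMeasurable_const)).mpr hvar.1
    have h1 := h0.add (memLp_const (entries (fderiv ℝ (meanMap μ g) z)))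
    refine h1.ae_eq (.of_forall fun ξ => ?_)
    simp
  rw [← hmean] at hvar
  have hb := h₂.lintegral_add_batchMean_sub_le hm hmem hvar.2 0
  rw [norm_zero, zero_pow two_ne_zero, zero_add] at hb
  refine lintegral_le_of_forall_le fun s₁ => ?_
  refine (lintegral_mono fun s₂ => ?_).trans hb
  refine lintegral_le_of_forall_le fun s₃ => ?_
  refine le_of_eq ?_
  rw [hmean, ← entries_batchMean, ← map_sub, zero_add, norm_entries]
  simp only [estimate, ht, if_true, State.jacErr, ← hz]

/-- The variance bound holds at every point, hence also at the random point `c` once the first batch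
is fixed. -/
lemma StochasticComposition.lintegral_gradErr_reset_le [IsProbabilityMeasure ν]
    (hk : 0 < k) :
    ∫⁻ S, ENNReal.ofReal ((estimate par g f t S x y prev).gradErr (meanLoss ν f))
      ∂(ρ₁.prod (ρ₂.prod ρ₃)) ≤ ENNReal.ofReal (σf' ^ 2 / k) := by
  have := h₁.prob
  have := h₂.prob
  have := h₃.prob
  rw [lintegral_prod_prod _ _ _ (hM.measurable_err_estimate hM.measurable_gradErr x y prev)]
  set z := (1 - par.α (t + 1)) • y + par.α (t + 1) • x with hz
  refine lintegral_le_of_forall_le fun s₁ => lintegral_le_of_forall_le fun s₂ => ?_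
  set c := batchMean fun i => g (s₁ i) z with hc
  have hmean := gradient_meanLoss (ν := ν) hM.loss hM.meas_f hM.int_f c
  have hmem : MemLp (fun η => gradient (f η) c) 2 ν :=
    .of_bound (measurable_gradient_family hM.loss hM.meas_f c).aestronglyMeasurable lf
      (.of_forall fun η => norm_gradient_le hM.loss η c)
  have hvar := (hV.var_grad c).2
  rw [hmean] at hvar
  have hb := h₃.lintegral_add_batchMean_sub_le hk hmem hvar 0
  rw [norm_zero, zero_pow two_ne_zero, zero_add] at hb
  refine (lintegral_mono fun s₃ => ?_).trans hb
  refine le_of_eq ?_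
  simp only [estimate, ht, if_true, State.gradErr, ← hz, ← hc, hmean, zero_add]

end Reset

end Errors

/-! ### Mean square errors along the run -/

section Recursion

variable {d p : ℕ} {I J Ω : Type*} [MeasurableSpace I] [MeasurableSpace J] [MeasurableSpace Ω]
  {μ : Measure I} {ν : Measure J} {g : I → Vec d → Vec p} {f : J → Vec p → ℝ} {lf lg Lf Lg : ℝ}
  {P : Measure Ω} [IsProbabilityMeasure P] {T : ℕ} {a a' b : ℕ → ℕ}
  {S : (t : ℕ) → Ω → Batch I J (a t) (a' t) (b t)} {ζ : Ω → Fin T}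

lemma add_one_mod_of_ne_zero {t τ : ℕ} (h : (t + 1) % τ ≠ 0) : (t + 1) % τ = t % τ + 1 := by
  rcases Nat.eq_zero_or_pos τ with h0 | h0
  · subst h0; simp
  · have h1 : (t + 1) % τ = (t % τ + 1) % τ := (Nat.mod_add_mod t τ 1).symm
    have h2 := Nat.mod_lt t h0
    rcases Nat.lt_or_ge (t % τ + 1) τ with h3 | h3
    · rw [h1, Nat.mod_eq_of_lt h3]
    · have : t % τ + 1 = τ := by omega
      rw [h1, this, Nat.mod_self] at h
      exact absurd rfl h

/-- One recursion for all three errors, with `l` the Lipschitz constant of the estimated quantity.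
The bounds on one iteration are assumed uniformly in its input, so they may be applied with the
random input by integrating over the independent fresh batch first. -/
lemma StochasticComposition.lintegral_err_run_le
    (hM : StochasticComposition μ ν g f lf lg Lf Lg) (hS : IndependentSamples P T S ζ)
    {τ : ℕ} {ε β L c C l V : ℝ} {lam : ℕ → ℝ} {r : Vec d → ℝ} (hr : ConvexOn ℝ Set.univ r)
    (x₀ : Vec d) (hε : 0 ≤ ε) (hτ : 0 < τ) (hC : 0 ≤ C) (hl : 0 ≤ l) (hV : 0 ≤ V)
    (hstep : StepSizes c L T β lam) {err : State d p → ℝ} (herr : Measurable err)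
    (herr0 : ∀ s, 0 ≤ err s)
    (hreset : ∀ t < T, t % τ = 0 → ∀ x y prev,
      ∫⁻ s, ENNReal.ofReal (err (estimate (dimParams τ ε β lam) g f t s x y prev))
        ∂(P.map (S t)) ≤ ENNReal.ofReal V)
    (hone : ∀ t < T, t % τ ≠ 0 → ∀ x y prev,
      ∫⁻ s, ENNReal.ofReal (err (estimate (dimParams τ ε β lam) g f t s x y prev))
        ∂(P.map (S t)) ≤ ENNReal.ofReal (err prev +
          4 * (l * ‖(1 - alpha (t + 1)) • y + alpha (t + 1) • x - prev.z‖) ^ 2 * (C / τ)))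
    {t : ℕ} (ht : t < T) :
    ∫⁻ ω, ENNReal.ofReal (err (run (dimParams τ ε β lam) g f r x₀ (fun s => S s ω) t)) ∂P ≤
      ENNReal.ofReal (V + 36 * C * (l * β * ε) ^ 2) := by
  set par := dimParams τ ε β lam with hpar
  have hβ := hstep.pos
  have hlam : ∀ s < T, 0 < par.lam s := fun s hs => hβ.trans_le (hstep.lam_mem s hs).1
  have hest : ∀ t, Measurable fun q : (Vec d × Vec d × State d p) × Batch I J (a t) (a' t) (b t) =>
      ENNReal.ofReal (err (estimate par g f t q.2 q.1.1 q.1.2.1 q.1.2.2)) := fun t =>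
    (herr.comp (measurable_estimate (par := par) (t := t)
      (S := fun q : (Vec d × Vec d × State d p) × Batch I J (a t) (a' t) (b t) => q.2)
      (x := fun q => q.1.1) (y := fun q => q.1.2.1) (prev := fun q => q.1.2.2) hM.map hM.meas_g
      hM.loss hM.meas_f measurable_snd (measurable_fst.comp measurable_fst)
      (measurable_fst.comp (measurable_snd.comp measurable_fst))
      (measurable_snd.comp (measurable_snd.comp measurable_fst)))).ennreal_ofReal
  have hin : ∀ t < T, Measurable fun ω => runInput par g f r x₀ (fun s => S s ω) t :=
    fun t ht => measurable_runInput hM.map hM.meas_g hM.loss hM.meas_f hr x₀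
      (fun s hs => hlam s (hs.trans ht)) fun s hs => hS.meas s (hs.trans ht)
  have hind : ∀ t < T, IndepFun (fun ω => runInput par g f r x₀ (fun s => S s ω) t) (S t) P :=
    fun t ht => hS.indepFun_runInput hM.map hM.meas_g hM.loss hM.meas_f hr x₀ ht
      fun s hs => hlam s (hs.trans ht)
  -- The increase per iteration, from the deterministic move `3 * β * ε` of `z` and a batch of size
  -- at least `τ / C`; one full period costs `τ * D = 36 * C * (l * β * ε) ^ 2`.
  set D := 4 * (l * (3 * β * ε)) ^ 2 * (C / τ) with hD
  have hD0 : 0 ≤ D := by positivity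
  -- The residue `t % τ` counts the corrections since the last reset.
  have key : ∀ t < T,
      ∫⁻ ω, ENNReal.ofReal (err (run par g f r x₀ (fun s => S s ω) t)) ∂P ≤
        ENNReal.ofReal (V + (t % τ : ℕ) * D) := by
    have hres : ∀ t < T, t % τ = 0 →
        ∫⁻ ω, ENNReal.ofReal (err (run par g f r x₀ (fun s => S s ω) t)) ∂P ≤
          ENNReal.ofReal (V + (t % τ : ℕ) * D) := by
      intro t ht h0
      simp_rw [run_eq_estimate]
      refine (lintegral_le_of_indepFun (hin t ht) (hS.meas t ht) (hind t ht)
        (h := fun w s => ENNReal.ofReal (err (estimate par g f t s w.1 w.2.1 w.2.2)))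
        (k := fun _ => ENNReal.ofReal V) (hest t) (fun w => hreset t ht h0 _ _ _)
        measurable_const).trans ?_
      simp [h0]
    intro t
    induction t with
    | zero => exact fun ht => hres 0 ht (Nat.zero_mod τ)
    | succ t ih =>
      intro ht
      by_cases h0 : (t + 1) % τ = 0
      · exact hres _ ht h0
      have ih := ih (by omega)
      have hk : Measurable fun w : Vec d × Vec d × State d p =>
          ENNReal.ofReal (err w.2.2 + 4 * (l * ‖(1 - alpha (t + 1 + 1)) • w.2.1 +
            alpha (t + 1 + 1) • w.1 - w.2.2.z‖) ^ 2 * (C / τ)) := by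
        have h1 : Measurable fun w : Vec d × Vec d × State d p => w.2.2.z :=
          State.measurable_z.comp (measurable_snd.comp measurable_snd)
        have h2 : Measurable fun w : Vec d × Vec d × State d p => err w.2.2 :=
          herr.comp (measurable_snd.comp measurable_snd)
        fun_prop
      have h1 := lintegral_le_of_indepFun (hin (t + 1) ht) (hS.meas (t + 1) ht)
        (hind (t + 1) ht)
        (h := fun w s => ENNReal.ofReal (err (estimate par g f (t + 1) s w.1 w.2.1 w.2.2)))
        (hest (t + 1)) (fun w => hone (t + 1) ht h0 w.1 w.2.1 w.2.2) hk
      simp_rw [run_eq_estimate _ _ _ _ _ _ (t + 1)]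
      refine h1.trans ?_
      have h2 : ∀ ω, ENNReal.ofReal (err (runInput par g f r x₀ (fun s => S s ω) (t + 1)).2.2 +
          4 * (l * ‖(1 - alpha (t + 1 + 1)) • (runInput par g f r x₀ (fun s => S s ω) (t + 1)).2.1 +
            alpha (t + 1 + 1) • (runInput par g f r x₀ (fun s => S s ω) (t + 1)).1 -
            (runInput par g f r x₀ (fun s => S s ω) (t + 1)).2.2.z‖) ^ 2 * (C / τ)) ≤
          ENNReal.ofReal (err (run par g f r x₀ (fun s => S s ω) t)) + ENNReal.ofReal D := by
        intro ω
        have htr := isTrajectory_run par g f r x₀ (fun s => S s ω)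
        have h3 := htr.norm_z_succ_sub_le hε hβ hstep.lam_mem (show t < T by omega)
        rw [htr.z_eq (t + 1), htr.x_succ, htr.y_succ] at h3
        rw [← ENNReal.ofReal_add (herr0 _) hD0]
        refine ENNReal.ofReal_le_ofReal ?_
        refine add_le_add le_rfl ?_
        rw [hD]
        gcongr
        exact h3
      refine (lintegral_mono h2).trans ?_
      rw [lintegral_add_right _ measurable_const]
      simp only [lintegral_const, measure_univ, mul_one]
      refine (add_le_add_left ih _).trans ?_
      rw [← ENNReal.ofReal_add (by positivity) hD0, add_one_mod_of_ne_zero h0]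
      refine ENNReal.ofReal_le_ofReal (le_of_eq ?_)
      push_cast; ring
  refine (key t ht).trans (ENNReal.ofReal_le_ofReal ?_)
  have h1 : ((t % τ : ℕ) : ℝ) ≤ τ := by exact_mod_cast (Nat.mod_lt t hτ).le
  have hτ' : (0 : ℝ) < τ := by exact_mod_cast hτ
  have h2 : ((t % τ : ℕ) : ℝ) * D ≤ τ * D := by gcongr
  have h3 : (τ : ℝ) * D = 36 * C * (l * β * ε) ^ 2 := by rw [hD]; field_simp; ring
  linarith

end Recursion

/-! ### Convergence -/

/-- The expectation at a uniform random index that is independent of the process. -/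
lemma integral_uniform_index {Ω : Type*} [MeasurableSpace Ω] {P : Measure Ω}
    [IsProbabilityMeasure P] {T : ℕ} {ζ : Ω → Fin T} (hζ : Measurable ζ)
    (hlaw : P.map ζ = uniformOn Set.univ) {X : Fin T → Ω → ℝ} (hX : ∀ t, Integrable (X t) P)
    (hind : ∀ t, IndepFun ζ (X t) P) :
    Integrable (fun ω => X (ζ ω) ω) P ∧
      ∫ ω, X (ζ ω) ω ∂P = (T : ℝ)⁻¹ * ∑ t, ∫ ω, X t ω ∂P := by
  -- Splitting by the value of the index reduces the claim to products of independent variables,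
  -- with no joint measurability of `X` required.
  have hsum : (fun ω => X (ζ ω) ω) =
      fun ω => ∑ t, (if ζ ω = t then (1 : ℝ) else 0) * X t ω := by
    funext ω
    simp
  have hφ : ∀ t, Measurable fun s : Fin T => if s = t then (1 : ℝ) else 0 :=
    fun t => measurable_of_finite _
  have hindt : ∀ t, IndepFun (fun ω => if ζ ω = t then (1 : ℝ) else 0) (X t) P := fun t =>
    (hind t).comp (hφ t) measurable_id
  have hI : ∀ t, Integrable (fun ω => if ζ ω = t then (1 : ℝ) else 0) P := fun t =>
    Integrable.of_bound ((hφ t).comp hζ).aestronglyMeasurable 1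
      (.of_forall fun ω => by split <;> simp)
  have hprod : ∀ t, Integrable (fun ω => (if ζ ω = t then (1 : ℝ) else 0) * X t ω) P :=
    fun t => (hindt t).integrable_mul (hI t) (hX t)
  rw [hsum]
  refine ⟨integrable_finsetSum _ fun t _ => hprod t, ?_⟩
  rw [integral_finsetSum _ fun t _ => hprod t, Finset.mul_sum]
  refine Finset.sum_congr rfl fun t _ => ?_
  have h1 := (hindt t).integral_mul_eq_mul_integral (hI t).aestronglyMeasurable
    (hX t).aestronglyMeasurable
  have h2 : ∫ ω, (if ζ ω = t then (1 : ℝ) else 0) ∂P = (T : ℝ)⁻¹ := by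
    have h3 := integral_map (μ := P) hζ.aemeasurable
      (f := fun s : Fin T => if s = t then (1 : ℝ) else 0) (hφ t).aestronglyMeasurable
    rw [← h3, hlaw, integral_uniformOn_univ]
    simp
  rw [h2] at h1
  exact h1

lemma LF_nonneg {d p : ℕ} {I J : Type*} {g : I → Vec d → Vec p} {f : J → Vec p → ℝ}
    {lf lg Lf Lg : ℝ} (hf : SmoothLoss f lf Lf) (hg : SmoothMap g lg Lg) : 0 ≤ LF lf lg Lf Lg := by
  have h1 := hf.nonneg.1
  have h2 := hf.nonneg.2
  have h3 := hg.nonneg.2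
  unfold LF; positivity

lemma gap_nonneg {d : ℕ} {F r : Vec d → ℝ} (h : RegularObjective F r) (x₀ : Vec d) : 0 ≤ gap F r x₀ := by
  have := ciInf_le h.bddBelow x₀
  unfold gap; linarith

section Convergence

variable {d p : ℕ} {I J Ω : Type*} [MeasurableSpace I] [MeasurableSpace J] [MeasurableSpace Ω]
  {μ : Measure I} {ν : Measure J} {g : I → Vec d → Vec p} {f : J → Vec p → ℝ} {lf lg Lf Lg : ℝ}
  {P : Measure Ω} {T : ℕ} {a a' b : ℕ → ℕ}
  {S : (t : ℕ) → Ω → Batch I J (a t) (a' t) (b t)} {ζ : Ω → Fin T}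
  {τ : ℕ} {ε β c C : ℝ} {lam : ℕ → ℝ} {r : Vec d → ℝ}

variable [IsProbabilityMeasure μ] [IsProbabilityMeasure ν]

lemma StochasticComposition.differentiable_expObj
    (hM : StochasticComposition μ ν g f lf lg Lf Lg) : Differentiable ℝ (expObj μ ν g f) :=
  (hM.smoothLoss.diff ()).comp (hM.smoothMap.diff ())

lemma StochasticComposition.norm_gradient_expObj_sub_le
    (hM : StochasticComposition μ ν g f lf lg Lf Lg) (x y : Vec d) :
    ‖gradient (expObj μ ν g f) x - gradient (expObj μ ν g f) y‖ ≤
      LF lf lg Lf Lg * ‖x - y‖ :=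
  norm_gradient_comp_sub_le hM.smoothMap hM.smoothLoss x y

lemma StochasticComposition.continuous_gradMap
    (hM : StochasticComposition μ ν g f lf lg Lf Lg) (hr : ConvexOn ℝ Set.univ r) {l : ℝ}
    (hl : 0 < l) : Continuous (gradMap l (expObj μ ν g f) r) := by
  have h1 : Continuous (gradient (expObj μ ν g f)) :=
    (LipschitzWith.of_dist_le_mul (K := (LF lf lg Lf Lg).toNNReal) fun x y => by
      rw [dist_eq_norm, dist_eq_norm, Real.coe_toNNReal _ (LF_nonneg hM.loss hM.map)]
      exact hM.norm_gradient_expObj_sub_le x y).continuous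
  have h2 : Continuous fun x => prox l r (x - l • gradient (expObj μ ν g f) x) :=
    (continuous_prox hr hl).comp (continuous_id.sub (h1.const_smul l))
  exact (continuous_id.sub h2).const_smul (1 / l)

lemma StochasticComposition.measurable_norm_gradMap
    (hM : StochasticComposition μ ν g f lf lg Lf Lg) (hr : ConvexOn ℝ Set.univ r) (x₀ : Vec d)
    (par : Params) {A : Type*} [MeasurableSpace A]
    {S : (t : ℕ) → A → Batch I J (a t) (a' t) (b t)} {t : ℕ}
    (hlam : ∀ s ≤ t, 0 < par.lam s) (hS : ∀ s ≤ t, Measurable (S s)) :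
    Measurable fun ω => ‖gradMap (par.lam t) (expObj μ ν g f) r
      (run par g f r x₀ (fun s => S s ω) t).z‖ := by
  have hrun : Measurable fun ω => run par g f r x₀ (fun s => S s ω) t :=
    measurable_run hM.map hM.meas_g hM.loss hM.meas_f hr x₀ (fun s hs => hlam s hs.le) hS
  exact (hM.continuous_gradMap hr (hlam t le_rfl)).norm.measurable.comp
    (State.measurable_z.comp hrun)

/-- The stationarity measure at `z_t` is integrable and independent of the output index. -/
lemma StochasticComposition.integrable_norm_gradMap [IsProbabilityMeasure P]
    (hM : StochasticComposition μ ν g f lf lg Lf Lg) (hS : IndependentSamples P T S ζ)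
    (hr : ConvexOn ℝ Set.univ r) (x₀ : Vec d) (hε : 0 ≤ ε) {L : ℝ}
    (hstep : StepSizes c L T β lam) {t : ℕ} (ht : t < T) :
    Integrable (fun ω => ‖gradMap (lam t) (expObj μ ν g f) r
      (run (dimParams τ ε β lam) g f r x₀ (fun s => S s ω) t).z‖) P ∧
    IndepFun ζ (fun ω => ‖gradMap (lam t) (expObj μ ν g f) r
      (run (dimParams τ ε β lam) g f r x₀ (fun s => S s ω) t).z‖) P := by
  have hβ := hstep.pos
  have hlam : ∀ s ≤ t, 0 < (dimParams τ ε β lam).lam s := fun s hs =>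
    hβ.trans_le (hstep.lam_mem s (by omega)).1
  constructor
  · have hG := hM.measurable_norm_gradMap hr x₀ (dimParams τ ε β lam) hlam
      fun s hs => hS.meas s (by omega)
    have hc := (hM.continuous_gradMap hr (hlam t le_rfl)).norm
    -- The point `z_t` stays in a compact ball fixed in advance, on which the continuous
    -- stationarity measure is bounded.
    obtain ⟨B, hB⟩ := ((isCompact_closedBall x₀ (3 * β * ε * t)).image hc).bddAbove
    refine Integrable.of_bound hG.aestronglyMeasurable B (.of_forall fun ω => ?_)
    rw [norm_norm]
    refine hB ⟨_, ?_, rfl⟩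
    rw [Metric.mem_closedBall, dist_eq_norm]
    exact (isTrajectory_run _ g f r x₀ fun s => S s ω).norm_z_sub_start_le hε hβ
      hstep.lam_mem t ht.le
  -- Independence of `ζ` follows once the stationarity measure is measurable with respect to the
  -- σ-algebra generated by all the batches.
  · have hSm : ∀ s ≤ t, Measurable[MeasurableSpace.comap (fun ω (s : Fin T) => S s ω)
        inferInstance] (S s) := fun s hs =>
      (measurable_pi_apply (⟨s, by omega⟩ : Fin T)).comp
        (comap_measurable fun ω (s : Fin T) => S s ω)
    have hG := @StochasticComposition.measurable_norm_gradMap _ _ _ _ _ _ _ _ _ _ _ _ _ _ _ _ _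
      _ _ _ hM hr x₀ (dimParams τ ε β lam) Ω
      (MeasurableSpace.comap (fun ω (s : Fin T) => S s ω) inferInstance) S t hlam hSm
    have h1 := hS.indep_ζ
    rw [IndepFun_iff_Indep] at h1 ⊢
    exact indep_of_indep_of_le_right h1 hG.comap_le

variable [IsProbabilityMeasure P]

/-- The constant of the convergence rate. -/
def rateConst (c C : ℝ) : ℝ := 50 + 1500 * C + 4 / c

/-- Convergence of the algorithm, for any sampling with small mean square error at resets. -/
theorem StochasticComposition.integral_outputNorm_le
    (hM : StochasticComposition μ ν g f lf lg Lf Lg) (hS : IndependentSamples P T S ζ)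
    (hFr : RegularObjective (expObj μ ν g f) r) (x₀ : Vec d) (hc : 0 < c) (hC : 0 < C)
    (hε : 0 < ε) (hεl : ε ≤ lf * lg) (hτ : 0 < τ)
    (hstep : StepSizes c (LF lf lg Lf Lg) T β lam)
    (hsize : ∀ t < T, t % τ ≠ 0 → BatchOrderTau C τ (a t) ∧ BatchOrderTau C τ (a' t) ∧
      BatchOrderTau C τ (b t))
    (hlaw : ∀ t < T, t % τ ≠ 0 → ∃ (ρ₁ : Measure (Fin (a t) → I))
      (ρ₂ : Measure (Fin (a' t) → I)) (ρ₃ : Measure (Fin (b t) → J)), UnbiasedBatch μ ρ₁ ∧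
        UnbiasedBatch μ ρ₂ ∧ UnbiasedBatch ν ρ₃ ∧ P.map (S t) = ρ₁.prod (ρ₂.prod ρ₃))
    {V₁ V₂ V₃ : ℝ} (hV₁ : 0 ≤ V₁) (hV₂ : 0 ≤ V₂) (hV₃ : 0 ≤ V₃)
    (hV₁' : Lf ^ 2 * lg ^ 2 * V₁ ≤ C * ε ^ 2) (hV₂' : lf ^ 2 * V₂ ≤ C * ε ^ 2)
    (hV₃' : lg ^ 2 * V₃ ≤ C * ε ^ 2)
    (hreset₁ : ∀ t < T, t % τ = 0 → ∀ x y prev, ∫⁻ s, ENNReal.ofReal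
      ((estimate (dimParams τ ε β lam) g f t s x y prev).valueErr (meanMap μ g))
        ∂(P.map (S t)) ≤ ENNReal.ofReal V₁)
    (hreset₂ : ∀ t < T, t % τ = 0 → ∀ x y prev, ∫⁻ s, ENNReal.ofReal
      ((estimate (dimParams τ ε β lam) g f t s x y prev).jacErr (meanMap μ g))
        ∂(P.map (S t)) ≤ ENNReal.ofReal V₂)
    (hreset₃ : ∀ t < T, t % τ = 0 → ∀ x y prev, ∫⁻ s, ENNReal.ofReal
      ((estimate (dimParams τ ε β lam) g f t s x y prev).gradErr (meanLoss ν f))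
        ∂(P.map (S t)) ≤ ENNReal.ofReal V₃) :
    Integrable (outputNorm (dimParams τ ε β lam) g f (expObj μ ν g f) r x₀ S ζ) P ∧
      ∫ ω, outputNorm (dimParams τ ε β lam) g f (expObj μ ν g f) r x₀ S ζ ω ∂P ≤
        rateConst c C * (ε + LF lf lg Lf Lg * gap (expObj μ ν g f) r x₀ / (ε * T)) := by
  set par := dimParams τ ε β lam with hpar
  set F := expObj μ ν g f with hF
  set L := LF lf lg Lf Lg with hL
  have hlf := hM.loss.nonneg.1
  have hLf := hM.loss.nonneg.2
  have hlg := hM.map.nonneg.1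
  have hLg := hM.map.nonneg.2
  have hβ := hstep.pos
  have hτ' : (0 : ℝ) < τ := by exact_mod_cast hτ
  -- A probability space is nonempty and `ζ` takes values in `Fin T`.
  have hT : 0 < T := by
    obtain ⟨ω⟩ : Nonempty Ω := nonempty_of_isProbabilityMeasure P
    exact (ζ ω).pos
  have hT' : (0 : ℝ) < T := by exact_mod_cast hT
  have hgap : 0 ≤ L * gap F r x₀ :=
    mul_nonneg (LF_nonneg hM.loss hM.map) (gap_nonneg hFr x₀)
  let s : ℕ → Ω → State d p := fun t ω => run par g f r x₀ (fun q => S q ω) t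
  have hs : ∀ t < T, Measurable (s t) := fun t ht =>
    measurable_run hM.map hM.meas_g hM.loss hM.meas_f hFr.convex x₀
      (fun q hq => hβ.trans_le (hstep.lam_mem q (hq.trans ht)).1)
      fun q hq => hS.meas q (by omega)
  -- mean square errors
  have hfrac : ∀ {m : ℕ} (x : ℝ), BatchOrderTau C τ m → 0 < m ∧
      4 * x ^ 2 / m ≤ 4 * x ^ 2 * (C / τ) := fun {m} x hm => by
    have h1 : (0 : ℝ) < m := lt_of_lt_of_le (by positivity) hm.1
    refine ⟨by exact_mod_cast h1, ?_⟩
    rw [div_eq_mul_inv]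
    gcongr
    rw [inv_le_comm₀ h1 (by positivity), inv_div]
    exact hm.1
  have hE₁ : ∀ t < T, ∫⁻ ω, ENNReal.ofReal ((s t ω).valueErr (meanMap μ g)) ∂P ≤
      ENNReal.ofReal (V₁ + 36 * C * (lg * β * ε) ^ 2) := fun t ht =>
    hM.lintegral_err_run_le hS hFr.convex x₀ hε.le hτ hC.le hlg hV₁ hstep hM.measurable_valueErr
      (fun _ => sq_nonneg _) hreset₁ (fun t ht h0 x y prev => by
        obtain ⟨ρ₁, ρ₂, ρ₃, h₁, h₂, h₃, h⟩ := hlaw t ht h0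
        obtain ⟨hm, hle⟩ := hfrac (lg * ‖(1 - alpha (t + 1)) • y + alpha (t + 1) • x - prev.z‖)
          (hsize t ht h0).1
        rw [h]
        refine (hM.lintegral_valueErr_step_le h₁ h₂ h₃ h0 x y prev hm).trans ?_
        exact ENNReal.ofReal_le_ofReal (add_le_add le_rfl hle)) ht
  have hE₂ : ∀ t < T, ∫⁻ ω, ENNReal.ofReal ((s t ω).jacErr (meanMap μ g)) ∂P ≤
      ENNReal.ofReal (V₂ + 36 * C * (Lg * β * ε) ^ 2) := fun t ht =>
    hM.lintegral_err_run_le hS hFr.convex x₀ hε.le hτ hC.le hLg hV₂ hstep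
      (State.measurable_jacErr _)
      (fun _ => sq_nonneg _) hreset₂ (fun t ht h0 x y prev => by
        obtain ⟨ρ₁, ρ₂, ρ₃, h₁, h₂, h₃, h⟩ := hlaw t ht h0
        obtain ⟨hm, hle⟩ := hfrac (Lg * ‖(1 - alpha (t + 1)) • y + alpha (t + 1) • x - prev.z‖)
          (hsize t ht h0).2.1
        rw [h]
        refine (hM.lintegral_jacErr_step_le h₁ h₂ h₃ h0 x y prev hm).trans ?_
        exact ENNReal.ofReal_le_ofReal (add_le_add le_rfl hle)) ht
  have hE₃ : ∀ t < T, ∫⁻ ω, ENNReal.ofReal ((s t ω).gradErr (meanLoss ν f)) ∂P ≤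
      ENNReal.ofReal (V₃ + 36 * C * (Lf * lg * β * ε) ^ 2) := fun t ht =>
    hM.lintegral_err_run_le hS hFr.convex x₀ hε.le hτ hC.le (mul_nonneg hLf hlg) hV₃ hstep
      hM.measurable_gradErr
      (fun _ => sq_nonneg _) hreset₃ (fun t ht h0 x y prev => by
        obtain ⟨ρ₁, ρ₂, ρ₃, h₁, h₂, h₃, h⟩ := hlaw t ht h0
        obtain ⟨hm, hle⟩ := hfrac
          (Lf * lg * ‖(1 - alpha (t + 1)) • y + alpha (t + 1) • x - prev.z‖) (hsize t ht h0).2.2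
        rw [h]
        refine (hM.lintegral_gradErr_step_le h₁ h₂ h₃ h0 x y prev hm).trans ?_
        exact ENNReal.ofReal_le_ofReal (add_le_add le_rfl hle)) ht
  let Q : State d p → ℝ := fun s => lf ^ 2 * s.jacErr (meanMap μ g) +
    lg ^ 2 * s.gradErr (meanLoss ν f) + Lf ^ 2 * lg ^ 2 * s.valueErr (meanMap μ g)
  have hQ0 : ∀ s, 0 ≤ Q s := fun s =>
    add_nonneg (add_nonneg (mul_nonneg (sq_nonneg _) (sq_nonneg _))
      (mul_nonneg (sq_nonneg _) (sq_nonneg _)))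
      (mul_nonneg (mul_nonneg (sq_nonneg _) (sq_nonneg _)) (sq_nonneg _))
  have hQm : ∀ t < T, Measurable fun ω => Q (s t ω) := fun t ht =>
    ((((State.measurable_jacErr _).const_mul _).add (hM.measurable_gradErr.const_mul _)).add
      (hM.measurable_valueErr.const_mul _)).comp (hs t ht)
  -- Each summand of `LF` separately satisfies the upper step size bound. These are exactly the
  -- factors left when the accumulated errors are multiplied by their weights.
  have hβ1 : lf * Lg * β ≤ 1 := by
    refine le_trans ?_ hstep.upper
    rw [hL, LF]; nlinarith [mul_nonneg (mul_nonneg (sq_nonneg lg) hLf) hβ.le]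
  have hβ2 : lg ^ 2 * Lf * β ≤ 1 := by
    refine le_trans ?_ hstep.upper
    rw [hL, LF]; nlinarith [mul_nonneg (mul_nonneg hlf hLg) hβ.le]
  have hsq1 : (lf * Lg * β) ^ 2 * (36 * C * ε ^ 2) ≤ 36 * C * ε ^ 2 :=
    mul_le_of_le_one_left (by positivity) (pow_le_one₀ (by positivity) hβ1)
  have hsq2 : (lg ^ 2 * Lf * β) ^ 2 * (36 * C * ε ^ 2) ≤ 36 * C * ε ^ 2 :=
    mul_le_of_le_one_left (by positivity) (pow_le_one₀ (by positivity) hβ2)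
  -- Each of the three errors contributes `C * ε ^ 2` from its reset and `36 * C * ε ^ 2` from its
  -- corrections, so the constant is `3 * 37 = 111`.
  have hEQ : ∀ t < T, ∫⁻ ω, ENNReal.ofReal (Q (s t ω)) ∂P ≤
      ENNReal.ofReal (111 * C * ε ^ 2) := by
    intro t ht
    have h0 : ∀ ω, ENNReal.ofReal (Q (s t ω)) =
        ENNReal.ofReal (lf ^ 2) * ENNReal.ofReal ((s t ω).jacErr (meanMap μ g)) +
        ENNReal.ofReal (lg ^ 2) * ENNReal.ofReal ((s t ω).gradErr (meanLoss ν f)) +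
        ENNReal.ofReal (Lf ^ 2 * lg ^ 2) *
          ENNReal.ofReal ((s t ω).valueErr (meanMap μ g)) := fun ω => by
      have a1 : 0 ≤ (s t ω).jacErr (meanMap μ g) := sq_nonneg _
      have a2 : 0 ≤ (s t ω).gradErr (meanLoss ν f) := sq_nonneg _
      have a3 : 0 ≤ (s t ω).valueErr (meanMap μ g) := sq_nonneg _
      rw [← ENNReal.ofReal_mul (by positivity), ← ENNReal.ofReal_mul (by positivity),
        ← ENNReal.ofReal_mul (by positivity), ← ENNReal.ofReal_add (by positivity) (by positivity),
        ← ENNReal.ofReal_add (by positivity) (by positivity)]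
    have m1 : Measurable fun ω => ENNReal.ofReal ((s t ω).jacErr (meanMap μ g)) :=
      ((State.measurable_jacErr _).comp (hs t ht)).ennreal_ofReal
    have m2 : Measurable fun ω => ENNReal.ofReal ((s t ω).gradErr (meanLoss ν f)) :=
      (hM.measurable_gradErr.comp (hs t ht)).ennreal_ofReal
    have m3 : Measurable fun ω => ENNReal.ofReal ((s t ω).valueErr (meanMap μ g)) :=
      (hM.measurable_valueErr.comp (hs t ht)).ennreal_ofReal
    simp_rw [h0]
    rw [lintegral_add_right _ (m3.const_mul _), lintegral_add_right _ (m2.const_mul _),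
      lintegral_const_mul _ m1, lintegral_const_mul _ m2, lintegral_const_mul _ m3]
    calc _ ≤ ENNReal.ofReal (lf ^ 2) * ENNReal.ofReal (V₂ + 36 * C * (Lg * β * ε) ^ 2) +
          ENNReal.ofReal (lg ^ 2) * ENNReal.ofReal (V₃ + 36 * C * (Lf * lg * β * ε) ^ 2) +
          ENNReal.ofReal (Lf ^ 2 * lg ^ 2) *
            ENNReal.ofReal (V₁ + 36 * C * (lg * β * ε) ^ 2) := by
          gcongr
          exacts [hE₂ t ht, hE₃ t ht, hE₁ t ht]
      _ = ENNReal.ofReal (lf ^ 2 * (V₂ + 36 * C * (Lg * β * ε) ^ 2) +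
          lg ^ 2 * (V₃ + 36 * C * (Lf * lg * β * ε) ^ 2) +
          Lf ^ 2 * lg ^ 2 * (V₁ + 36 * C * (lg * β * ε) ^ 2)) := by
          rw [← ENNReal.ofReal_mul (by positivity), ← ENNReal.ofReal_mul (by positivity),
            ← ENNReal.ofReal_mul (by positivity),
            ← ENNReal.ofReal_add (by positivity) (by positivity),
            ← ENNReal.ofReal_add (by positivity) (by positivity)]
      _ ≤ _ := by
          refine ENNReal.ofReal_le_ofReal ?_
          have e1 : lf ^ 2 * (V₂ + 36 * C * (Lg * β * ε) ^ 2) =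
            lf ^ 2 * V₂ + (lf * Lg * β) ^ 2 * (36 * C * ε ^ 2) := by ring
          have e2 : lg ^ 2 * (V₃ + 36 * C * (Lf * lg * β * ε) ^ 2) =
            lg ^ 2 * V₃ + (lg ^ 2 * Lf * β) ^ 2 * (36 * C * ε ^ 2) := by ring
          have e3 : Lf ^ 2 * lg ^ 2 * (V₁ + 36 * C * (lg * β * ε) ^ 2) =
            Lf ^ 2 * lg ^ 2 * V₁ + (lg ^ 2 * Lf * β) ^ 2 * (36 * C * ε ^ 2) := by ring
          rw [e1, e2, e3]
          linarith
  -- the sum of the stationarity measures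
  let X : ℕ → Ω → ℝ := fun t ω => ‖gradMap (lam t) F r (s t ω).z‖
  have hX : ∀ t < T, Integrable (X t) P ∧ IndepFun ζ (X t) P := fun t ht =>
    hM.integrable_norm_gradMap hS hFr.convex x₀ hε.le hstep ht
  -- The deterministic part: the descent bound together with `13 * (3 / 2) * ε` per iteration from
  -- the splitting of the gradient error.
  set A := (30 * ε * T + 4 * (L * gap F r x₀) / (c * ε)) + 39 / 2 * ε * T with hA
  have hA0 : 0 ≤ A := by positivity
  have hpath : ∀ ω, ∑ t ∈ Finset.range T, X t ω ≤
      A + ∑ t ∈ Finset.range T, 13 / ε * Q (s t ω) := by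
    intro ω
    have h1 := (isTrajectory_run par g f r x₀ fun q => S q ω).sum_norm_gradMap_le
      hM.differentiable_expObj hM.norm_gradient_expObj_sub_le hFr hε hc hstep
    have h2 : ∀ t ∈ Finset.range T, ‖ContinuousLinearMap.adjoint (s t ω).jacEst (s t ω).gradEst -
        gradient F (s t ω).z‖ ≤ 3 / 2 * ε + Q (s t ω) / ε := fun t _ =>
      norm_estimate_sub_gradient_le hM.smoothMap hM.smoothLoss hε hεl (s t ω).z (s t ω).gEst
        (s t ω).gradEst (s t ω).jacEst
    have h3 := Finset.sum_le_sum h2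
    rw [Finset.sum_add_distrib] at h3
    simp only [Finset.sum_const, Finset.card_range, nsmul_eq_mul] at h3
    have h4 : ∑ t ∈ Finset.range T, 13 / ε * Q (s t ω) =
        13 * ∑ t ∈ Finset.range T, Q (s t ω) / ε := by
      rw [Finset.mul_sum]
      exact Finset.sum_congr rfl fun t _ => by ring
    rw [h4, hA]
    refine h1.trans ?_
    have h5 := mul_le_mul_of_nonneg_left h3 (by norm_num : (0 : ℝ) ≤ 13)
    exact (add_le_add le_rfl h5).trans (le_of_eq (by ring))
  have hsumint : ∫ ω, ∑ t ∈ Finset.range T, X t ω ∂P ≤ A + T * (1443 * C * ε) := by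
    have hXm : Integrable (fun ω => ∑ t ∈ Finset.range T, X t ω) P :=
      integrable_finsetSum _ fun t ht => (hX t (Finset.mem_range.mp ht)).1
    have hX0 : ∀ ω, 0 ≤ ∑ t ∈ Finset.range T, X t ω := fun ω =>
      Finset.sum_nonneg fun t _ => norm_nonneg _
    -- In terms of lower integrals the integrability of `Q` along the run need not be shown
    -- separately. The constant in the target is `13 * 111 = 1443`.
    rw [integral_eq_lintegral_of_nonneg_ae (.of_forall hX0) hXm.aestronglyMeasurable]
    refine ENNReal.toReal_le_of_le_ofReal (by positivity) ?_
    have h1 : ∀ ω, ENNReal.ofReal (∑ t ∈ Finset.range T, X t ω) ≤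
        ENNReal.ofReal A + ∑ t ∈ Finset.range T, ENNReal.ofReal (13 / ε) *
          ENNReal.ofReal (Q (s t ω)) := fun ω => by
      refine (ENNReal.ofReal_le_ofReal (hpath ω)).trans (ENNReal.ofReal_add_le.trans ?_)
      gcongr
      rw [ENNReal.ofReal_sum_of_nonneg fun t _ => mul_nonneg (by positivity) (hQ0 _)]
      refine Finset.sum_le_sum fun t _ => le_of_eq ?_
      rw [ENNReal.ofReal_mul (by positivity)]
    refine (lintegral_mono h1).trans ?_
    rw [lintegral_add_left measurable_const,
      lintegral_finsetSum' _ fun t ht => ((hQm t (Finset.mem_range.mp ht)).ennreal_ofReal.const_mul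
        _).aemeasurable]
    simp only [lintegral_const, measure_univ, mul_one]
    rw [ENNReal.ofReal_add hA0 (by positivity)]
    gcongr
    have h2 : ∀ t ∈ Finset.range T, ∫⁻ ω, ENNReal.ofReal (13 / ε) *
        ENNReal.ofReal (Q (s t ω)) ∂P ≤ ENNReal.ofReal (1443 * C * ε) := fun t ht => by
      have ht := Finset.mem_range.mp ht
      rw [lintegral_const_mul _ (hQm t ht).ennreal_ofReal]
      calc _ ≤ ENNReal.ofReal (13 / ε) * ENNReal.ofReal (111 * C * ε ^ 2) := by
            gcongr; exact hEQ t ht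
        _ = ENNReal.ofReal (1443 * C * ε) := by
            rw [← ENNReal.ofReal_mul (by positivity)]
            congr 1; field_simp; ring
    refine (Finset.sum_le_sum h2).trans (le_of_eq ?_)
    rw [Finset.sum_const, Finset.card_range, nsmul_eq_mul, ENNReal.ofReal_mul hT'.le,
      ENNReal.ofReal_natCast]
  -- the output
  obtain ⟨hint, heq⟩ := integral_uniform_index (P := P) hS.meas_ζ hS.law_ζ
    (X := fun t : Fin T => X t) (fun t => (hX t t.2).1) (fun t => (hX t t.2).2)
  refine ⟨hint, ?_⟩
  change ∫ ω, X (ζ ω) ω ∂P ≤ _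
  rw [heq, Fin.sum_univ_eq_sum_range (fun t => ∫ ω, X t ω ∂P) T,
    ← integral_finsetSum _ fun t ht => (hX t (Finset.mem_range.mp ht)).1]
  rw [integral_finsetSum _ fun t ht => (hX t (Finset.mem_range.mp ht)).1] at hsumint ⊢
  calc _ ≤ (T : ℝ)⁻¹ * (A + T * (1443 * C * ε)) := by gcongr
    _ = (99 / 2 + 1443 * C) * ε + 4 / c * (L * gap F r x₀ / (ε * T)) := by
        rw [hA]; field_simp; ring
    _ ≤ (50 + 1500 * C + 4 / c) * ε +
        (50 + 1500 * C + 4 / c) * (L * gap F r x₀ / (ε * T)) := by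
        have h1 : 0 ≤ 4 / c := by positivity
        refine add_le_add (mul_le_mul_of_nonneg_right ?_ hε.le)
          (mul_le_mul_of_nonneg_right ?_ (by positivity)) <;> linarith
    _ = _ := by rw [rateConst]; ring

end Convergence

/-! ### The double expectation problem -/

lemma one_le_expPeriod {lf lg ε : ℝ} (hε : 0 < ε) (hεl : ε ≤ lf * lg) :
    1 ≤ expPeriod lf lg ε :=
  Nat.le_floor (by rw [Nat.cast_one, le_div_iff₀ hε]; linarith)

/-- The weight `κ` may vanish, for instance when `Lf = 0`. Then the prescribed size gives no
information, but the error carries no weight either, and `m ≥ 1` suffices. -/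
lemma exists_reset_bound {C κ σ ε : ℝ} (hC : 0 < C) (hκ : 0 ≤ κ) (hε : 0 < ε) :
    ∃ V : ℝ, 0 ≤ V ∧ κ * V ≤ C * ε ^ 2 ∧
      ∀ m : ℕ, BatchOrder C (κ * σ ^ 2 / ε ^ 2) m → σ ^ 2 / m ≤ V := by
  rcases hκ.eq_or_lt with h | h
  · refine ⟨σ ^ 2, by positivity, by rw [← h]; simp; positivity, fun m hm => ?_⟩
    exact div_le_self (sq_nonneg σ) (by exact_mod_cast hm.1)
  · refine ⟨C * ε ^ 2 / κ, by positivity, (mul_div_cancel₀ _ h.ne').le, fun m hm => ?_⟩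
    have hm0 : (0 : ℝ) < m := by exact_mod_cast hm.1
    have h1 := hm.2.1
    rw [div_div, div_le_iff₀ (by positivity)] at h1
    rw [div_le_div_iff₀ hm0 h]
    linarith

theorem integral_outputNorm_expRun_le {d p : ℕ} {I J Ω : Type*} [MeasurableSpace I]
    [MeasurableSpace J] [MeasurableSpace Ω] {μ : Measure I} [IsProbabilityMeasure μ]
    {ν : Measure J} [IsProbabilityMeasure ν] {P : Measure Ω} [IsProbabilityMeasure P]
    {c C lf lg Lf Lg σg σg' σf' : ℝ} {g : I → Vec d → Vec p} {f : J → Vec p → ℝ}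
    {r : Vec d → ℝ} (x₀ : Vec d) (hc : 0 < c) (hC : 0 < C) (hf : SmoothLoss f lf Lf)
    (hg : SmoothMap g lg Lg) (hFr : RegularObjective (expObj μ ν g f) r)
    (hV : BoundedVariance μ ν g f σg σg' σf') {ε : ℝ} (hε : 0 < ε) (hεl : ε ≤ lf * lg) {T : ℕ}
    {β : ℝ} {lam : ℕ → ℝ} {a a' b : ℕ → ℕ}
    {S : (t : ℕ) → Ω → Batch I J (a t) (a' t) (b t)} {ζ : Ω → Fin T}
    (hR : ExpRun P μ ν c C lf lg Lf Lg σg σg' σf' ε T β lam S ζ) :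
    Integrable (outputNorm (dimParams (expPeriod lf lg ε) ε β lam) g f (expObj μ ν g f) r x₀ S ζ)
      P ∧
    ∫ ω, outputNorm (dimParams (expPeriod lf lg ε) ε β lam) g f (expObj μ ν g f) r x₀ S ζ ω ∂P
      ≤ rateConst c C * (ε + LF lf lg Lf Lg * gap (expObj μ ν g f) r x₀ / (ε * T)) := by
  have hM : StochasticComposition μ ν g f lf lg Lf Lg :=
    ⟨hf, hg, hV.meas_g, hV.meas_f, hV.int_g, hV.int_f⟩
  obtain ⟨V₁, hV₁, hV₁', hb₁⟩ := exists_reset_bound (κ := Lf ^ 2 * lg ^ 2) (σ := σg) hC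
    (by positivity) hε
  obtain ⟨V₂, hV₂, hV₂', hb₂⟩ := exists_reset_bound (κ := lf ^ 2) (σ := σg') hC
    (by positivity) hε
  obtain ⟨V₃, hV₃, hV₃', hb₃⟩ := exists_reset_bound (κ := lg ^ 2) (σ := σf') hC
    (by positivity) hε
  refine hM.integral_outputNorm_le hR.samples hFr x₀ hc hC hε hεl (one_le_expPeriod hε hεl)
    hR.steps hR.size (fun t ht _ => ⟨_, _, _, unbiasedBatch_pi μ _, unbiasedBatch_pi μ _,
      unbiasedBatch_pi ν _, hR.law t ht⟩) hV₁ hV₂ hV₃ hV₁' hV₂' hV₃' ?_ ?_ ?_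
  · intro t ht h0 x y prev
    obtain ⟨s₁, s₂, s₃⟩ := hR.size_reset t ht h0
    rw [hR.law t ht]
    exact (hM.lintegral_valueErr_reset_le hV (unbiasedBatch_pi μ _) (unbiasedBatch_pi μ _)
      (unbiasedBatch_pi ν _) h0 x y prev s₁.1).trans (ENNReal.ofReal_le_ofReal (hb₁ _ s₁))
  · intro t ht h0 x y prev
    obtain ⟨s₁, s₂, s₃⟩ := hR.size_reset t ht h0
    rw [hR.law t ht]
    exact (hM.lintegral_jacErr_reset_le hV (unbiasedBatch_pi μ _) (unbiasedBatch_pi μ _)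
      (unbiasedBatch_pi ν _) h0 x y prev s₂.1).trans (ENNReal.ofReal_le_ofReal (hb₂ _ s₂))
  · intro t ht h0 x y prev
    obtain ⟨s₁, s₂, s₃⟩ := hR.size_reset t ht h0
    rw [hR.law t ht]
    exact (hM.lintegral_gradErr_reset_le hV (unbiasedBatch_pi μ _) (unbiasedBatch_pi μ _)
      (unbiasedBatch_pi ν _) h0 x y prev s₃.1).trans (ENNReal.ofReal_le_ofReal (hb₃ _ s₃))

/-! ### The double finite-sum problem -/

lemma isProbabilityMeasure_uniformOn_fin {n : ℕ} (hn : 0 < n) :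
    IsProbabilityMeasure (uniformOn (Set.univ : Set (Fin n))) :=
  isProbabilityMeasure_uniformOn Set.finite_univ ⟨⟨0, hn⟩, trivial⟩

/-- Finite sums are expectations under the uniform measures, so one convergence theorem serves both
problems. -/
lemma sumObj_eq_expObj {d p n N : ℕ} (g : Fin n → Vec d → Vec p) (f : Fin N → Vec p → ℝ) :
    sumObj g f = expObj (uniformOn Set.univ) (uniformOn Set.univ) g f := by
  funext x
  simp only [sumObj, expObj, meanLoss, meanMap, integral_uniformOn_univ, one_div, smul_eq_mul]

lemma stochasticComposition_fin {d p n N : ℕ} {g : Fin n → Vec d → Vec p}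
    {f : Fin N → Vec p → ℝ} {lf lg Lf Lg : ℝ} (hf : SmoothLoss f lf Lf)
    (hg : SmoothMap g lg Lg) (hn : 0 < n) (hN : 0 < N) :
    StochasticComposition (uniformOn Set.univ) (uniformOn Set.univ) g f lf lg Lf Lg := by
  have := isProbabilityMeasure_uniformOn_fin hn
  have := isProbabilityMeasure_uniformOn_fin hN
  exact ⟨hf, hg, fun _ => measurable_of_finite _, fun _ => measurable_of_finite _,
    fun _ => Integrable.of_finite, fun _ => Integrable.of_finite⟩

lemma batchMean_bijective {E : Type*} [NormedAddCommGroup E] [NormedSpace ℝ E]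
    [CompleteSpace E] {n m : ℕ} (φ : Fin n → E) {s : Fin m → Fin n}
    (hs : Function.Bijective s) :
    batchMean (fun i => φ (s i)) = ∫ i, φ i ∂(uniformOn (Set.univ : Set (Fin n))) := by
  have hmn : m = n := by simpa using Fintype.card_of_bijective hs
  rw [integral_uniformOn_univ, batchMean, hs.sum_comp φ, hmn]

lemma batchLaw_eq_zero_or_isProbabilityMeasure (mode : Sampling) (n m : ℕ) :
    batchLaw mode n m = 0 ∨ IsProbabilityMeasure (batchLaw mode n m) := by
  have h : ∀ A : Set (Fin m → Fin n), uniformOn A = 0 ∨ IsProbabilityMeasure (uniformOn A) := by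
    intro A
    rcases A.eq_empty_or_nonempty with hA | hA
    · left; rw [hA, uniformOn_empty_meas]
    · right; exact isProbabilityMeasure_uniformOn A.toFinite hA
  cases mode
  · exact h _
  · exact h _

/-- A batch law is either zero or a probability measure, and a zero factor would annihilate the
product. Thus the mere existence of a run guarantees that the batch sizes can be realized without
replacement. -/
lemma isProbabilityMeasure_batchLaw_of_prod {mode : Sampling} {n n' N m m' k : ℕ}
    (h : IsProbabilityMeasure
      ((batchLaw mode n m).prod ((batchLaw mode n' m').prod (batchLaw mode N k)))) :
    IsProbabilityMeasure (batchLaw mode n m) ∧ IsProbabilityMeasure (batchLaw mode n' m') ∧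
      IsProbabilityMeasure (batchLaw mode N k) := by
  have hne : (batchLaw mode n m).prod ((batchLaw mode n' m').prod (batchLaw mode N k)) ≠ 0 :=
    h.ne_zero
  refine ⟨(batchLaw_eq_zero_or_isProbabilityMeasure mode n m).resolve_left fun h0 => ?_,
    (batchLaw_eq_zero_or_isProbabilityMeasure mode n' m').resolve_left fun h0 => ?_,
    (batchLaw_eq_zero_or_isProbabilityMeasure mode N k).resolve_left fun h0 => ?_⟩
  all_goals exact hne (by simp [h0])

lemma one_le_sqrt_max {n N : ℕ} (hN : 0 < N) : 1 ≤ Real.sqrt (max N n : ℕ) := by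
  rw [Real.one_le_sqrt]
  exact_mod_cast le_max_of_le_left hN

lemma one_le_sumPeriod {n N : ℕ} (hN : 0 < N) : 1 ≤ sumPeriod n N :=
  Nat.le_floor (by simpa using one_le_sqrt_max (n := n) hN)

theorem integral_outputNorm_sumRun_le {d p n N : ℕ} {Ω : Type*} [MeasurableSpace Ω]
    {P : Measure Ω} [IsProbabilityMeasure P] {c C lf lg Lf Lg : ℝ} {g : Fin n → Vec d → Vec p}
    {f : Fin N → Vec p → ℝ} {r : Vec d → ℝ} (x₀ : Vec d) (hc : 0 < c) (hC : 0 < C)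
    (hn : 0 < n) (hN : 0 < N) (hf : SmoothLoss f lf Lf)
    (hg : SmoothMap g lg Lg) (hFr : RegularObjective (sumObj g f) r) {ε : ℝ} (hε : 0 < ε)
    (hεl : ε < lf * lg / Real.sqrt (max N n : ℕ)) {T : ℕ}
    {β : ℝ} {lam : ℕ → ℝ} {a a' b : ℕ → ℕ} {mode : Sampling}
    {S : (t : ℕ) → Ω → Batch (Fin n) (Fin N) (a t) (a' t) (b t)} {ζ : Ω → Fin T}
    (hR : SumRun P n N c C (LF lf lg Lf Lg) T β lam mode S ζ) :
    Integrable (outputNorm (dimParams (sumPeriod n N) ε β lam) g f (sumObj g f) r x₀ S ζ) P ∧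
    ∫ ω, outputNorm (dimParams (sumPeriod n N) ε β lam) g f (sumObj g f) r x₀ S ζ ω ∂P
      ≤ rateConst c C * (ε + LF lf lg Lf Lg * gap (sumObj g f) r x₀ / (ε * T)) := by
  have := isProbabilityMeasure_uniformOn_fin hn
  have := isProbabilityMeasure_uniformOn_fin hN
  have hM := stochasticComposition_fin hf hg hn hN
  have hεl' : ε ≤ lf * lg :=
    hεl.le.trans (div_le_self (mul_nonneg hf.nonneg.1 hg.nonneg.1) (one_le_sqrt_max hN))
  rw [sumObj_eq_expObj] at hFr ⊢
  -- At a reset the batch runs through all indices for every outcome, so the estimate is exact and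
  -- the reset bounds hold with zero.
  have hreset : ∀ {err : State d p → ℝ}, Measurable err → (∀ t < T, t % sumPeriod n N = 0 →
      ∀ x y prev ω,
      err (estimate (dimParams (sumPeriod n N) ε β lam) g f t (S t ω) x y prev) = 0) →
      ∀ t < T, t % sumPeriod n N = 0 → ∀ x y prev, ∫⁻ s, ENNReal.ofReal
        (err (estimate (dimParams (sumPeriod n N) ε β lam) g f t s x y prev)) ∂(P.map (S t)) ≤
          ENNReal.ofReal 0 := by
    intro err herr h t ht h0 x y prev
    rw [lintegral_map (hM.measurable_err_estimate herr x y prev) (hR.samples.meas t ht)]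
    simp only [h t ht h0 x y prev]
    simp
  refine hM.integral_outputNorm_le hR.samples hFr x₀ hc hC hε hεl' (one_le_sumPeriod hN)
    hR.steps hR.size (fun t ht h0 => ?_) le_rfl le_rfl le_rfl (by simp; positivity)
    (by simp; positivity) (by simp; positivity) (hreset hM.measurable_valueErr ?_)
    (hreset (State.measurable_jacErr _) ?_) (hreset hM.measurable_gradErr ?_)
  · have hp : IsProbabilityMeasure (P.map (S t)) :=
      Measure.isProbabilityMeasure_map (hR.samples.meas t ht).aemeasurable
    rw [hR.law t ht h0] at hp
    obtain ⟨h₁, h₂, h₃⟩ := isProbabilityMeasure_batchLaw_of_prod hp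
    exact ⟨_, _, _, unbiasedBatch_batchLaw hn mode h₁, unbiasedBatch_batchLaw hn mode h₂,
      unbiasedBatch_batchLaw hN mode h₃, hR.law t ht h0⟩
  · intro t ht h0 x y prev ω
    have hb := (hR.full_reset t ht h0 ω).1
    simp only [estimate, dimParams, h0, if_true, State.valueErr]
    rw [batchMean_bijective (fun i => g i _) hb]
    simp [meanMap]
  · intro t ht h0 x y prev ω
    have hb := (hR.full_reset t ht h0 ω).2.1
    simp only [estimate, dimParams, h0, if_true, State.jacErr]
    rw [batchMean_bijective (fun i => fderiv ℝ (g i) _) hb,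
      fderiv_meanMap hM.map hM.meas_g hM.int_g, sub_self, ← norm_entries, map_zero, norm_zero,
      zero_pow two_ne_zero]
  · intro t ht h0 x y prev ω
    have hb := (hR.full_reset t ht h0 ω).2.2
    simp only [estimate, dimParams, h0, if_true, State.gradErr]
    rw [batchMean_bijective (fun i => gradient (f i) _) hb,
      gradient_meanLoss hM.loss hM.meas_f hM.int_f, sub_self, norm_zero, zero_pow two_ne_zero]

/-! ### Sample complexity -/

/-- Division by `τ` is injective on the numbers with residue zero. -/
lemma card_multiples_le (τ T : ℕ) :
    ((Finset.range T).filter fun t => t % τ = 0).card ≤ T / τ + 1 := by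
  rw [← Finset.card_range (T / τ + 1)]
  refine Finset.card_le_card_of_injOn (fun t => t / τ) (fun t ht => ?_) fun t ht u hu h => ?_
  · have ht := (Finset.mem_filter.mp ht).1
    rw [Finset.mem_range] at ht
    exact Finset.mem_coe.mpr (Finset.mem_range.mpr
      (Nat.lt_succ_of_le (Nat.div_le_div_right ht.le)))
  · have h1 := (Finset.mem_filter.mp ht).2
    have h2 := (Finset.mem_filter.mp hu).2
    have h3 := Nat.div_add_mod t τ
    have h4 := Nat.div_add_mod u τ
    simp only at h
    rw [← h3, ← h4, h, h1, h2]

lemma evalCount_le {τ T : ℕ} {a a' b : ℕ → ℕ} {R M : ℝ} (hR : 0 ≤ R) (hM : 0 ≤ M)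
    (hreset : ∀ t < T, t % τ = 0 → (a t + a' t + b t : ℝ) ≤ R)
    (hother : ∀ t < T, t % τ ≠ 0 → (a t + a' t + b t : ℝ) ≤ M) :
    (evalCount τ a a' b T : ℝ) ≤ (T / τ + 1) * R + 2 * M * T := by
  have h1 : ∀ t ∈ Finset.range T,
      ((if t % τ = 0 then 1 else 2 : ℕ) * (a t + a' t + b t) : ℝ) ≤
        (if t % τ = 0 then R else 0) + 2 * M := by
    intro t ht
    have ht := Finset.mem_range.mp ht
    split
    · next h => push_cast; linarith [hreset t ht h]
    · next h => push_cast; linarith [hother t ht h]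
  have h2 := Finset.sum_le_sum h1
  have h3 : (evalCount τ a a' b T : ℝ) = ∑ t ∈ Finset.range T,
      ((if t % τ = 0 then 1 else 2 : ℕ) * (a t + a' t + b t) : ℝ) := by
    rw [evalCount]; push_cast; rfl
  rw [h3]
  refine h2.trans ?_
  rw [Finset.sum_add_distrib, ← Finset.sum_filter, Finset.sum_const, Finset.sum_const,
    Finset.card_range, nsmul_eq_mul, nsmul_eq_mul]
  have h4 : ((((Finset.range T).filter fun t => t % τ = 0).card : ℕ) : ℝ) ≤ T / τ + 1 := by
    have h5 : ((((Finset.range T).filter fun t => t % τ = 0).card : ℕ) : ℝ) ≤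
        ((T / τ + 1 : ℕ) : ℝ) := by exact_mod_cast card_multiples_le τ T
    refine h5.trans ?_
    push_cast
    gcongr
    exact Nat.cast_div_le
  nlinarith

/-- The number of iterations that suffices for accuracy `ε`. -/
def iterations (K A ε : ℝ) : ℕ := ⌊4 * K ^ 2 * A / ε ^ 2⌋₊ + 1

lemma iterations_le {K A ε : ℝ} (hA : 0 ≤ A) :
    (iterations K A ε : ℝ) ≤ 4 * K ^ 2 * A / ε ^ 2 + 1 := by
  rw [iterations]; push_cast
  gcongr
  exact Nat.floor_le (by positivity)

/-- The accuracy `ε / (2 * K)` makes the first term `ε / 2`; the number of iterations is chosen so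
that the second is at most `ε / 2` as well. -/
lemma rate_le {K A ε : ℝ} (hK : 0 < K) (hε : 0 < ε) :
    K * (ε / (2 * K) + A / (ε / (2 * K) * iterations K A ε)) ≤ ε := by
  have hT : 4 * K ^ 2 * A / ε ^ 2 ≤ iterations K A ε := by
    rw [iterations]; push_cast
    exact (Nat.lt_floor_add_one _).le
  have hT0 : (0 : ℝ) < iterations K A ε := by rw [iterations]; positivity
  have h1 : K * (ε / (2 * K) + A / (ε / (2 * K) * iterations K A ε)) =
      ε / 2 + 2 * K ^ 2 * A / ε / iterations K A ε := by
    field_simp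
  have h2 : 2 * K ^ 2 * A / ε / iterations K A ε ≤ ε / 2 := by
    rw [div_le_iff₀ hT0]
    calc 2 * K ^ 2 * A / ε = ε / 2 * (4 * K ^ 2 * A / ε ^ 2) := by field_simp; ring
      _ ≤ _ := by gcongr
  rw [h1]; linarith

lemma half_le_floor {x : ℝ} (hx : 1 ≤ x) : x / 2 ≤ ⌊x⌋₊ := by
  have h1 := Nat.lt_floor_add_one x
  have h2 : (1 : ℝ) ≤ ⌊x⌋₊ := by exact_mod_cast Nat.le_floor (by simpa using hx)
  linarith

lemma rateConst_ge {c C : ℝ} (hc : 0 < c) (hC : 0 ≤ C) : 50 ≤ rateConst c C := by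
  have : 0 ≤ 4 / c := by positivity
  unfold rateConst; linarith

/-- A reset costs at most `3 * q ^ 2` and occurs once per period of length at least `q / 2`, so on
average it costs `6 * q` per iteration, the same order as the ordinary batches. The initial reset
accounts for the term in `N + n`. -/
lemma evalCount_sum_le {n N T : ℕ} {a a' b : ℕ → ℕ} {C : ℝ} (hC : 0 ≤ C) (hN : 0 < N)
    (hreset : ∀ t < T, t % sumPeriod n N = 0 → a t = n ∧ a' t = n ∧ b t = N)
    (hsize : ∀ t < T, t % sumPeriod n N ≠ 0 → BatchOrderTau C (sumPeriod n N) (a t) ∧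
      BatchOrderTau C (sumPeriod n N) (a' t) ∧ BatchOrderTau C (sumPeriod n N) (b t)) :
    (evalCount (sumPeriod n N) a a' b T : ℝ) ≤
      3 * (N + n) + (6 + 6 * C) * Real.sqrt (max N n : ℕ) * T := by
  set q := Real.sqrt (max N n : ℕ) with hq
  have hq1 : 1 ≤ q := one_le_sqrt_max hN
  have hqq : q * q = (max N n : ℕ) := Real.mul_self_sqrt (Nat.cast_nonneg _)
  have hτ1 : q / 2 ≤ sumPeriod n N := half_le_floor hq1
  have hτ2 : (sumPeriod n N : ℝ) ≤ q := Nat.floor_le (by linarith)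
  have hmaxN : (N : ℝ) ≤ q * q := by rw [hqq]; exact_mod_cast le_max_left N n
  have hmaxn : (n : ℝ) ≤ q * q := by rw [hqq]; exact_mod_cast le_max_right N n
  have hmax : q * q ≤ N + n := by
    rw [hqq]; exact_mod_cast max_le (Nat.le_add_right N n) (Nat.le_add_left n N)
  have h1 := evalCount_le (τ := sumPeriod n N) (T := T) (a := a) (a' := a') (b := b)
    (R := 3 * (q * q)) (M := 3 * C * q) (by positivity) (by positivity)
    (fun t ht h0 => by
      obtain ⟨e₁, e₂, e₃⟩ := hreset t ht h0
      rw [e₁, e₂, e₃]; linarith)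
    (fun t ht h0 => by
      obtain ⟨e₁, e₂, e₃⟩ := hsize t ht h0
      have : C * (sumPeriod n N : ℝ) ≤ C * q := by gcongr
      linarith [e₁.2, e₂.2, e₃.2])
  have h2 : (T : ℝ) / sumPeriod n N ≤ T / (q / 2) := by gcongr
  have h3 : (T : ℝ) / (q / 2) * (3 * (q * q)) = 6 * q * T := by field_simp; ring
  have h4 : (T : ℝ) / sumPeriod n N * (3 * (q * q)) ≤ 6 * q * T := by
    rw [← h3]; gcongr
  linarith

/-- The constant of the sample complexity of the double finite-sum problem. -/
def sumConst (c C : ℝ) : ℝ := rateConst c C + 24 * (1 + C) * rateConst c C ^ 2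

/-- The additional iteration from rounding up costs a multiple of `q`, absorbed into `X` by `q ≤ X`.
-/
lemma sum_complexity_arith {K C A ε q X E T : ℝ} (hK : 50 ≤ K) (hC : 0 ≤ C) (hA : 0 ≤ A)
    (hq : 0 ≤ q) (hqX : q ≤ X) (hE : E ≤ 3 * X + (6 + 6 * C) * q * T)
    (hT : T ≤ 4 * K ^ 2 * A / ε ^ 2 + 1) :
    E ≤ (K + 24 * (1 + C) * K ^ 2) * (X + q * A / ε ^ 2) := by
  have hX : 0 ≤ X := hq.trans hqX
  set B := A / ε ^ 2 with hB
  have hB0 : 0 ≤ B := by positivity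
  have e1 : 4 * K ^ 2 * A / ε ^ 2 = 4 * K ^ 2 * B := by rw [hB]; ring
  have e2 : q * A / ε ^ 2 = q * B := by rw [hB]; ring
  rw [e1] at hT
  rw [e2]
  have h1 : (6 + 6 * C) * q * T ≤ (6 + 6 * C) * q * (4 * K ^ 2 * B + 1) := by gcongr
  have h2 : (6 + 6 * C) * q ≤ (6 + 6 * C) * X := by gcongr
  have h3 : 1 ≤ K ^ 2 := by nlinarith
  have h4 : (6 + 6 * C) * X * 1 ≤ (6 + 6 * C) * X * K ^ 2 := by gcongr
  have h5 : 0 ≤ K * (q * B) := by positivity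
  have h6 : 0 ≤ (1 + C) * K ^ 2 * X := by positivity
  nlinarith

/-- Resets number of order `1 / ε` and cost of order `1 / ε ^ 2` each, while about `1 / ε ^ 2`
iterations use batches of order `1 / ε`; both products are of order `1 / ε ^ 3`. -/
lemma evalCount_exp_le {lf lg Lf σg σg' σf' ε K C : ℝ} {T : ℕ} {a a' b : ℕ → ℕ} (hC : 0 ≤ C)
    (hK : 50 ≤ K) (hε : 0 < ε) (hεl : ε ≤ lf * lg)
    (hreset : ∀ t < T, t % expPeriod lf lg (ε / (2 * K)) = 0 →
      BatchOrder C (Lf ^ 2 * lg ^ 2 * σg ^ 2 / (ε / (2 * K)) ^ 2) (a t) ∧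
      BatchOrder C (lf ^ 2 * σg' ^ 2 / (ε / (2 * K)) ^ 2) (a' t) ∧
      BatchOrder C (lg ^ 2 * σf' ^ 2 / (ε / (2 * K)) ^ 2) (b t))
    (hsize : ∀ t < T, t % expPeriod lf lg (ε / (2 * K)) ≠ 0 →
      BatchOrderTau C (expPeriod lf lg (ε / (2 * K))) (a t) ∧
      BatchOrderTau C (expPeriod lf lg (ε / (2 * K))) (a' t) ∧
      BatchOrderTau C (expPeriod lf lg (ε / (2 * K))) (b t))
    {B : ℝ} (hT : T ≤ B / ε ^ 2) :
    (evalCount (expPeriod lf lg (ε / (2 * K))) a a' b T : ℝ) ≤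
      ((B / (K * (lf * lg)) + lf * lg) * (C * (4 * K ^ 2 * (Lf ^ 2 * lg ^ 2 * σg ^ 2 +
        lf ^ 2 * σg' ^ 2 + lg ^ 2 * σf' ^ 2) + 3 * (lf * lg) ^ 2)) +
          12 * C * K * (lf * lg) * B) / ε ^ 3 := by
  set q := lf * lg with hq
  have hq0 : 0 < q := hε.trans_le hεl
  set W := Lf ^ 2 * lg ^ 2 * σg ^ 2 + lf ^ 2 * σg' ^ 2 + lg ^ 2 * σf' ^ 2 with hW
  have hW0 : 0 ≤ W := by positivity
  set τ := expPeriod lf lg (ε / (2 * K)) with hτ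
  have hx : q / (ε / (2 * K)) = 2 * K * q / ε := by field_simp
  have hx1 : 1 ≤ 2 * K * q / ε := by rw [le_div_iff₀ hε]; nlinarith
  have hτ1 : K * q / ε ≤ τ := by
    have := half_le_floor hx1
    rw [hτ, expPeriod, ← hq, hx]
    refine le_trans (le_of_eq ?_) this
    ring
  have hτ2 : (τ : ℝ) ≤ 2 * K * q / ε := by
    rw [hτ, expPeriod, ← hq, hx]
    exact Nat.floor_le (by linarith)
  have hTB : (0 : ℝ) ≤ B := by
    have h0 : (0 : ℝ) ≤ B / ε ^ 2 := le_trans (Nat.cast_nonneg T) hT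
    have h1 := mul_nonneg h0 (sq_nonneg ε)
    rwa [div_mul_cancel₀ _ (by positivity)] at h1
  -- Absorbs the lower-order constants, which stem from positive batch sizes and from the initial
  -- reset, into negative powers of `ε`.
  have hεq : 1 ≤ q / ε := by rw [le_div_iff₀ hε]; linarith
  set R := C * (4 * K ^ 2 * W + 3 * q ^ 2) with hR
  have hR0 : 0 ≤ R := by positivity
  have h1 := evalCount_le (τ := τ) (T := T) (a := a) (a' := a') (b := b)
    (R := R / ε ^ 2) (M := 3 * C * (2 * K * q / ε)) (by positivity) (by positivity)
    (fun t ht h0 => by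
      obtain ⟨e₁, e₂, e₃⟩ := hreset t ht h0
      have e₄ : (a t + a' t + b t : ℝ) ≤ C * (4 * K ^ 2 * W / ε ^ 2 + 3) := by
        have := add_le_add (add_le_add e₁.2.2 e₂.2.2) e₃.2.2
        refine this.trans (le_of_eq ?_)
        rw [hW]; field_simp; ring
      refine e₄.trans ?_
      have e₅ : (1 : ℝ) ≤ (q / ε) ^ 2 := one_le_pow₀ hεq
      have e₆ : R / ε ^ 2 = C * (4 * K ^ 2 * W / ε ^ 2 + 3 * (q / ε) ^ 2) := by
        rw [hR]; field_simp
      rw [e₆]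
      gcongr
      linarith)
    (fun t ht h0 => by
      obtain ⟨e₁, e₂, e₃⟩ := hsize t ht h0
      have : C * (τ : ℝ) ≤ C * (2 * K * q / ε) := by gcongr
      linarith [e₁.2, e₂.2, e₃.2])
  have hK0 : 0 < K := by linarith
  have h2 : (T : ℝ) / τ + 1 ≤ (B / (K * q) + q) / ε := by
    have h3 : (T : ℝ) / τ ≤ (B / ε ^ 2) / (K * q / ε) := by gcongr
    have h4 : (B / ε ^ 2) / (K * q / ε) = B / (K * q) / ε := by field_simp
    rw [add_div]; linarith
  calc _ ≤ ((T : ℝ) / τ + 1) * (R / ε ^ 2) + 2 * (3 * C * (2 * K * q / ε)) * T := h1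
    _ ≤ ((B / (K * q) + q) / ε) * (R / ε ^ 2) +
        2 * (3 * C * (2 * K * q / ε)) * (B / ε ^ 2) := by gcongr
    _ = _ := by field_simp; ring

end

end MVRC

/-! ### The two problems together -/

open MVRC in
theorem theorem5 :
    -- the double finite-sum problem
    (∀ c C : ℝ, 0 < c → c ≤ 1 → 1 ≤ C → ∃ K : ℝ, 0 < K ∧
      ∀ (d p n N : ℕ) (lf lg Lf Lg : ℝ) (g : Fin n → Vec d → Vec p) (f : Fin N → Vec p → ℝ)
        (r : Vec d → ℝ) (x₀ : Vec d),
        0 < n → 0 < N → (n : ℝ) ≤ C * (N : ℝ) ^ 2 → (N : ℝ) ≤ C * (n : ℝ) ^ 2 →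
        SmoothLoss f lf Lf → SmoothMap g lg Lg → RegularObjective (sumObj g f) r →
        ∀ ε : ℝ, 0 < ε → ε < lf * lg / Real.sqrt (max N n : ℕ) →
          -- convergence
          (∀ (Ω : Type*) [MeasurableSpace Ω] (P : Measure Ω) [IsProbabilityMeasure P]
            (T : ℕ) (β : ℝ) (lam : ℕ → ℝ) (a a' b : ℕ → ℕ) (mode : Sampling)
            (S : (t : ℕ) → Ω → Batch (Fin n) (Fin N) (a t) (a' t) (b t)) (ζ : Ω → Fin T),
            SumRun P n N c C (LF lf lg Lf Lg) T β lam mode S ζ →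
            Integrable (outputNorm (dimParams (sumPeriod n N) ε β lam) g f (sumObj g f) r x₀ S ζ)
              P ∧
            ∫ ω, outputNorm (dimParams (sumPeriod n N) ε β lam) g f (sumObj g f) r x₀ S ζ ω ∂P
              ≤ K * (ε + LF lf lg Lf Lg * gap (sumObj g f) r x₀ / (ε * T))) ∧
          -- sample complexity
          (∃ (ε' : ℝ) (T : ℕ), 0 < ε' ∧ ε' ≤ ε ∧ 0 < T ∧
            ∀ (Ω : Type*) [MeasurableSpace Ω] (P : Measure Ω) [IsProbabilityMeasure P]
            (β : ℝ) (lam : ℕ → ℝ) (a a' b : ℕ → ℕ) (mode : Sampling)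
            (S : (t : ℕ) → Ω → Batch (Fin n) (Fin N) (a t) (a' t) (b t)) (ζ : Ω → Fin T),
            SumRun P n N c C (LF lf lg Lf Lg) T β lam mode S ζ →
            Integrable (outputNorm (dimParams (sumPeriod n N) ε' β lam) g f (sumObj g f) r x₀ S ζ)
              P ∧
            ∫ ω, outputNorm (dimParams (sumPeriod n N) ε' β lam) g f (sumObj g f) r x₀ S ζ ω ∂P
              ≤ ε ∧
            (evalCount (sumPeriod n N) a a' b T : ℝ) ≤
              K * (N + n + Real.sqrt (max N n : ℕ) *
                (LF lf lg Lf Lg * gap (sumObj g f) r x₀) / ε ^ 2))) ∧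
    -- the double expectation problem
    (∀ c C : ℝ, 0 < c → c ≤ 1 → 1 ≤ C →
      -- convergence
      (∃ K : ℝ, 0 < K ∧
        ∀ (d p : ℕ) (I J : Type*) [MeasurableSpace I] [MeasurableSpace J]
          (μ : Measure I) [IsProbabilityMeasure μ] (ν : Measure J) [IsProbabilityMeasure ν]
          (lf lg Lf Lg σg σg' σf' : ℝ) (g : I → Vec d → Vec p) (f : J → Vec p → ℝ)
          (r : Vec d → ℝ) (x₀ : Vec d),
          SmoothLoss f lf Lf → SmoothMap g lg Lg → RegularObjective (expObj μ ν g f) r →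
          BoundedVariance μ ν g f σg σg' σf' →
          ∀ ε : ℝ, 0 < ε → ε ≤ lf * lg →
          ∀ (Ω : Type*) [MeasurableSpace Ω] (P : Measure Ω) [IsProbabilityMeasure P]
            (T : ℕ) (β : ℝ) (lam : ℕ → ℝ) (a a' b : ℕ → ℕ)
            (S : (t : ℕ) → Ω → Batch I J (a t) (a' t) (b t)) (ζ : Ω → Fin T),
            ExpRun P μ ν c C lf lg Lf Lg σg σg' σf' ε T β lam S ζ →
            Integrable (outputNorm (dimParams (expPeriod lf lg ε) ε β lam) g f
              (expObj μ ν g f) r x₀ S ζ) P ∧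
            ∫ ω, outputNorm (dimParams (expPeriod lf lg ε) ε β lam) g f
              (expObj μ ν g f) r x₀ S ζ ω ∂P
              ≤ K * (ε + LF lf lg Lf Lg * gap (expObj μ ν g f) r x₀ / (ε * T))) ∧
      -- sample complexity
      (∀ lf lg Lf Lg σg σg' σf' D : ℝ, ∃ K : ℝ, 0 < K ∧
        ∀ (d p : ℕ) (I J : Type*) [MeasurableSpace I] [MeasurableSpace J]
          (μ : Measure I) [IsProbabilityMeasure μ] (ν : Measure J) [IsProbabilityMeasure ν]
          (g : I → Vec d → Vec p) (f : J → Vec p → ℝ) (r : Vec d → ℝ) (x₀ : Vec d),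
          SmoothLoss f lf Lf → SmoothMap g lg Lg → RegularObjective (expObj μ ν g f) r →
          BoundedVariance μ ν g f σg σg' σf' → gap (expObj μ ν g f) r x₀ ≤ D →
          ∀ ε : ℝ, 0 < ε → ε ≤ lf * lg →
          ∃ (ε' : ℝ) (T : ℕ), 0 < ε' ∧ ε' ≤ ε ∧ 0 < T ∧
            ∀ (Ω : Type*) [MeasurableSpace Ω] (P : Measure Ω) [IsProbabilityMeasure P]
            (β : ℝ) (lam : ℕ → ℝ) (a a' b : ℕ → ℕ)
            (S : (t : ℕ) → Ω → Batch I J (a t) (a' t) (b t)) (ζ : Ω → Fin T),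
            ExpRun P μ ν c C lf lg Lf Lg σg σg' σf' ε' T β lam S ζ →
            Integrable (outputNorm (dimParams (expPeriod lf lg ε') ε' β lam) g f
              (expObj μ ν g f) r x₀ S ζ) P ∧
            ∫ ω, outputNorm (dimParams (expPeriod lf lg ε') ε' β lam) g f
              (expObj μ ν g f) r x₀ S ζ ω ∂P ≤ ε ∧
            (evalCount (expPeriod lf lg ε') a a' b T : ℝ) ≤ K / ε ^ 3)) := by
  refine ⟨fun c C hc _ hC => ?_, fun c C hc _ hC => ⟨?_, ?_⟩⟩
  · have hC0 : 0 < C := by linarith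
    have hK := rateConst_ge hc hC0.le
    have hKpos : 0 < rateConst c C := by linarith
    have hsum : rateConst c C ≤ sumConst c C := by
      have : 0 ≤ 24 * (1 + C) * rateConst c C ^ 2 := by positivity
      unfold sumConst; linarith
    -- The larger complexity constant also serves for the convergence rate, so a single `K` covers
    -- both claims.
    refine ⟨sumConst c C, by linarith, ?_⟩
    intro d p n N lf lg Lf Lg g f r x₀ hn hN _ _ hf hg hFr ε hε hεl
    have hgap : 0 ≤ LF lf lg Lf Lg * gap (sumObj g f) r x₀ :=
      mul_nonneg (LF_nonneg hf hg) (gap_nonneg hFr x₀)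
    refine ⟨?_, ?_⟩
    · intro Ω _ P _ T β lam a a' b mode S ζ hR
      obtain ⟨h1, h2⟩ := integral_outputNorm_sumRun_le x₀ hc hC0 hn hN hf hg hFr hε hεl hR
      refine ⟨h1, h2.trans ?_⟩
      gcongr
    · set K := rateConst c C with hKdef
      have hε' : ε / (2 * K) ≤ ε := div_le_self hε.le (by linarith)
      refine ⟨ε / (2 * K), iterations K (LF lf lg Lf Lg * gap (sumObj g f) r x₀) ε, by positivity,
        hε', Nat.succ_pos _, ?_⟩
      intro Ω _ P _ β lam a a' b mode S ζ hR
      obtain ⟨h1, h2⟩ := integral_outputNorm_sumRun_le x₀ hc hC0 hn hN hf hg hFr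
        (by positivity) (hε'.trans_lt hεl) hR
      refine ⟨h1, h2.trans (rate_le hKpos hε), ?_⟩
      have hq : Real.sqrt (max N n : ℕ) ≤ (N : ℝ) + n := by
        have h3 := one_le_sqrt_max (n := n) hN
        have h4 := Real.mul_self_sqrt (Nat.cast_nonneg (α := ℝ) (max N n))
        have h5 : ((max N n : ℕ) : ℝ) ≤ (N : ℝ) + n := by
          exact_mod_cast max_le (Nat.le_add_right N n) (Nat.le_add_left n N)
        nlinarith
      exact sum_complexity_arith hK hC0.le hgap (Real.sqrt_nonneg _) hq
        (evalCount_sum_le hC0.le hN hR.size_reset hR.size) (iterations_le hgap)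
  · have hC0 : 0 < C := by linarith
    have hK := rateConst_ge hc hC0.le
    refine ⟨rateConst c C, by linarith, ?_⟩
    intro d p I J _ _ μ _ ν _ lf lg Lf Lg σg σg' σf' g f r x₀ hf hg hFr hV ε hε hεl
      Ω _ P _ T β lam a a' b S ζ hR
    exact integral_outputNorm_expRun_le x₀ hc hC0 hf hg hFr hV hε hεl hR
  · intro lf lg Lf Lg σg σg' σf' D
    have hC0 : 0 < C := by linarith
    have hK := rateConst_ge hc hC0.le
    have hKpos : 0 < rateConst c C := by linarith
    set K := rateConst c C with hKdef
    -- The summand `(lf * lg) ^ 2` pays for the rounding in the number of iterations, as `1 ≤ (lf *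
    -- lg / ε) ^ 2`.
    set B := 4 * K ^ 2 * (LF lf lg Lf Lg * D) + (lf * lg) ^ 2 with hB
    set K' := (B / (K * (lf * lg)) + lf * lg) * (C * (4 * K ^ 2 * (Lf ^ 2 * lg ^ 2 * σg ^ 2 +
      lf ^ 2 * σg' ^ 2 + lg ^ 2 * σf' ^ 2) + 3 * (lf * lg) ^ 2)) +
        12 * C * K * (lf * lg) * B with hK'
    -- The constant is fixed before the problem, for arbitrary real parameters, so `K'` by itself
    -- need not be positive.
    refine ⟨max K' 1, by positivity, ?_⟩
    intro d p I J _ _ μ _ ν _ g f r x₀ hf hg hFr hV hD ε hε hεl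
    have hLF := LF_nonneg hf hg
    have hgap : 0 ≤ LF lf lg Lf Lg * gap (expObj μ ν g f) r x₀ :=
      mul_nonneg hLF (gap_nonneg hFr x₀)
    have hε' : ε / (2 * K) ≤ ε := div_le_self hε.le (by linarith)
    refine ⟨ε / (2 * K), iterations K (LF lf lg Lf Lg * gap (expObj μ ν g f) r x₀) ε,
      by positivity, hε', Nat.succ_pos _, ?_⟩
    intro Ω _ P _ β lam a a' b S ζ hR
    obtain ⟨h1, h2⟩ := integral_outputNorm_expRun_le x₀ hc hC0 hf hg hFr hV
      (by positivity) (hε'.trans hεl) hR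
    refine ⟨h1, h2.trans (rate_le hKpos hε), ?_⟩
    have hT : (iterations K (LF lf lg Lf Lg * gap (expObj μ ν g f) r x₀) ε : ℝ) ≤ B / ε ^ 2 := by
      refine (iterations_le hgap).trans ?_
      rw [hB, add_div, ← div_pow]
      have h3 : 1 ≤ lf * lg / ε := by rw [le_div_iff₀ hε]; linarith
      have h4 : (1 : ℝ) ≤ (lf * lg / ε) ^ 2 := one_le_pow₀ h3
      gcongr
    refine (evalCount_exp_le hC0.le hK hε hεl hR.size_reset hR.size hT).trans ?_
    gcongr
    exact le_max_left _ _
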